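/- Let $\mathcal X\subseteq\mathbb R^d$ be compact, let $n\ge 1$, let $x_1,\dots,x_n\in\mathcal X$ be pairwise distinct and $y=(y_1,\dots,y_n)\in\mathbb R^n$. Let $\sigma(h)=\max\{h,0\}$ and, for $m\ge1$, consider the two-layer ReLU network of width $2m$, $$f^m_\theta(x)=\frac1{\sqrt m}\sum_{r=1}^{2m}a_r\,\sigma(\langle w_r,x\rangle+b_r)+b,\qquad \theta=(a_r,w_r,b_r,b)_{r\le 2m}.$$ At initialization, the entries of $(a_r(0),w_r(0),b_r(0))_{r\le m}$ are i.i.d. $\mathcal N(0,1)$, $a_{r+m}(0)=-a_r(0)$, $w_{r+m}(0)=w_r(0)$, $b_{r+m}(0)=b_r(0)$ for $r\le m$, and $b(0)=0$. All parameters are trained by the gradient flow $$\dot\theta(t)=-\frac1n\sum_{i=1}^n\bigl(f^m_{\theta(t)}(x_i)-y_i\bigr)\,\nabla_\theta f^m_{\theta(t)}(x_i),\qquad t\ge0,$$ of the loss $\frac1{2n}\sum_i(y_i-f^m_\theta(x_i))^2$. Since $\sigma$ is not differentiable at $0$, this is understood as a differential inclusion: $\theta$ is continuous and satisfies the integrated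 equation, where $\sigma'$ at the pre-activation of neuron $r$ on $x_i$ is, at each time, some element, chosen measurably in $t$, of the subdifferential of $\sigma$ (that is, $\{1\}$ on $(0,\infty)$, $\{0\}$ on $(-\infty,0)$, and $[0,1]$ at $0$). Let $$K_d(x,x')=\frac2\pi(\pi-\psi(x,x'))(\langle x,x'\rangle+1)+\frac1\pi\sqrt{\|x-x'\|^2+\|x\|^2\|x'\|^2-\langle x,x'\rangle^2}+1,$$ $$\psi(x,x')=\arccos\frac{\langle x,x'\rangle+1}{\sqrt{(\|x\|^2+1)(\|x'\|^2+1)}},$$ and, with $K=(K_d(x_i,x_j))_{i,j}$ and $K_d(x,X)=(K_d(x,x_1),\dots,K_d(x,x_n))$, let $$f^{\mathtt{NTK}}_t(x)=K_d(x,X)\,K^{-1}\bigl(I-e^{-\frac tn K}\bigr)y .$$ Then there is a sequence $p_m\to0$ such that for every $\epsilon>0$ and all sufficiently large $m$, with probability at least $1-p_m$ over the initialization, the gradient flow started at $\theta(0)$ has a solution on $[0,\infty)$, and every such solution satisfies $$\sup_{t\ge0}\ \sup_{x\in\mathcal X}\bigl|f^m_{\theta(t)}(x)-f^{\mathtt{NTK}}_t(x)\bigr|\le\epsilon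 .$$ -/

import Mathlib

open MeasureTheory ProbabilityTheory Filter Topology
open scoped RealInnerProductSpace

namespace WideReLU

noncomputable section

/-- Input vectors: `ℝ^d` with the Euclidean norm. -/
abbrev Input (d : ℕ) : Type := EuclideanSpace ℝ (Fin d)

/-! ### Two-layer ReLU networks -/

/-- All trainable parameters of a two-layer network with `N` hidden neurons on `ℝ^d`:
output weights `a r`, hidden weights `w r`, hidden biases `b r`, and the output bias `c`. -/
structure Params (N d : ℕ) where
  /-- output weights -/
  a : Fin N → ℝ
  /-- hidden weights -/
  w : Fin N → Input d
  /-- hidden biases -/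
  b : Fin N → ℝ
  /-- output bias -/
  c : ℝ

/-- The ReLU activation. -/
def relu (z : ℝ) : ℝ := max z 0

/-- The pre-activation `⟨w_r, z⟩ + b_r` of the `r`-th hidden neuron. -/
def preact {N d : ℕ} (θ : Params N d) (r : Fin N) (z : Input d) : ℝ :=
  ⟪θ.w r, z⟫ + θ.b r

/-- The network of width `N`:
`f_θ(z) = √(2/N) ∑_r a_r σ(⟨w_r, z⟩ + b_r) + c`. -/
def network {N d : ℕ} (θ : Params N d) (z : Input d) : ℝ :=
  √(2 / (N : ℝ)) * ∑ r, θ.a r * relu (preact θ r z) + θ.c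

/-! ### Gradient flow of the empirical loss -/

/-- The (Clarke) subdifferential of the ReLU at `z`: it is `{1}` for `z > 0`, `{0}` for `z < 0`,
and `[0, 1]` for `z = 0`. -/
def reluSubdiff (z : ℝ) : Set ℝ :=
  {s | 0 ≤ s ∧ s ≤ 1 ∧ (0 < z → s = 1) ∧ (z < 0 → s = 0)}

/-- The gradient of `θ ↦ f_θ(z)`, with `s r` standing for the derivative of the ReLU at the
pre-activation of the `r`-th neuron. -/
def networkGrad {N d : ℕ} (θ : Params N d) (z : Input d) (s : Fin N → ℝ) : Params N d where
  a := fun r => √(2 / (N : ℝ)) * relu (preact θ r z)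
  w := fun r => (√(2 / (N : ℝ)) * θ.a r * s r) • z
  b := fun r => √(2 / (N : ℝ)) * θ.a r * s r
  c := 1

/-- `θ : [0, ∞) → Params` is a trajectory of the gradient flow
`θ' = -∇ L(θ) = -(1/n) ∑ i, (f_θ(x_i) - y_i) ∇_θ f_θ(x_i)` of the empirical loss
`L(θ) = (1/(2n)) ∑ i, (y_i - f_θ(x_i))²`.

The right-hand side is discontinuous where a pre-activation vanishes, so, as usual for ReLU
networks, the equation is a differential inclusion for continuous (in fact absolutely
continuous) curves, written in integral form: the derivative of the ReLU is, at
every time, some element `s r i t` of its subdifferential, depending measurably on time.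
The choices `σ'(0) = 1` (activation indicator of `h ≥ 0`) and `σ'(0) = 0` are special cases.
Only the values `θ t` with `0 ≤ t` matter. -/
def IsGradientFlow {N d n : ℕ} (x : Fin n → Input d) (y : Fin n → ℝ)
    (θ : ℝ → Params N d) : Prop :=
  (∀ r, ContinuousOn (fun t => (θ t).a r) (Set.Ici 0)) ∧
  (∀ r, ContinuousOn (fun t => (θ t).w r) (Set.Ici 0)) ∧
  (∀ r, ContinuousOn (fun t => (θ t).b r) (Set.Ici 0)) ∧
  ContinuousOn (fun t => (θ t).c) (Set.Ici 0) ∧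
  ∃ s : Fin N → Fin n → ℝ → ℝ,
    (∀ r i, Measurable (s r i)) ∧
    (∀ r i, ∀ t, 0 ≤ t → s r i t ∈ reluSubdiff (preact (θ t) r (x i))) ∧
    ∀ t, 0 ≤ t →
      (∀ r, (θ t).a r = (θ 0).a r - ∫ τ in (0 : ℝ)..t, (1 / (n : ℝ)) *
        ∑ i, (network (θ τ) (x i) - y i) *
          (networkGrad (θ τ) (x i) (fun k => s k i τ)).a r) ∧
      (∀ r, (θ t).w r = (θ 0).w r - ∫ τ in (0 : ℝ)..t, (1 / (n : ℝ)) •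
        ∑ i, (network (θ τ) (x i) - y i) •
          (networkGrad (θ τ) (x i) (fun k => s k i τ)).w r) ∧
      (∀ r, (θ t).b r = (θ 0).b r - ∫ τ in (0 : ℝ)..t, (1 / (n : ℝ)) *
        ∑ i, (network (θ τ) (x i) - y i) *
          (networkGrad (θ τ) (x i) (fun k => s k i τ)).b r) ∧
      (θ t).c = (θ 0).c - ∫ τ in (0 : ℝ)..t, (1 / (n : ℝ)) *
        ∑ i, (network (θ τ) (x i) - y i) *
          (networkGrad (θ τ) (x i) (fun k => s k i τ)).c

/-! ### Random mirrored initialization -/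

/-- Sample space of the initialization: the parameters `(a_r, w_r, b_r)` of `m` neurons. -/
abbrev InitSample (d m : ℕ) : Type := Fin m → ℝ × (Fin d → ℝ) × ℝ

/-- The law of the initialization: all coordinates are independent standard Gaussians. -/
def initLaw (d m : ℕ) : Measure (InitSample d m) :=
  Measure.pi fun _ : Fin m =>
    (gaussianReal 0 1).prod
      ((Measure.pi fun _ : Fin d => gaussianReal 0 1).prod (gaussianReal 0 1))

/-- The mirrored initialization of a network of width `2m`: `a_{r+m} = -a_r`, `w_{r+m} = w_r`,
`b_{r+m} = b_r` for `r < m`, and zero output bias. -/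
def mirroredInit {d m : ℕ} (ω : InitSample d m) : Params (m + m) d where
  a := Fin.append (fun r => (ω r).1) (fun r => -(ω r).1)
  w := Fin.append (fun r => WithLp.toLp 2 (ω r).2.1) (fun r => WithLp.toLp 2 (ω r).2.1)
  b := Fin.append (fun r => (ω r).2.2) (fun r => (ω r).2.2)
  c := 0

/-! ### Neural tangent kernel regression -/

/-- The angle `ψ(z, z')` between `(z, 1)` and `(z', 1)`. -/
def ntkAngle {d : ℕ} (z z' : Input d) : ℝ :=
  Real.arccos ((⟪z, z'⟫ + 1) / √((‖z‖ ^ 2 + 1) * (‖z'‖ ^ 2 + 1)))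

/-- The neural tangent kernel `K_d` of the two-layer ReLU network. -/
def ntk {d : ℕ} (z z' : Input d) : ℝ :=
  2 / Real.pi * (Real.pi - ntkAngle z z') * (⟪z, z'⟫ + 1)
    + 1 / Real.pi * √(‖z - z'‖ ^ 2 + ‖z‖ ^ 2 * ‖z'‖ ^ 2 - ⟪z, z'⟫ ^ 2) + 1

/-- The Gram matrix `K_d(X, X)`. -/
def ntkGram {d n : ℕ} (x : Fin n → Input d) : Matrix (Fin n) (Fin n) ℝ :=
  Matrix.of fun i j => ntk (x i) (x j)

/-- The NTK regression function at time `t`: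
`f_t(z) = K_d(z, X) K_d(X, X)⁻¹ (I - exp(-(t/n) K_d(X, X))) y`. -/
def ntkRegression {d n : ℕ} (x : Fin n → Input d) (y : Fin n → ℝ) (t : ℝ) (z : Input d) : ℝ :=
  (fun i => ntk z (x i)) ⬝ᵥ
    Matrix.mulVec ((ntkGram x)⁻¹ * (1 - NormedSpace.exp (-(t / (n : ℝ)) • ntkGram x))) y

end

end WideReLU

namespace WideReLU

noncomputable section

/-! ### Existence of solutions of differential inclusions -/

section Inclusion

variable {V ι : Type*} [NormedAddCommGroup V] [NormedSpace ℝ V] [Fintype ι]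

/-- The Euler scheme of step `h` for `p' = ∑ k, 1[u k p ≥ 0] • g k p`. -/
def eulerNode (g : ι → V → V) (u : ι → V → ℝ) (p₀ : V) (h : ℝ) : ℕ → V
  | 0 => p₀
  | i + 1 => eulerNode g u p₀ h i + h • ∑ k, (if 0 ≤ u k (eulerNode g u p₀ h i) then (1 : ℝ) else 0) •
      g k (eulerNode g u p₀ h i)

/-- The time spent in `{u k ≥ 0}` by the first `i` steps of the Euler scheme. -/
def eulerTime (g : ι → V → V) (u : ι → V → ℝ) (p₀ : V) (h : ℝ) (k : ι) (i : ℕ) : ℝ :=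
  ∑ l ∈ Finset.range i, h * (if 0 ≤ u k (eulerNode g u p₀ h l) then (1 : ℝ) else 0)

variable {g : ι → V → V} {u : ι → V → ℝ} {p₀ : V} {h B : ℝ}

lemma eulerNode_sub (i j : ℕ) (hij : i ≤ j) :
    eulerNode g u p₀ h j - eulerNode g u p₀ h i = ∑ l ∈ Finset.Ico i j,
      h • ∑ k, (if 0 ≤ u k (eulerNode g u p₀ h l) then (1 : ℝ) else 0) •
        g k (eulerNode g u p₀ h l) := by
  induction j, hij using Nat.le_induction with
  | base => simp
  | succ j hj ih =>
    rw [Finset.sum_Ico_succ_top hj, ← ih]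
    conv_lhs => rw [eulerNode]
    abel

lemma eulerTime_sub (k : ι) (i j : ℕ) (hij : i ≤ j) :
    eulerTime g u p₀ h k j - eulerTime g u p₀ h k i = ∑ l ∈ Finset.Ico i j,
      h * (if 0 ≤ u k (eulerNode g u p₀ h l) then (1 : ℝ) else 0) := by
  rw [Finset.sum_Ico_eq_sub _ hij]; rfl

lemma norm_eulerNode_sub_le (hh : 0 ≤ h) (hB : ∀ k p, ‖g k p‖ ≤ B) (i j : ℕ) (hij : i ≤ j) :
    ‖eulerNode g u p₀ h j - eulerNode g u p₀ h i‖
      ≤ Fintype.card ι * B * (h * ((j : ℝ) - i)) := by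
  rw [eulerNode_sub i j hij]
  have : ∀ l ∈ Finset.Ico i j, ‖h • ∑ k, (if 0 ≤ u k (eulerNode g u p₀ h l) then (1 : ℝ) else 0) •
        g k (eulerNode g u p₀ h l)‖ ≤ h * (Fintype.card ι * B) := by
    intro l _
    rw [norm_smul, Real.norm_of_nonneg hh]
    gcongr
    refine (norm_sum_le _ _).trans ?_
    have : ∀ k ∈ (Finset.univ : Finset ι), ‖(if 0 ≤ u k (eulerNode g u p₀ h l) then (1 : ℝ) else 0) •
        g k (eulerNode g u p₀ h l)‖ ≤ B := by
      intro k _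
      have h0 : 0 ≤ B := (norm_nonneg _).trans (hB k p₀)
      split_ifs
      · simpa using hB k _
      · simpa using h0
    refine (Finset.sum_le_sum this).trans ?_
    simp
  refine (norm_sum_le_of_le _ this).trans ?_
  rw [Finset.sum_const, Nat.card_Ico, nsmul_eq_mul, Nat.cast_sub hij]
  exact le_of_eq (by ring)

lemma eulerTime_sub_mem (hh : 0 ≤ h) (k : ι) (i j : ℕ) (hij : i ≤ j) :
    0 ≤ eulerTime g u p₀ h k j - eulerTime g u p₀ h k i ∧
      eulerTime g u p₀ h k j - eulerTime g u p₀ h k i ≤ h * ((j : ℝ) - i) := by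
  rw [eulerTime_sub k i j hij]
  constructor
  · refine Finset.sum_nonneg fun l _ => ?_
    split_ifs <;> simp [hh]
  · have : ∀ l ∈ Finset.Ico i j, h * (if 0 ≤ u k (eulerNode g u p₀ h l) then (1 : ℝ) else 0) ≤ h := by
      intro l _
      split_ifs <;> simp [hh]
    refine (Finset.sum_le_sum this).trans ?_
    rw [Finset.sum_const, Nat.card_Ico, nsmul_eq_mul, Nat.cast_sub hij]
    exact le_of_eq (by ring)

lemma mul_floor_sub_le (hh : 0 < h) {s t : ℝ} (hst : s ≤ t) :
    h * ((⌊t / h⌋₊ : ℝ) - ⌊s / h⌋₊) ≤ t - s + h := by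
  rcases le_or_gt t 0 with ht | ht
  · have h1 : ⌊t / h⌋₊ = 0 := Nat.floor_of_nonpos (div_nonpos_of_nonpos_of_nonneg ht hh.le)
    have h2 : (0 : ℝ) ≤ h * ⌊s / h⌋₊ := by positivity
    rw [h1, mul_sub]
    simp only [Nat.cast_zero, mul_zero]
    linarith
  · have h1 : (⌊t / h⌋₊ : ℝ) ≤ t / h := Nat.floor_le (by positivity)
    have h2 : s / h < ⌊s / h⌋₊ + 1 := Nat.lt_floor_add_one _
    rw [le_div_iff₀ hh] at h1
    rw [div_lt_iff₀ hh] at h2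
    linarith

lemma floor_div_mono (hh : 0 < h) {s t : ℝ} (hst : s ≤ t) : ⌊s / h⌋₊ ≤ ⌊t / h⌋₊ :=
  Nat.floor_mono (by gcongr)

lemma tendsto_mul_floor {α : Type*} {l : Filter α} {h : α → ℝ} (hpos : ∀ a, 0 < h a)
    (hh : Tendsto h l (𝓝 0)) {t : ℝ} (ht : 0 ≤ t) :
    Tendsto (fun a => h a * (⌊t / h a⌋₊ : ℝ)) l (𝓝 t) := by
  have h0 : Tendsto (fun a => t - h a) l (𝓝 t) := by
    simpa using (tendsto_const_nhds (x := t)).sub hh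
  refine tendsto_of_tendsto_of_tendsto_of_le_of_le h0 tendsto_const_nhds ?_ ?_
  · intro a
    have h2 : t / h a < ⌊t / h a⌋₊ + 1 := Nat.lt_floor_add_one _
    rw [div_lt_iff₀ (hpos a)] at h2
    change t - h a ≤ h a * (⌊t / h a⌋₊ : ℝ)
    linarith
  · intro a
    have h1 : (⌊t / h a⌋₊ : ℝ) ≤ t / h a := Nat.floor_le (div_nonneg ht (hpos a).le)
    rw [le_div_iff₀ (hpos a)] at h1
    change h a * (⌊t / h a⌋₊ : ℝ) ≤ t
    linarith

/-- Existence of solutions of `p' = ∑ k, s k • g k p`, `s k ∈ reluSubdiff (u k p)`. -/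
theorem exists_inclusion_solution [ProperSpace V] (hg : ∀ k, Continuous (g k))
    (hB : ∀ k p, ‖g k p‖ ≤ B) (hu : ∀ k, Continuous (u k)) (p₀ : V) :
    ∃ θ : ℝ → V, Continuous θ ∧ θ 0 = p₀ ∧ ∃ s : ι → ℝ → ℝ, (∀ k, Measurable (s k)) ∧
      (∀ k t, 0 ≤ t → s k t ∈ reluSubdiff (u k (θ t))) ∧
      ∀ t, 0 ≤ t → θ t = p₀ + ∫ τ in (0 : ℝ)..t, ∑ k, s k τ • g k (θ τ) := by
  classical
  obtain ⟨C, hC0, hC⟩ : ∃ C : ℝ, 0 ≤ C ∧ (Fintype.card ι : ℝ) * B ≤ C := ⟨|(Fintype.card ι : ℝ) * B|, abs_nonneg _, le_abs_self _⟩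
  let U : Ultrafilter ℕ := hyperfilter ℕ
  have hU : (U : Filter ℕ) ≤ atTop := Nat.hyperfilter_le_atTop
  let η : ℕ → ℝ := fun m => 1 / ((m : ℝ) + 1)
  have hηpos : ∀ m, 0 < η m := fun m => by positivity
  have hη : Tendsto η U (𝓝 0) := tendsto_one_div_add_atTop_nhds_zero_nat.mono_left hU
  let q : ℕ → ℝ → ℕ := fun m t => ⌊t / η m⌋₊
  have hqm : ∀ m {s t : ℝ}, s ≤ t → q m s ≤ q m t := fun m s t hst => floor_div_mono (hηpos m) hst
  let P : ℕ → ℕ → V := fun m => eulerNode g u p₀ (η m)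
  let T : ℕ → ι → ℕ → ℝ := fun m => eulerTime g u p₀ (η m)
  have hP : ∀ m i j, i ≤ j → ‖P m j - P m i‖ ≤ C * (η m * ((j : ℝ) - i)) := by
    intro m i j hij
    refine (norm_eulerNode_sub_le (hηpos m).le hB i j hij).trans ?_
    have : (i : ℝ) ≤ j := by exact_mod_cast hij
    have := hηpos m
    gcongr
  have hPq : ∀ m {s t : ℝ}, s ≤ t → ‖P m (q m t) - P m (q m s)‖ ≤ C * (t - s + η m) := by
    intro m s t hst
    refine (hP m _ _ (hqm m hst)).trans ?_
    gcongr
    exact mul_floor_sub_le (hηpos m) hst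
  have hTq : ∀ m k {s t : ℝ}, s ≤ t → 0 ≤ T m k (q m t) - T m k (q m s) ∧
      T m k (q m t) - T m k (q m s) ≤ t - s + η m := by
    intro m k s t hst
    have := eulerTime_sub_mem (g := g) (u := u) (p₀ := p₀) (hηpos m).le k _ _ (hqm m hst)
    exact ⟨this.1, this.2.trans (mul_floor_sub_le (hηpos m) hst)⟩
  have hq0 : ∀ m, q m 0 = 0 := fun m => by simp [q]
  have hη1 : ∀ m, η m ≤ 1 := fun m => by
    simp only [η]; rw [div_le_one (by positivity)]; linarith [(Nat.cast_nonneg m : (0:ℝ) ≤ m)]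
  have hqneg : ∀ m {t : ℝ}, t ≤ 0 → q m t = 0 := fun m t ht =>
    Nat.floor_of_nonpos (div_nonpos_of_nonpos_of_nonneg ht (hηpos m).le)
  have exθ : ∀ t, ∃ p, Tendsto (fun m => P m (q m t)) U (𝓝 p) := by
    intro t
    have hmem : ∀ m, P m (q m t) ∈ Metric.closedBall p₀ (C * (|t| + 1)) := by
      intro m
      rw [mem_closedBall_iff_norm]
      rcases le_total t 0 with ht | ht
      · rw [hqneg m ht]; simp only [P, eulerNode, sub_self, norm_zero]; positivity
      · have := hPq m ht
        rw [hq0] at this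
        simp only [P, eulerNode] at this
        refine this.trans ?_
        gcongr
        · rw [sub_zero]; exact le_abs_self t
        · exact hη1 m
    obtain ⟨p, _, hp⟩ := (isCompact_closedBall p₀ (C * (|t| + 1))).ultrafilter_le_nhds'
      (U.map fun m => P m (q m t)) (Filter.mem_map.2 (Filter.univ_mem' hmem))
    exact ⟨p, hp⟩
  choose θ hθ using exθ
  have exS : ∀ k t, ∃ p, Tendsto (fun m => T m k (q m t)) U (𝓝 p) := by
    intro k t
    have hmem : ∀ m, T m k (q m t) ∈ Set.Icc (0 : ℝ) (|t| + 1) := by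
      intro m
      have hT0 : T m k 0 = 0 := by simp [T, eulerTime]
      rcases le_total t 0 with ht | ht
      · rw [hqneg m ht, hT0]; exact ⟨le_rfl, by positivity⟩
      · have := hTq m k ht
        rw [hq0, hT0] at this
        exact ⟨by linarith, by linarith [this.2, le_abs_self t, hη1 m]⟩
    obtain ⟨p, _, hp⟩ := (isCompact_Icc (a := (0 : ℝ)) (b := |t| + 1)).ultrafilter_le_nhds'
      (U.map fun m => T m k (q m t)) (Filter.mem_map.2 (Filter.univ_mem' hmem))
    exact ⟨p, hp⟩
  choose S hS using exS
  have hlin : ∀ c : ℝ, Tendsto (fun m => c + η m) U (𝓝 c) := fun c => by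
    simpa using (tendsto_const_nhds (x := c)).add hη
  have hθle : ∀ s t, s ≤ t → ‖θ t - θ s‖ ≤ C * (t - s) := fun s t hst =>
    le_of_tendsto_of_tendsto ((hθ t).sub (hθ s)).norm ((hlin (t - s)).const_mul C)
      (Eventually.of_forall fun m => hPq m hst)
  have hS0 : ∀ k s t, s ≤ t → S k s ≤ S k t := fun k s t hst =>
    le_of_tendsto_of_tendsto (hS k s) (hS k t)
      (Eventually.of_forall fun m => by have := (hTq m k hst).1; simpa using this)
  have hS1 : ∀ k s t, s ≤ t → S k t - S k s ≤ t - s := fun k s t hst =>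
    le_of_tendsto_of_tendsto ((hS k t).sub (hS k s)) (hlin (t - s))
      (Eventually.of_forall fun m => (hTq m k hst).2)
  have hθL : LipschitzWith ⟨C, hC0⟩ θ := by
    refine LipschitzWith.of_dist_le_mul fun s t => ?_
    rw [dist_eq_norm, Real.dist_eq]
    change _ ≤ C * |s - t|
    rcases le_total s t with hst | hst
    · rw [norm_sub_rev, abs_sub_comm, abs_of_nonneg (sub_nonneg.2 hst)]; exact hθle s t hst
    · rw [abs_of_nonneg (sub_nonneg.2 hst)]; exact hθle t s hst
  have hSL : ∀ k, LipschitzWith 1 (S k) := by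
    intro k
    refine LipschitzWith.of_dist_le_mul fun s t => ?_
    rw [Real.dist_eq, Real.dist_eq]
    simp only [NNReal.coe_one, one_mul]
    rcases le_total s t with hst | hst
    · rw [abs_sub_comm, abs_sub_comm s, abs_of_nonneg (sub_nonneg.2 hst), abs_of_nonneg (sub_nonneg.2 (hS0 k s t hst))]
      exact hS1 k s t hst
    · rw [abs_of_nonneg (sub_nonneg.2 hst), abs_of_nonneg (sub_nonneg.2 (hS0 k t s hst))]
      exact hS1 k t s hst
  -- nodes visited around time `t` are close to `θ t`
  have hloc : ∀ t, ∀ r > 0, ∃ δ > 0, ∀ᶠ m in (U : Filter ℕ),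
      ∀ l ∈ Finset.Ico (q m (t - δ)) (q m (t + δ)), ‖P m l - θ t‖ < r := by
    intro t r hr
    refine ⟨r / (8 * (C + 1)), by positivity, ?_⟩
    set δ := r / (8 * (C + 1)) with hδ
    have hCδ : C * δ ≤ r / 8 := by
      rw [hδ, ← mul_div_assoc, div_le_div_iff₀ (by positivity) (by positivity)]; nlinarith
    have h1 : ∀ᶠ m in (U : Filter ℕ), ‖P m (q m t) - θ t‖ < r / 4 := by
      have := (tendsto_iff_norm_sub_tendsto_zero.1 (hθ t))
      exact this.eventually_lt_const (by positivity)
    have h2 : ∀ᶠ m in (U : Filter ℕ), η m < r / (8 * (C + 1)) := hη.eventually_lt_const (by positivity)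
    filter_upwards [h1, h2] with m hm1 hm2 l hl
    have hCη : C * η m ≤ r / 8 := (mul_le_mul_of_nonneg_left hm2.le hC0).trans hCδ
    have hδ0 : 0 < δ := by positivity
    rw [Finset.mem_Ico] at hl
    have hspan : C * (η m * ((q m (t + δ) : ℝ) - q m (t - δ))) ≤ 3 * r / 8 := by
      have := mul_le_mul_of_nonneg_left
        (mul_floor_sub_le (hηpos m) (show t - δ ≤ t + δ by linarith)) hC0
      refine this.trans ?_
      have : C * (t + δ - (t - δ) + η m) = 2 * (C * δ) + C * η m := by ring
      linarith
    have hPl : ‖P m l - P m (q m t)‖ ≤ 3 * r / 8 := by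
      have hη0 := hηpos m
      have e1 : (l : ℝ) ≤ q m (t + δ) := by exact_mod_cast hl.2.le
      have e2 : (q m (t - δ) : ℝ) ≤ l := by exact_mod_cast hl.1
      have e3 : (q m (t - δ) : ℝ) ≤ q m t := by exact_mod_cast hqm m (by linarith)
      have e4 : (q m t : ℝ) ≤ q m (t + δ) := by exact_mod_cast hqm m (by linarith)
      rcases le_total l (q m t) with h | h
      · rw [norm_sub_rev]
        refine (hP m _ _ h).trans (le_trans ?_ hspan)
        gcongr
      · refine (hP m _ _ h).trans (le_trans ?_ hspan)
        gcongr
    calc ‖P m l - θ t‖ = ‖(P m l - P m (q m t)) + (P m (q m t) - θ t)‖ := by congr 1; abel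
      _ ≤ _ := norm_add_le _ _
      _ < r := by linarith
  have hder : ∀ t, ∀ ε > 0, ∃ δ > 0, ∀ a b, a ≤ b → t - δ ≤ a → b ≤ t + δ →
      ‖θ b - θ a - ∑ k, (S k b - S k a) • g k (θ t)‖ ≤ ε * (b - a) := by
    intro t ε hε
    have hcont : ∀ᶠ p in 𝓝 (θ t), ∀ k, ‖g k p - g k (θ t)‖ < ε / (Fintype.card ι + 1) := by
      rw [eventually_all]
      intro k
      have := (tendsto_iff_norm_sub_tendsto_zero.1 ((hg k).tendsto (θ t)))
      exact this.eventually_lt_const (by positivity)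
    obtain ⟨r, hr, hball⟩ := Metric.eventually_nhds_iff.1 hcont
    obtain ⟨δ, hδ, hev⟩ := hloc t r hr
    refine ⟨δ, hδ, fun a b hab ha hb => ?_⟩
    refine le_of_tendsto_of_tendsto ((((hθ b).sub (hθ a)).sub
      (tendsto_finsetSum _ fun k _ => ((hS k b).sub (hS k a)).smul_const (g k (θ t)))).norm)
      ((hlin (b - a)).const_mul ε) ?_
    filter_upwards [hev] with m hm
    have hη0 := hηpos m
    have hsub := hqm m hab
    have e1 := eulerNode_sub (g := g) (u := u) (p₀ := p₀) (h := η m) _ _ hsub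
    have e2 := fun k => eulerTime_sub (g := g) (u := u) (p₀ := p₀) (h := η m) k _ _ hsub
    have e3 : P m (q m b) - P m (q m a) - ∑ k, (T m k (q m b) - T m k (q m a)) • g k (θ t)
        = ∑ l ∈ Finset.Ico (q m a) (q m b), η m • ∑ k,
          (if 0 ≤ u k (P m l) then (1 : ℝ) else 0) • (g k (P m l) - g k (θ t)) := by
      rw [e1]
      simp_rw [T, e2, Finset.sum_smul, smul_sub, Finset.sum_sub_distrib, smul_sub, Finset.sum_sub_distrib]
      congr 1
      rw [Finset.sum_comm]
      simp_rw [Finset.smul_sum, mul_smul]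
      rfl
    rw [e3]
    have e4 : ∀ l ∈ Finset.Ico (q m a) (q m b), ‖η m • ∑ k,
          (if 0 ≤ u k (P m l) then (1 : ℝ) else 0) • (g k (P m l) - g k (θ t))‖ ≤ η m * ε := by
      intro l hl
      have hl' : l ∈ Finset.Ico (q m (t - δ)) (q m (t + δ)) := by
        rw [Finset.mem_Ico] at hl ⊢
        exact ⟨(hqm m ha).trans hl.1, hl.2.trans_le (hqm m hb)⟩
      have hclose := hball (by rw [dist_eq_norm]; exact hm l hl')
      rw [norm_smul, Real.norm_of_nonneg hη0.le]
      gcongr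
      refine (norm_sum_le _ _).trans ?_
      have : ∀ k ∈ (Finset.univ : Finset ι), ‖(if 0 ≤ u k (P m l) then (1 : ℝ) else 0) •
          (g k (P m l) - g k (θ t))‖ ≤ ε / (Fintype.card ι + 1) := by
        intro k _
        split_ifs
        · simpa using (hclose k).le
        · simp only [zero_smul, norm_zero]; positivity
      refine (Finset.sum_le_sum this).trans ?_
      rw [Finset.sum_const, Finset.card_univ, nsmul_eq_mul, mul_div_assoc', div_le_iff₀ (by positivity)]
      nlinarith
    refine (norm_sum_le_of_le _ e4).trans ?_
    rw [Finset.sum_const, Nat.card_Ico, nsmul_eq_mul, Nat.cast_sub hsub]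
    have := mul_floor_sub_le hη0 hab
    calc ((q m b : ℝ) - q m a) * (η m * ε) = ε * (η m * ((q m b : ℝ) - q m a)) := by ring
      _ ≤ _ := by gcongr
  have hsgn : ∀ k t c, (∀ᶠ p in 𝓝 (θ t), (if 0 ≤ u k p then (1 : ℝ) else 0) = c) → 0 < t →
      HasDerivAt (S k) c t := by
    intro k t c hc ht
    obtain ⟨r, hr, hball⟩ := Metric.eventually_nhds_iff.1 hc
    obtain ⟨δ, hδ, hev⟩ := hloc t r hr
    have key : ∀ a b, 0 ≤ a → a ≤ b → t - δ ≤ a → b ≤ t + δ → S k b - S k a = c * (b - a) := by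
      intro a b ha0 hab ha hb
      have l1 := (hS k b).sub (hS k a)
      have l2 : Tendsto (fun m => c * (η m * (q m b : ℝ) - η m * (q m a : ℝ))) U (𝓝 (c * (b - a))) :=
        ((tendsto_mul_floor hηpos hη (ha0.trans hab)).sub (tendsto_mul_floor hηpos hη ha0)).const_mul c
      refine tendsto_nhds_unique (l1.congr' ?_) l2
      filter_upwards [hev] with m hm
      have hsub := hqm m hab
      have e2 : T m k (q m b) - T m k (q m a) = _ := eulerTime_sub (g := g) (u := u) (p₀ := p₀) (h := η m) k _ _ hsub
      rw [e2]
      have : ∀ l ∈ Finset.Ico (q m a) (q m b),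
          η m * (if 0 ≤ u k (eulerNode g u p₀ (η m) l) then (1 : ℝ) else 0) = η m * c := by
        intro l hl
        have hl' : l ∈ Finset.Ico (q m (t - δ)) (q m (t + δ)) := by
          rw [Finset.mem_Ico] at hl ⊢
          exact ⟨(hqm m ha).trans hl.1, hl.2.trans_le (hqm m hb)⟩
        rw [hball (by rw [dist_eq_norm]; exact hm l hl')]
      rw [Finset.sum_congr rfl this, Finset.sum_const, Nat.card_Ico, nsmul_eq_mul, Nat.cast_sub hsub]
      ring
    have heq : S k =ᶠ[𝓝 t] fun b => S k t + c * (b - t) := by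
      have : Set.Ioo (max 0 (t - δ)) (t + δ) ∈ 𝓝 t :=
        Ioo_mem_nhds (max_lt ht (by linarith)) (by linarith)
      filter_upwards [this] with b hb
      have hb0 : 0 ≤ b := (le_max_left _ _).trans hb.1.le
      have hb1 : t - δ ≤ b := (le_max_right _ _).trans hb.1.le
      rcases le_total t b with h | h
      · linarith [key t b ht.le h (by linarith) hb.2.le]
      · linarith [key b t hb0 h hb1 (by linarith)]
    refine HasDerivAt.congr_of_eventuallyEq ?_ heq
    simpa using (((hasDerivAt_id t).sub_const t).const_mul c).const_add (S k t)
  let s : ι → ℝ → ℝ := fun k t => if t ≤ 0 then (if 0 ≤ u k (θ 0) then 1 else 0) else deriv (S k) t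
  have hsmeas : ∀ k, Measurable (s k) := fun k =>
    Measurable.ite measurableSet_Iic measurable_const (measurable_deriv _)
  have hssub : ∀ k t, 0 ≤ t → s k t ∈ reluSubdiff (u k (θ t)) := by
    intro k t ht
    rcases ht.eq_or_lt with rfl | ht
    · simp only [s, le_refl, if_true, reluSubdiff, Set.mem_ofPred_eq]
      split_ifs with h0
      · exact ⟨zero_le_one, le_rfl, fun _ => rfl, fun h => absurd h0 (not_le.2 h)⟩
      · exact ⟨le_rfl, zero_le_one, fun h => absurd h.le h0, fun _ => rfl⟩
    · simp only [s, not_le.2 ht, if_false, reluSubdiff, Set.mem_ofPred_eq]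
      refine ⟨Monotone.deriv_nonneg fun a b hab => hS0 k a b hab, ?_, fun hpos => ?_, fun hneg => ?_⟩
      · have := norm_deriv_le_of_lipschitz (x₀ := t) (hSL k)
        exact (le_abs_self _).trans (by simpa using this)
      · refine (hsgn k t 1 ?_ ht).deriv
        filter_upwards [(hu k).continuousAt.eventually (lt_mem_nhds hpos)] with p hp
        simp [hp.le]
      · refine (hsgn k t 0 ?_ ht).deriv
        filter_upwards [(hu k).continuousAt.eventually (gt_mem_nhds hneg)] with p hp
        simp [hp]
  have hθ0 : θ 0 = p₀ := by
    refine tendsto_nhds_unique (hθ 0) ?_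
    simp only [hq0, P, eulerNode]
    exact tendsto_const_nhds
  refine ⟨θ, hθL.continuous, hθ0, s, hsmeas, hssub, fun t ht => ?_⟩
  have hsb : ∀ k τ, ‖s k τ‖ ≤ 1 := by
    intro k τ
    by_cases hτ : τ ≤ 0
    · simp only [s, hτ, if_true]; split_ifs <;> simp
    · have := hssub k τ (not_le.1 hτ).le
      rw [Real.norm_of_nonneg this.1]
      exact this.2.1
  have hmeas : AEStronglyMeasurable (fun τ => ∑ k, s k τ • g k (θ τ)) (volume : Measure ℝ) := by
    refine Finset.aestronglyMeasurable_fun_sum _ fun k _ => ?_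
    exact (hsmeas k).aestronglyMeasurable.smul ((hg k).comp hθL.continuous).aestronglyMeasurable
  have hbd : ∀ τ, ‖∑ k, s k τ • g k (θ τ)‖ ≤ C := by
    intro τ
    refine le_trans ((norm_sum_le_of_le (f := fun k => s k τ • g k (θ τ)) (n := fun _ => B) Finset.univ fun k _ => ?_)) (le_trans (by simp) hC)
    rw [norm_smul]
    calc _ ≤ 1 * B := by gcongr; exact hsb k τ; exact hB k _
      _ = B := one_mul B
  have hint : ∀ a b, IntervalIntegrable (fun τ => ∑ k, s k τ • g k (θ τ)) volume a b := by
    intro a b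
    refine (intervalIntegrable_const (c := C)).mono_fun hmeas.restrict (Eventually.of_forall fun τ => ?_)
    exact (hbd τ).trans (le_abs_self _)
  have hloc_int : LocallyIntegrable (fun τ => ∑ k, s k τ • g k (θ τ)) (volume : Measure ℝ) := by
    refine (locallyIntegrable_const C).mono hmeas (Eventually.of_forall fun τ => ?_)
    exact (hbd τ).trans (le_abs_self _)
  let D : ℝ → V := fun t => θ t - ∫ τ in (0 : ℝ)..t, ∑ k, s k τ • g k (θ τ)
  have hIL : LipschitzWith ⟨C, hC0⟩ (fun t => ∫ τ in (0 : ℝ)..t, ∑ k, s k τ • g k (θ τ)) := by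
    refine LipschitzWith.of_dist_le_mul fun a b => ?_
    rw [dist_eq_norm, intervalIntegral.integral_interval_sub_left (hint _ _) (hint _ _), Real.dist_eq]
    exact intervalIntegral.norm_integral_le_of_norm_le_const fun τ _ => hbd τ
  have hDac : AbsolutelyContinuousOnInterval D 0 t :=
    (hθL.lipschitzOnWith.absolutelyContinuousOnInterval).sub
      (hIL.lipschitzOnWith.absolutelyContinuousOnInterval)
  have hdiffS : ∀ᵐ τ, ∀ k, DifferentiableAt ℝ (S k) τ := by
    rw [ae_all_iff]
    exact fun k => (hSL k).ae_differentiableAt_real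
  have hne : ∀ᵐ τ : ℝ, τ ≠ 0 := by simp [ae_iff, measure_singleton]
  have hD0 : ∀ᵐ τ, τ ∈ Set.uIcc 0 t → HasDerivAt D 0 τ := by
    filter_upwards [hdiffS, _root_.LocallyIntegrable.ae_hasDerivAt_integral hloc_int, hne] with τ h1 h2 h3 hτ
    rw [Set.uIcc_of_le ht] at hτ
    have hτ0 : 0 < τ := lt_of_le_of_ne hτ.1 (Ne.symm h3)
    have hsum : HasDerivAt (fun b => ∑ k, S k b • g k (θ τ)) (∑ k, s k τ • g k (θ τ)) τ := by
      refine HasDerivAt.fun_sum fun k _ => ?_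
      have : s k τ = deriv (S k) τ := by simp [s, not_le.2 hτ0]
      rw [this]
      exact (h1 k).hasDerivAt.smul_const _
    have hdiff : HasDerivAt (fun b => θ b - ∑ k, S k b • g k (θ τ)) 0 τ := by
      rw [hasDerivAt_iff_isLittleO, Asymptotics.isLittleO_iff]
      intro ε hε
      obtain ⟨δ, hδ, hh⟩ := hder τ ε hε
      filter_upwards [Icc_mem_nhds (show τ - δ < τ by linarith) (show τ < τ + δ by linarith)] with b hb
      have e : θ b - ∑ k, S k b • g k (θ τ) - (θ τ - ∑ k, S k τ • g k (θ τ)) - (b - τ) • (0 : V)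
          = θ b - θ τ - ∑ k, (S k b - S k τ) • g k (θ τ) := by
        simp_rw [sub_smul, Finset.sum_sub_distrib, smul_zero]; abel
      rw [e, Real.norm_eq_abs]
      rcases le_total τ b with h | h
      · rw [abs_of_nonneg (sub_nonneg.2 h)]
        exact hh τ b h (by linarith) hb.2
      · have := hh b τ h hb.1 (by linarith)
        rw [abs_sub_comm, abs_of_nonneg (sub_nonneg.2 h)]
        refine le_trans (le_of_eq ?_) this
        rw [← norm_neg]
        congr 1
        simp_rw [sub_smul, Finset.sum_sub_distrib]; abel
    have := (hdiff.add hsum).sub (h2 0)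
    refine (this.congr_deriv (by simp)).congr_of_eventuallyEq (Eventually.of_forall fun b => ?_)
    simp [D]
  obtain ⟨c, hc⟩ := hDac.const_of_ae_hasDerivAt_zero hD0
  have c0 := hc 0 Set.left_mem_uIcc
  have c1 := hc t Set.right_mem_uIcc
  simp only [D, intervalIntegral.integral_same, sub_zero] at c0 c1
  rw [← hθ0, c0, ← c1]
  abel

end Inclusion

/-! ### Absolutely continuous functions with a prescribed derivative -/

/-- `f` is absolutely continuous on `[0, T]` with derivative `f'` almost everywhere. -/
def HasACDeriv (f f' : ℝ → ℝ) (T : ℝ) : Prop :=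
  AbsolutelyContinuousOnInterval f 0 T ∧ ∀ᵐ t, t ∈ Set.Ioo 0 T → HasDerivAt f (f' t) t

namespace HasACDeriv

variable {f g f' g' : ℝ → ℝ} {T : ℝ}

lemma mono (hf : HasACDeriv f f' T) {t : ℝ} (h0 : 0 ≤ t) (ht : t ≤ T) : HasACDeriv f f' t := by
  refine ⟨hf.1.mono (Set.uIcc_subset_uIcc_left (by rw [Set.uIcc_of_le (h0.trans ht)]; exact ⟨h0, ht⟩)), ?_⟩
  filter_upwards [hf.2] with s hs hs'
  exact hs ⟨hs'.1, hs'.2.trans_le ht⟩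

lemma congr_deriv (hf : HasACDeriv f f' T) (h : ∀ t ∈ Set.Ioo 0 T, f' t = g' t) :
    HasACDeriv f g' T := by
  refine ⟨hf.1, ?_⟩
  filter_upwards [hf.2] with s hs hs'
  rw [← h s hs']; exact hs hs'

lemma add (hf : HasACDeriv f f' T) (hg : HasACDeriv g g' T) :
    HasACDeriv (fun t => f t + g t) (fun t => f' t + g' t) T := by
  refine ⟨hf.1.add hg.1, ?_⟩
  filter_upwards [hf.2, hg.2] with s h1 h2 hs using (h1 hs).add (h2 hs)

lemma sub (hf : HasACDeriv f f' T) (hg : HasACDeriv g g' T) :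
    HasACDeriv (fun t => f t - g t) (fun t => f' t - g' t) T := by
  refine ⟨hf.1.sub hg.1, ?_⟩
  filter_upwards [hf.2, hg.2] with s h1 h2 hs using (h1 hs).sub (h2 hs)

lemma mul (hf : HasACDeriv f f' T) (hg : HasACDeriv g g' T) :
    HasACDeriv (fun t => f t * g t) (fun t => f' t * g t + f t * g' t) T := by
  refine ⟨hf.1.mul hg.1, ?_⟩
  filter_upwards [hf.2, hg.2] with s h1 h2 hs using (h1 hs).mul (h2 hs)

lemma of_lipschitz {K : NNReal} (hf : LipschitzOnWith K f (Set.uIcc 0 T))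
    (h : ∀ᵐ t, t ∈ Set.Ioo 0 T → HasDerivAt f (f' t) t) : HasACDeriv f f' T :=
  ⟨hf.absolutelyContinuousOnInterval, h⟩

lemma of_contDiff (hf : ContDiff ℝ 1 f) (h : ∀ t, HasDerivAt f (f' t) t) : HasACDeriv f f' T :=
  ⟨hf.contDiffOn.absolutelyContinuousOnInterval, Eventually.of_forall fun t _ => h t⟩

lemma const (c : ℝ) : HasACDeriv (fun _ => c) (fun _ => 0) T :=
  of_contDiff contDiff_const fun t => hasDerivAt_const t c

lemma const_mul (c : ℝ) (hf : HasACDeriv f f' T) :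
    HasACDeriv (fun t => c * f t) (fun t => c * f' t) T :=
  ((const c).mul hf).congr_deriv fun t _ => by ring

lemma sum {ι : Type*} (S : Finset ι) {f f' : ι → ℝ → ℝ} (h : ∀ i ∈ S, HasACDeriv (f i) (f' i) T) :
    HasACDeriv (fun t => ∑ i ∈ S, f i t) (fun t => ∑ i ∈ S, f' i t) T := by
  classical
  induction S using Finset.induction_on with
  | empty => simpa using const 0
  | insert a S ha ih =>
    simp_rw [Finset.sum_insert ha]
    exact (h a (Finset.mem_insert_self _ _)).add (ih fun i hi => h i (Finset.mem_insert_of_mem hi))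

lemma le_of_deriv_nonpos (hf : HasACDeriv f f' T) (h : ∀ t ∈ Set.Ioo 0 T, f' t ≤ 0) {t : ℝ}
    (h0 : 0 ≤ t) (ht : t ≤ T) : f t ≤ f 0 := by
  have hf' := hf.mono h0 ht
  have e := hf'.1.integral_deriv_eq_sub
  have : ∫ s in (0 : ℝ)..t, deriv f s ≤ 0 := by
    have h1 : 0 ≤ ∫ s in (0 : ℝ)..t, -deriv f s := by
      refine intervalIntegral.integral_nonneg_of_ae_restrict h0 ?_
      rw [EventuallyLE, ae_restrict_iff' measurableSet_Icc]
      have n0 : ∀ᵐ s : ℝ, s ≠ 0 := by simp [ae_iff, measure_singleton]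
      have nt : ∀ᵐ s : ℝ, s ≠ t := by simp [ae_iff, measure_singleton]
      filter_upwards [hf'.2, n0, nt] with s hs h1 h2 hmem
      have hs' : s ∈ Set.Ioo 0 t := ⟨lt_of_le_of_ne hmem.1 h1.symm, lt_of_le_of_ne hmem.2 h2⟩
      rw [(hs hs').deriv]
      have := h s ⟨hs'.1, hs'.2.trans_le ht⟩
      simpa using this
    rw [intervalIntegral.integral_neg] at h1
    linarith
  linarith

lemma le_of_deriv_le (hf : HasACDeriv f f' T) (hg : HasACDeriv g g' T)
    (h : ∀ t ∈ Set.Ioo 0 T, f' t ≤ g' t) {t : ℝ} (h0 : 0 ≤ t) (ht : t ≤ T) :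
    f t - f 0 ≤ g t - g 0 := by
  have := (hf.sub hg).le_of_deriv_nonpos (fun s hs => by linarith [h s hs]) h0 ht
  linarith

lemma abs_sub_le (hf : HasACDeriv f f' T) (hg : HasACDeriv g g' T)
    (h : ∀ t ∈ Set.Ioo 0 T, |f' t| ≤ g' t) {t : ℝ} (h0 : 0 ≤ t) (ht : t ≤ T) :
    |f t - f 0| ≤ g t - g 0 := by
  rw [abs_le']
  refine ⟨hf.le_of_deriv_le hg (fun s hs => (le_abs_self _).trans (h s hs)) h0 ht, ?_⟩
  have := (hf.const_mul (-1)).le_of_deriv_le hg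
    (fun s hs => by have := (neg_le_abs _).trans (h s hs); linarith) h0 ht
  linarith

lemma exp_mul (c : ℝ) (hf : HasACDeriv f f' T) :
    HasACDeriv (fun t => Real.exp (c * t) * f t)
      (fun t => Real.exp (c * t) * (c * f t + f' t)) T := by
  have h1 : HasACDeriv (fun t => Real.exp (c * t)) (fun t => c * Real.exp (c * t)) T := by
    refine of_contDiff (by fun_prop) fun t => ?_
    have := ((hasDerivAt_id t).const_mul c).exp
    simpa [mul_comm] using this
  exact (h1.mul hf).congr_deriv fun t _ => by ring

end HasACDeriv

/-! ### Perturbed linear flows -/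

section LinearFlow

variable {n : ℕ} {K : Fin n → Fin n → ℝ} {lam κ T : ℝ} {e e₀ : Fin n → ℝ → ℝ}
  {H : Fin n → Fin n → ℝ → ℝ}

lemma sq_sum_abs_le (v : Fin n → ℝ) : (∑ i, |v i|) ^ 2 ≤ n * ∑ i, v i ^ 2 := by
  have := sq_sum_le_card_mul_sum_sq (s := (Finset.univ : Finset (Fin n))) (f := fun i => |v i|)
  simpa using this

lemma abs_sum_sum_mul_le (A : Fin n → Fin n → ℝ) (v w : Fin n → ℝ) (hA : ∀ i j, |A i j| ≤ κ) :
    |∑ i, ∑ j, v i * A i j * w j| ≤ κ * ((∑ i, |v i|) * ∑ j, |w j|) := by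
  refine (Finset.abs_sum_le_sum_abs _ _).trans ?_
  rw [Finset.sum_mul_sum, Finset.mul_sum]
  refine Finset.sum_le_sum fun i _ => (Finset.abs_sum_le_sum_abs _ _).trans ?_
  rw [Finset.mul_sum]
  refine Finset.sum_le_sum fun j _ => ?_
  rw [abs_mul, abs_mul]
  have := mul_le_mul_of_nonneg_left (hA i j) (mul_nonneg (abs_nonneg (v i)) (abs_nonneg (w j)))
  nlinarith

/-- Exponential decay of the residuals of a flow whose kernel is close to `K`. -/
lemma sum_sq_le_exp (hn : 0 < n)
    (hK : ∀ v : Fin n → ℝ, lam * ∑ i, v i ^ 2 ≤ ∑ i, ∑ j, v i * K i j * v j)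
    (he : ∀ i, HasACDeriv (e i) (fun t => -(1 / (n : ℝ)) * ∑ j, H i j t * e j t) T)
    (hH : ∀ t ∈ Set.Ioo 0 T, ∀ i j, |H i j t - K i j| ≤ κ) (hκ : n * κ ≤ lam / 2) (hκ0 : 0 ≤ κ)
    {t : ℝ} (h0 : 0 ≤ t) (ht : t ≤ T) :
    ∑ i, e i t ^ 2 ≤ Real.exp (-(lam / n * t)) * ∑ i, e i 0 ^ 2 := by
  have hn' : (0 : ℝ) < n := by exact_mod_cast hn
  have hS : HasACDeriv (fun t => ∑ i, e i t * e i t)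
      (fun t => ∑ i, (-(1 / (n : ℝ)) * (∑ j, H i j t * e j t) * e i t
        + e i t * (-(1 / (n : ℝ)) * ∑ j, H i j t * e j t))) T :=
    HasACDeriv.sum _ fun i _ => (he i).mul (he i)
  have key := (hS.exp_mul (lam / n)).le_of_deriv_nonpos (fun s hs => ?_) h0 ht
  · simp only [mul_zero, Real.exp_zero, one_mul] at key
    have hpos := Real.exp_pos (-(lam / n * t))
    have := mul_le_mul_of_nonneg_left key hpos.le
    rw [← mul_assoc, ← Real.exp_add, neg_add_cancel, Real.exp_zero, one_mul] at this
    simpa only [sq] using this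
  · refine mul_nonpos_of_nonneg_of_nonpos (Real.exp_pos _).le ?_
    set E := ∑ i, e i s ^ 2 with hE
    have e1 : ∑ i, e i s * e i s = E := Finset.sum_congr rfl fun i _ => by ring
    have e2 : ∑ i, (-(1 / (n : ℝ)) * (∑ j, H i j s * e j s) * e i s
        + e i s * (-(1 / (n : ℝ)) * ∑ j, H i j s * e j s))
        = -(2 / n) * (∑ i, ∑ j, e i s * K i j * e j s
          + ∑ i, ∑ j, e i s * (H i j s - K i j) * e j s) := by
      rw [← Finset.sum_add_distrib, Finset.mul_sum]
      refine Finset.sum_congr rfl fun i _ => ?_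
      rw [← Finset.sum_add_distrib]
      have : ∑ j, (e i s * K i j * e j s + e i s * (H i j s - K i j) * e j s)
          = e i s * ∑ j, H i j s * e j s := by
        rw [Finset.mul_sum]
        exact Finset.sum_congr rfl fun j _ => by ring
      rw [this]; ring
    rw [e1, e2]
    have h1 := hK fun i => e i s
    have h2 := abs_sum_sum_mul_le (fun i j => H i j s - K i j) (fun i => e i s) (fun i => e i s) (hH s hs)
    have h3 := sq_sum_abs_le fun i => e i s
    have h4 : κ * ((∑ i, |e i s|) * ∑ j, |e j s|) ≤ lam / 2 * E := by
      have hE0 : 0 ≤ E := Finset.sum_nonneg fun i _ => sq_nonneg _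
      calc _ = κ * (∑ i, |e i s|) ^ 2 := by ring
        _ ≤ κ * (n * E) := by gcongr
        _ = (n * κ) * E := by ring
        _ ≤ _ := by gcongr
    have h5 := (neg_le_abs _).trans (h2.trans h4)
    have h6 : lam / 2 * E ≤ ∑ i, ∑ j, e i s * K i j * e j s
          + ∑ i, ∑ j, e i s * (H i j s - K i j) * e j s := by linarith
    have h7 := mul_le_mul_of_nonneg_left h6 (show (0 : ℝ) ≤ 2 / n by positivity)
    have h8 : 2 / (n : ℝ) * (lam / 2 * E) = lam / n * E := by field_simp
    linarith

/-- Two flows with kernels `H` and `K` and the same initial residual stay close. -/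
lemma sum_sub_sq_le (hn : 0 < n) (hlam : 0 < lam)
    (hK : ∀ v : Fin n → ℝ, lam * ∑ i, v i ^ 2 ≤ ∑ i, ∑ j, v i * K i j * v j)
    (he : ∀ i, HasACDeriv (e i) (fun t => -(1 / (n : ℝ)) * ∑ j, H i j t * e j t) T)
    (he₀ : ∀ i, HasACDeriv (e₀ i) (fun t => -(1 / (n : ℝ)) * ∑ j, K i j * e₀ j t) T)
    (hinit : ∀ i, e i 0 = e₀ i 0)
    (hH : ∀ t ∈ Set.Ioo 0 T, ∀ i j, |H i j t - K i j| ≤ κ) (hκ : n * κ ≤ lam / 2) (hκ0 : 0 ≤ κ)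
    {t : ℝ} (h0 : 0 ≤ t) (ht : t ≤ T) :
    ∑ i, (e i t - e₀ i t) ^ 2
      ≤ 2 * (n * κ / lam) ^ 2 * (∑ i, e i 0 ^ 2) * Real.exp (-(lam / (2 * n) * t)) := by
  have hn' : (0 : ℝ) < n := by exact_mod_cast hn
  set Y := ∑ i, e i 0 ^ 2 with hY
  have hY0 : 0 ≤ Y := Finset.sum_nonneg fun i _ => sq_nonneg _
  have hdec := fun s (hs : s ∈ Set.Ioo 0 T) =>
    sum_sq_le_exp hn hK he hH hκ hκ0 hs.1.le hs.2.le
  have hW : HasACDeriv (fun t => ∑ i, (e i t - e₀ i t) * (e i t - e₀ i t))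
      (fun t => ∑ i, ((-(1 / (n : ℝ)) * (∑ j, H i j t * e j t)
        - -(1 / (n : ℝ)) * ∑ j, K i j * e₀ j t) * (e i t - e₀ i t)
        + (e i t - e₀ i t) * (-(1 / (n : ℝ)) * (∑ j, H i j t * e j t)
        - -(1 / (n : ℝ)) * ∑ j, K i j * e₀ j t))) T :=
    HasACDeriv.sum _ fun i _ => ((he i).sub (he₀ i)).mul ((he i).sub (he₀ i))
  have hlin : HasACDeriv (fun t => n * κ ^ 2 / lam * Y * t) (fun _ => n * κ ^ 2 / lam * Y) T := by
    refine HasACDeriv.of_contDiff (by fun_prop) fun t => ?_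
    simpa using (hasDerivAt_id t).const_mul (n * κ ^ 2 / lam * Y)
  have key := (hW.exp_mul (lam / n)).le_of_deriv_le hlin (fun s hs => ?_) h0 ht
  · simp only [mul_zero, Real.exp_zero, hinit, sub_self, Finset.sum_const_zero, sub_zero] at key
    set W := ∑ i, (e i t - e₀ i t) ^ 2 with hWd
    have eW : ∑ i, (e i t - e₀ i t) * (e i t - e₀ i t) = W :=
      Finset.sum_congr rfl fun i _ => by ring
    rw [eW] at key
    have hx : lam / (2 * n) * t ≤ Real.exp (lam / (2 * n) * t) := by
      linarith [Real.add_one_le_exp (lam / (2 * n) * t)]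
    have hsq : Real.exp (lam / n * t) = Real.exp (lam / (2 * n) * t) * Real.exp (lam / (2 * n) * t) := by
      rw [← Real.exp_add]; congr 1; field_simp; ring
    rw [Real.exp_neg]
    set X := Real.exp (lam / (2 * n) * t) with hX
    have hXpos : 0 < X := Real.exp_pos _
    rw [← div_eq_mul_inv, le_div_iff₀ hXpos]
    have h3 : X * W * X ≤ 2 * (n * κ / lam) ^ 2 * Y * X := by
      calc X * W * X = Real.exp (lam / n * t) * W := by rw [hsq]; ring
        _ ≤ n * κ ^ 2 / lam * Y * t := key
        _ = 2 * (n * κ / lam) ^ 2 * Y * (lam / (2 * n) * t) := by field_simp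
        _ ≤ _ := by gcongr
    nlinarith [le_of_mul_le_mul_right h3 hXpos]
  · set v : Fin n → ℝ := fun i => e i s - e₀ i s with hv
    have e2 : ∑ i, ((-(1 / (n : ℝ)) * (∑ j, H i j s * e j s)
        - -(1 / (n : ℝ)) * ∑ j, K i j * e₀ j s) * (e i s - e₀ i s)
        + (e i s - e₀ i s) * (-(1 / (n : ℝ)) * (∑ j, H i j s * e j s)
        - -(1 / (n : ℝ)) * ∑ j, K i j * e₀ j s))
        = -(2 / n) * (∑ i, ∑ j, v i * K i j * v j
          + ∑ i, ∑ j, v i * (H i j s - K i j) * e j s) := by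
      rw [← Finset.sum_add_distrib, Finset.mul_sum]
      refine Finset.sum_congr rfl fun i _ => ?_
      rw [← Finset.sum_add_distrib]
      have : ∑ j, (v i * K i j * v j + v i * (H i j s - K i j) * e j s)
          = v i * (∑ j, H i j s * e j s - ∑ j, K i j * e₀ j s) := by
        rw [← Finset.sum_sub_distrib, Finset.mul_sum]
        exact Finset.sum_congr rfl fun j _ => by simp only [hv]; ring
      rw [this]; simp only [hv]; ring
    have e1 : ∑ i, (e i s - e₀ i s) * (e i s - e₀ i s) = ∑ i, v i ^ 2 :=
      Finset.sum_congr rfl fun i _ => by simp only [hv]; ring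
    rw [e1, e2]
    set W := ∑ i, v i ^ 2 with hWd
    set E := ∑ i, e i s ^ 2 with hE
    have h1 := hK v
    have h2 := abs_sum_sum_mul_le (fun i j => H i j s - K i j) v (fun i => e i s) (hH s hs)
    have h3 := sq_sum_abs_le v
    have h3' := sq_sum_abs_le fun i => e i s
    have hAM : κ * ((∑ i, |v i|) * ∑ j, |e j s|) ≤ lam / 2 * W + n ^ 2 * κ ^ 2 / (2 * lam) * E := by
      set p := ∑ i, |v i|
      set r := ∑ j, |e j s|
      have g1 : κ * (p * r) ≤ lam / (2 * n) * p ^ 2 + n * κ ^ 2 / (2 * lam) * r ^ 2 := by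
        have : 0 ≤ (lam * p - n * κ * r) ^ 2 / (2 * n * lam) := by positivity
        have e : lam / (2 * n) * p ^ 2 + n * κ ^ 2 / (2 * lam) * r ^ 2 - κ * (p * r)
          = (lam * p - n * κ * r) ^ 2 / (2 * n * lam) := by field_simp; ring
        linarith
      have g2 : lam / (2 * n) * p ^ 2 ≤ lam / (2 * n) * (n * W) := by gcongr
      have g3 : n * κ ^ 2 / (2 * lam) * r ^ 2 ≤ n * κ ^ 2 / (2 * lam) * (n * E) := by gcongr
      have g4 : lam / (2 * n) * (n * W) = lam / 2 * W := by field_simp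
      have g5 : n * κ ^ 2 / (2 * lam) * (n * E) = n ^ 2 * κ ^ 2 / (2 * lam) * E := by ring
      linarith
    have h5 := (neg_le_abs _).trans (h2.trans hAM)
    have h6 : lam / 2 * W - n ^ 2 * κ ^ 2 / (2 * lam) * E ≤ ∑ i, ∑ j, v i * K i j * v j
          + ∑ i, ∑ j, v i * (H i j s - K i j) * e j s := by linarith
    have h7 := mul_le_mul_of_nonneg_left h6 (show (0 : ℝ) ≤ 2 / n by positivity)
    have h8 : 2 / (n : ℝ) * (lam / 2 * W - n ^ 2 * κ ^ 2 / (2 * lam) * E)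
      = lam / n * W - n * κ ^ 2 / lam * E := by field_simp
    have h9 : Real.exp (lam / n * s) * E ≤ Y := by
      have := mul_le_mul_of_nonneg_left (hdec s hs) (Real.exp_pos (lam / n * s)).le
      rwa [← mul_assoc, ← Real.exp_add, add_neg_cancel, Real.exp_zero, one_mul] at this
    calc _ ≤ Real.exp (lam / n * s) * (n * κ ^ 2 / lam * E) := by
          gcongr; linarith
      _ = n * κ ^ 2 / lam * (Real.exp (lam / n * s) * E) := by ring
      _ ≤ _ := by gcongr

/-- Two predictors driven by the residuals of `sum_sub_sq_le` stay uniformly close. -/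
lemma abs_sub_le_of_flow (hn : 0 < n) (hlam : 0 < lam)
    (hK : ∀ v : Fin n → ℝ, lam * ∑ i, v i ^ 2 ≤ ∑ i, ∑ j, v i * K i j * v j)
    (he : ∀ i, HasACDeriv (e i) (fun t => -(1 / (n : ℝ)) * ∑ j, H i j t * e j t) T)
    (he₀ : ∀ i, HasACDeriv (e₀ i) (fun t => -(1 / (n : ℝ)) * ∑ j, K i j * e₀ j t) T)
    (hinit : ∀ i, e i 0 = e₀ i 0)
    (hH : ∀ t ∈ Set.Ioo 0 T, ∀ i j, |H i j t - K i j| ≤ κ) (hκ : n * κ ≤ lam / 2) (hκ0 : 0 ≤ κ)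
    {F F₀ : ℝ → ℝ} {k : Fin n → ℝ} {G : Fin n → ℝ → ℝ} {L Y : ℝ} (hY0 : 0 ≤ Y)
    (hY : ∑ i, e i 0 ^ 2 ≤ Y ^ 2) (hk : ∀ j, |k j| ≤ L)
    (hF : HasACDeriv F (fun t => -(1 / (n : ℝ)) * ∑ j, G j t * e j t) T)
    (hF₀ : HasACDeriv F₀ (fun t => -(1 / (n : ℝ)) * ∑ j, k j * e₀ j t) T)
    (hG : ∀ t ∈ Set.Ioo 0 T, ∀ j, |G j t - k j| ≤ κ) (hFinit : F 0 = F₀ 0)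
    {t : ℝ} (h0 : 0 ≤ t) (ht : t ≤ T) :
    |F t - F₀ t| ≤ κ * ((Y + L * (2 * (n / lam) * Y)) * (4 * n / lam)) := by
  have hn' : (0 : ℝ) < n := by exact_mod_cast hn
  have hL : 0 ≤ L := (abs_nonneg _).trans (hk ⟨0, hn⟩)
  set A := κ * (Y + L * (2 * (n / lam) * Y)) with hA
  have hA0 : 0 ≤ A := by positivity
  have hexp : HasACDeriv (fun t => -(A * (4 * n / lam)) * Real.exp (-(lam / (4 * n)) * t))
      (fun t => A * Real.exp (-(lam / (4 * n)) * t)) T := by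
    refine HasACDeriv.of_contDiff (by fun_prop) fun t => ?_
    have := (((hasDerivAt_id t).const_mul (-(lam / (4 * n)))).exp).const_mul (-(A * (4 * n / lam)))
    refine this.congr_deriv ?_
    simp only [id]; field_simp
  have key := (hF.sub hF₀).abs_sub_le hexp (fun s hs => ?_) h0 ht
  · simp only [hFinit, sub_self, sub_zero, mul_zero, Real.exp_zero, mul_one] at key
    refine key.trans ?_
    have : 0 ≤ A * (4 * n / lam) * Real.exp (-(lam / (4 * n)) * t) := by positivity
    have e : κ * ((Y + L * (2 * (n / lam) * Y)) * (4 * n / lam)) = A * (4 * n / lam) := by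
      rw [hA]; ring
    rw [e]; linarith
  · set X := Real.exp (-(lam / (4 * n)) * s) with hX
    have hXpos : 0 < X := Real.exp_pos _
    have hX1 : X ≤ 1 := Real.exp_le_one_iff.2 (by
      have : 0 ≤ lam / (4 * n) * s := by have := hs.1.le; positivity
      linarith)
    have hX2 : Real.exp (-(lam / (2 * n) * s)) = X ^ 2 := by
      rw [hX, sq, ← Real.exp_add]; congr 1; field_simp; ring
    have hX4 : Real.exp (-(lam / n * s)) = X ^ 4 := by
      rw [hX, ← Real.exp_nat_mul]; congr 1; push_cast; field_simp
    have d1 := sum_sq_le_exp hn hK he hH hκ hκ0 hs.1.le hs.2.le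
    have d2 := sum_sub_sq_le hn hlam hK he he₀ hinit hH hκ hκ0 hs.1.le hs.2.le
    rw [hX4] at d1
    rw [hX2] at d2
    have b1 : ∑ j, |e j s| ≤ n * (Y * X) := by
      refine abs_le_of_sq_le_sq' ?_ (by positivity) |>.2
      refine (sq_sum_abs_le fun i => e i s).trans ?_
      have : ∑ i, e i s ^ 2 ≤ X ^ 4 * Y ^ 2 := d1.trans (by gcongr)
      have hX42 : X ^ 4 ≤ X ^ 2 := pow_le_pow_of_le_one hXpos.le hX1 (by norm_num)
      have hn1 : (1 : ℝ) ≤ n := by exact_mod_cast hn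
      calc (n : ℝ) * ∑ i, e i s ^ 2 ≤ n * (X ^ 2 * Y ^ 2) := by
            gcongr; exact this.trans (by gcongr)
        _ ≤ n ^ 2 * (X ^ 2 * Y ^ 2) := by
            gcongr; nlinarith
        _ = _ := by ring
    have b2 : ∑ j, |e j s - e₀ j s| ≤ n * (2 * (n * κ / lam) * Y * X) := by
      refine abs_le_of_sq_le_sq' ?_ (by positivity) |>.2
      refine (sq_sum_abs_le fun i => e i s - e₀ i s).trans ?_
      have hn1 : (1 : ℝ) ≤ n := by exact_mod_cast hn
      calc (n : ℝ) * ∑ i, (e i s - e₀ i s) ^ 2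
          ≤ n * (2 * (n * κ / lam) ^ 2 * Y ^ 2 * X ^ 2) := by
            gcongr; exact d2.trans (by gcongr)
        _ ≤ n ^ 2 * (4 * (n * κ / lam) ^ 2 * Y ^ 2 * X ^ 2) := by
            gcongr
            · nlinarith
            · norm_num
        _ = _ := by ring
    have e1 : -(1 / (n : ℝ)) * (∑ j, G j s * e j s) - -(1 / (n : ℝ)) * ∑ j, k j * e₀ j s
        = -(1 / (n : ℝ)) * (∑ j, (G j s - k j) * e j s + ∑ j, k j * (e j s - e₀ j s)) := by
      rw [← Finset.sum_add_distrib, ← mul_sub, ← Finset.sum_sub_distrib]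
      congr 1
      exact Finset.sum_congr rfl fun j _ => by ring
    rw [e1, abs_mul, abs_neg, abs_of_pos (by positivity : (0 : ℝ) < 1 / n)]
    have c1 : |∑ j, (G j s - k j) * e j s| ≤ κ * (n * (Y * X)) := by
      refine (Finset.abs_sum_le_sum_abs _ _).trans (le_trans ?_ (mul_le_mul_of_nonneg_left b1 hκ0))
      rw [Finset.mul_sum]
      refine Finset.sum_le_sum fun j _ => ?_
      rw [abs_mul]
      gcongr
      exact hG s hs j
    have c2 : |∑ j, k j * (e j s - e₀ j s)| ≤ L * (n * (2 * (n * κ / lam) * Y * X)) := by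
      refine (Finset.abs_sum_le_sum_abs _ _).trans (le_trans ?_ (mul_le_mul_of_nonneg_left b2 hL))
      rw [Finset.mul_sum]
      refine Finset.sum_le_sum fun j _ => ?_
      rw [abs_mul]
      gcongr
      exact hk j
    calc _ ≤ 1 / (n : ℝ) * (κ * (n * (Y * X)) + L * (n * (2 * (n * κ / lam) * Y * X))) := by
          gcongr; exact (abs_add_le _ _).trans (add_le_add c1 c2)
      _ = A * X := by rw [hA]; field_simp

end LinearFlow

/-! ### The Euclidean space of parameters -/

/-- The `ℓ²` product underlying `ParamSpace`. -/
abbrev ParamProd (N d : ℕ) : Type :=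
  WithLp 2 (EuclideanSpace ℝ (Fin N) × WithLp 2 (PiLp 2 (fun _ : Fin N => Input d) ×
    WithLp 2 (EuclideanSpace ℝ (Fin N) × ℝ)))

/-- `Params N d` as a Euclidean space. -/
def ParamSpace (N d : ℕ) : Type := ParamProd N d

instance (N d : ℕ) : NormedAddCommGroup (ParamSpace N d) :=
  inferInstanceAs (NormedAddCommGroup (ParamProd N d))

instance (N d : ℕ) : InnerProductSpace ℝ (ParamSpace N d) :=
  inferInstanceAs (InnerProductSpace ℝ (ParamProd N d))

instance (N d : ℕ) : FiniteDimensional ℝ (ParamSpace N d) :=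
  inferInstanceAs (FiniteDimensional ℝ (ParamProd N d))

instance (N d : ℕ) : ProperSpace (ParamSpace N d) := FiniteDimensional.proper ℝ _

section ParamSpace

variable {N d : ℕ}

/-- The parameters as a vector. -/
def toSpace (p : Params N d) : ParamSpace N d :=
  (WithLp.toLp 2 (WithLp.toLp 2 p.a, WithLp.toLp 2 (WithLp.toLp 2 p.w,
    WithLp.toLp 2 (WithLp.toLp 2 p.b, p.c))) : ParamProd N d)

/-- The output weight of neuron `r`. -/
def projA (r : Fin N) : ParamSpace N d →L[ℝ] ℝ :=
  ((PiLp.proj 2 (fun _ : Fin N => ℝ) r : EuclideanSpace ℝ (Fin N) →L[ℝ] ℝ) ∘L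
    WithLp.fstL 2 ℝ _ _ : ParamProd N d →L[ℝ] ℝ)

/-- The hidden weight of neuron `r`. -/
def projW (r : Fin N) : ParamSpace N d →L[ℝ] Input d :=
  ((PiLp.proj 2 (fun _ : Fin N => Input d) r) ∘L WithLp.fstL 2 ℝ _ _ ∘L WithLp.sndL 2 ℝ _ _ :
    ParamProd N d →L[ℝ] Input d)

/-- The hidden bias of neuron `r`. -/
def projB (r : Fin N) : ParamSpace N d →L[ℝ] ℝ :=
  ((PiLp.proj 2 (fun _ : Fin N => ℝ) r : EuclideanSpace ℝ (Fin N) →L[ℝ] ℝ) ∘L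
    WithLp.fstL 2 ℝ _ _ ∘L WithLp.sndL 2 ℝ _ _ ∘L WithLp.sndL 2 ℝ _ _ : ParamProd N d →L[ℝ] ℝ)

/-- The output bias. -/
def projC : ParamSpace N d →L[ℝ] ℝ :=
  (WithLp.sndL 2 ℝ _ _ ∘L WithLp.sndL 2 ℝ _ _ ∘L WithLp.sndL 2 ℝ _ _ : ParamProd N d →L[ℝ] ℝ)

/-- A vector of `ParamSpace` as parameters. -/
def ofSpace (v : ParamSpace N d) : Params N d where
  a := fun r => projA r v
  w := fun r => projW r v
  b := fun r => projB r v
  c := projC v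

@[simp] lemma projA_toSpace (p : Params N d) (r : Fin N) : projA r (toSpace p) = p.a r := rfl
@[simp] lemma projW_toSpace (p : Params N d) (r : Fin N) : projW r (toSpace p) = p.w r := rfl
@[simp] lemma projB_toSpace (p : Params N d) (r : Fin N) : projB r (toSpace p) = p.b r := rfl
@[simp] lemma projC_toSpace (p : Params N d) : projC (toSpace p) = p.c := rfl
@[simp] lemma ofSpace_toSpace (p : Params N d) : ofSpace (toSpace p) = p := rfl
@[simp] lemma ofSpace_a (v : ParamSpace N d) (r : Fin N) : (ofSpace v).a r = projA r v := rfl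
@[simp] lemma ofSpace_w (v : ParamSpace N d) (r : Fin N) : (ofSpace v).w r = projW r v := rfl
@[simp] lemma ofSpace_b (v : ParamSpace N d) (r : Fin N) : (ofSpace v).b r = projB r v := rfl
@[simp] lemma ofSpace_c (v : ParamSpace N d) : (ofSpace v).c = projC v := rfl

lemma paramSpace_ext {v w : ParamSpace N d} (ha : ∀ r, projA r v = projA r w)
    (hw : ∀ r, projW r v = projW r w) (hb : ∀ r, projB r v = projB r w)
    (hc : projC v = projC w) : v = w := by
  have h : ofSpace v = ofSpace w := by
    simp only [ofSpace]
    simp_rw [ha, hw, hb, hc]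
  exact congrArg toSpace h

lemma inner_paramProd (v w : ParamProd N d) :
    ⟪v, w⟫ = ∑ r, (v.fst r * w.fst r + ⟪v.snd.fst r, w.snd.fst r⟫ + v.snd.snd.fst r * w.snd.snd.fst r)
      + v.snd.snd.snd * w.snd.snd.snd := by
  rw [WithLp.prod_inner_apply, WithLp.prod_inner_apply, WithLp.prod_inner_apply,
    PiLp.inner_apply, PiLp.inner_apply, PiLp.inner_apply]
  simp only [Finset.sum_add_distrib]
  have e : ∀ a b : ℝ, inner ℝ a b = a * b := fun a b => by simp [mul_comm]
  simp_rw [e]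
  simp only [← add_assoc]
  rfl

lemma inner_eq (v w : ParamSpace N d) :
    ⟪v, w⟫ = ∑ r, (projA r v * projA r w + ⟪projW r v, projW r w⟫ + projB r v * projB r w)
      + projC v * projC w :=
  inner_paramProd (N := N) (d := d) v w

lemma norm_sq_eq (v : ParamSpace N d) :
    ‖v‖ ^ 2 = ∑ r, (projA r v ^ 2 + ‖projW r v‖ ^ 2 + projB r v ^ 2) + projC v ^ 2 := by
  rw [← real_inner_self_eq_norm_sq, inner_eq]
  simp only [real_inner_self_eq_norm_sq, sq]

lemma continuous_toSpace {X : Type*} [TopologicalSpace X] {p : X → Params N d}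
    (ha : ∀ r, Continuous fun t => (p t).a r) (hw : ∀ r, Continuous fun t => (p t).w r)
    (hb : ∀ r, Continuous fun t => (p t).b r) (hc : Continuous fun t => (p t).c) :
    Continuous fun t => toSpace (p t) := by
  unfold toSpace
  refine (WithLp.prod_continuous_toLp 2 _ _).comp (Continuous.prodMk ?_
    ((WithLp.prod_continuous_toLp 2 _ _).comp (Continuous.prodMk ?_
      ((WithLp.prod_continuous_toLp 2 _ _).comp (Continuous.prodMk ?_ hc)))))
  · exact (PiLp.continuous_toLp 2 _).comp (continuous_pi ha)
  · exact (PiLp.continuous_toLp 2 _).comp (continuous_pi hw)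
  · exact (PiLp.continuous_toLp 2 _).comp (continuous_pi hb)

/-- The pre-activation as a linear function of the parameters. -/
def preactL (r : Fin N) (z : Input d) : ParamSpace N d →L[ℝ] ℝ :=
  innerSL ℝ z ∘L projW r + projB r

lemma preact_ofSpace (v : ParamSpace N d) (r : Fin N) (z : Input d) :
    preact (ofSpace v) r z = preactL r z v := by
  simp [preact, preactL, real_inner_comm]

lemma continuous_relu : Continuous relu := by unfold relu; fun_prop

/-- The gradient of the network as a vector. -/
def gradVec (v : ParamSpace N d) (z : Input d) (s : Fin N → ℝ) : ParamSpace N d :=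
  toSpace (networkGrad (ofSpace v) z s)

lemma continuous_gradVec (z : Input d) :
    Continuous fun q : ParamSpace N d × (Fin N → ℝ) => gradVec q.1 z q.2 := by
  unfold gradVec
  refine continuous_toSpace (fun r => ?_) (fun r => ?_) (fun r => ?_) ?_
  · simp only [networkGrad, preact_ofSpace]
    exact continuous_const.mul (continuous_relu.comp (by fun_prop))
  · simp only [networkGrad, ofSpace_a]; fun_prop
  · simp only [networkGrad, ofSpace_a]; fun_prop
  · simp only [networkGrad]; fun_prop

lemma continuous_network (z : Input d) :
    Continuous fun v : ParamSpace N d => network (ofSpace v) z := by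
  unfold network
  simp only [preact_ofSpace, ofSpace_a, ofSpace_c]
  refine (continuous_const.mul (continuous_finsetSum _ fun r _ => ?_)).add (by fun_prop)
  exact (by fun_prop : Continuous fun v : ParamSpace N d => projA r v).mul
    (continuous_relu.comp (by fun_prop))

lemma inner_gradVec (v : ParamSpace N d) (z z' : Input d) (s s' : Fin N → ℝ) :
    ⟪gradVec v z s, gradVec v z' s'⟫ = 2 / (N : ℝ) *
      ∑ r, (relu (preact (ofSpace v) r z) * relu (preact (ofSpace v) r z')
        + projA r v ^ 2 * s r * s' r * (⟪z, z'⟫ + 1)) + 1 := by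
  rw [inner_eq]
  simp only [gradVec, projA_toSpace, projW_toSpace, projB_toSpace, projC_toSpace, networkGrad,
    inner_smul_left, inner_smul_right, ofSpace_a]
  rw [Finset.mul_sum]
  congr 1
  · refine Finset.sum_congr rfl fun r _ => ?_
    have h : √(2 / (N : ℝ)) * √(2 / (N : ℝ)) = 2 / N := Real.mul_self_sqrt (by positivity)
    simp only [conj_trivial]
    linear_combination (relu (preact (ofSpace v) r z) * relu (preact (ofSpace v) r z')
        + projA r v ^ 2 * s r * s' r * (⟪z, z'⟫ + 1)) * h
  · norm_num

end ParamSpace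

/-! ### Gradient flows in the space of parameters -/

section Flow

variable {N d n : ℕ} {x : Fin n → Input d} {y : Fin n → ℝ} {χ : ParamSpace N d → ℝ}
  {θ : ℝ → ParamSpace N d} {s : Fin N → Fin n → ℝ → ℝ}

/-- Minus the gradient of the loss. -/
def velocity (x : Fin n → Input d) (y : Fin n → ℝ) (v : ParamSpace N d)
    (s : Fin N → Fin n → ℝ) : ParamSpace N d :=
  -((1 / (n : ℝ)) • ∑ i, (network (ofSpace v) (x i) - y i) • gradVec v (x i) fun r => s r i)

lemma continuous_velocity :
    Continuous fun q : ParamSpace N d × (Fin N → Fin n → ℝ) => velocity x y q.1 q.2 := by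
  have h1 : ∀ i, Continuous fun q : ParamSpace N d × (Fin N → Fin n → ℝ) =>
      gradVec q.1 (x i) fun r => q.2 r i := by
    intro i
    have h : Continuous fun q : ParamSpace N d × (Fin N → Fin n → ℝ) => (q.1, fun r => q.2 r i) := by
      fun_prop
    have h5 := (continuous_gradVec (N := N) (x i)).comp h
    simpa only [Function.comp_def] using h5
  have h2 : ∀ i, Continuous fun q : ParamSpace N d × (Fin N → Fin n → ℝ) =>
      network (ofSpace q.1) (x i) - y i := fun i =>
    ((continuous_network (x i)).comp continuous_fst).sub continuous_const
  have h3 : Continuous fun q : ParamSpace N d × (Fin N → Fin n → ℝ) =>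
      ∑ i, (network (ofSpace q.1) (x i) - y i) • gradVec q.1 (x i) fun r => q.2 r i :=
    continuous_finsetSum _ fun i _ => (h2 i).smul (h1 i)
  have h4 := h3.const_smul (1 / (n : ℝ))
  exact h4.neg

/-- `s` is a measurable selection of the derivatives of the ReLU along the curve `θ`. -/
structure IsAdmissible (x : Fin n → Input d) (θ : ℝ → ParamSpace N d)
    (s : Fin N → Fin n → ℝ → ℝ) : Prop where
  continuous : Continuous θ
  measurable : ∀ r i, Measurable (s r i)
  mem_subdiff : ∀ r i t, 0 ≤ t → s r i t ∈ reluSubdiff (preact (ofSpace (θ t)) r (x i))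

/-- The gradient flow slowed down by the factor `χ`. -/
structure IsSpaceFlow (x : Fin n → Input d) (y : Fin n → ℝ) (χ : ParamSpace N d → ℝ)
    (θ : ℝ → ParamSpace N d) (s : Fin N → Fin n → ℝ → ℝ) : Prop extends IsAdmissible x θ s where
  eq_integral : ∀ t, 0 ≤ t → θ t = θ 0 +
    ∫ τ in (0 : ℝ)..t, χ (θ τ) • velocity x y (θ τ) fun r i => s r i τ

lemma ae_hasDerivAt_of_eq_integral {E : Type*} [NormedAddCommGroup E] [NormedSpace ℝ E]
    [CompleteSpace E] {f F : ℝ → E} {c : E} {T : ℝ} (hT : 0 ≤ T)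
    (hf : IntervalIntegrable f volume 0 T)
    (hF : ∀ t, 0 ≤ t → F t = c + ∫ τ in (0 : ℝ)..t, f τ) :
    ∀ᵐ t, t ∈ Set.Ioo 0 T → HasDerivAt F (f t) t := by
  filter_upwards [_root_.IntervalIntegrable.ae_hasDerivAt_integral hf] with t ht hmem
  rw [Set.uIcc_of_le hT] at ht
  have := (ht ⟨hmem.1.le, hmem.2.le⟩ 0 ⟨le_rfl, hT⟩).const_add c
  refine this.congr_of_eventuallyEq ?_
  filter_upwards [lt_mem_nhds hmem.1] with b hb
  exact hF b hb.le

lemma measurable_pi_selection (hs : ∀ r i, Measurable (s r i)) :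
    Measurable fun τ => fun r i => s r i τ :=
  measurable_pi_lambda _ fun r => measurable_pi_lambda _ fun i => hs r i

namespace IsAdmissible

lemma aestronglyMeasurable (h : IsAdmissible x θ s) (hχ : Continuous χ) :
    AEStronglyMeasurable (fun τ => χ (θ τ) • velocity x y (θ τ) fun r i => s r i τ)
      (volume : Measure ℝ) := by
  refine (hχ.comp h.continuous).aestronglyMeasurable.smul ?_
  refine continuous_velocity.comp_aestronglyMeasurable (f := fun τ => (θ τ, fun r i => s r i τ)) ?_
  exact h.continuous.aestronglyMeasurable.prodMk
    (measurable_pi_selection h.measurable).aestronglyMeasurable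

lemma exists_bound (h : IsAdmissible x θ s) (hχ : Continuous χ) (T : ℝ) :
    ∃ C : ℝ, 0 ≤ C ∧ ∀ τ ∈ Set.Icc 0 T,
      ‖χ (θ τ) • velocity x y (θ τ) fun r i => s r i τ‖ ≤ C := by
  have hK : IsCompact ((θ '' Set.Icc 0 T) ×ˢ
      (Set.univ.pi fun _ : Fin N => Set.univ.pi fun _ : Fin n => Set.Icc (0 : ℝ) 1)) :=
    (isCompact_Icc.image h.continuous).prod
      (isCompact_univ_pi fun _ => isCompact_univ_pi fun _ => isCompact_Icc)
  have hc : Continuous fun q : ParamSpace N d × (Fin N → Fin n → ℝ) => χ q.1 • velocity x y q.1 q.2 :=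
    (hχ.comp continuous_fst).smul continuous_velocity
  obtain ⟨C, hC⟩ := hK.exists_bound_of_continuousOn hc.continuousOn
  refine ⟨max C 0, le_max_right _ _, fun τ hτ => (hC (θ τ, fun r i => s r i τ) ?_).trans (le_max_left _ _)⟩
  refine ⟨⟨τ, hτ, rfl⟩, fun r _ i _ => ?_⟩
  have := h.mem_subdiff r i τ hτ.1
  exact ⟨this.1, this.2.1⟩

lemma intervalIntegrable (h : IsAdmissible x θ s) (hχ : Continuous χ) {T : ℝ} (hT : 0 ≤ T) :
    IntervalIntegrable (fun τ => χ (θ τ) • velocity x y (θ τ) fun r i => s r i τ) volume 0 T := by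
  obtain ⟨C, -, hC⟩ := h.exists_bound hχ T
  rw [intervalIntegrable_iff_integrableOn_Ioc_of_le hT]
  refine Measure.integrableOn_of_bounded (M := C) (by simp) (h.aestronglyMeasurable hχ) ?_
  rw [ae_restrict_iff' measurableSet_Ioc]
  exact Eventually.of_forall fun τ hτ => hC τ ⟨hτ.1.le, hτ.2⟩

end IsAdmissible

namespace IsSpaceFlow

lemma ae_hasDerivAt (h : IsSpaceFlow x y χ θ s) (hχ : Continuous χ) {T : ℝ} (hT : 0 ≤ T) :
    ∀ᵐ t, t ∈ Set.Ioo 0 T →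
      HasDerivAt θ (χ (θ t) • velocity x y (θ t) fun r i => s r i t) t := by
  exact ae_hasDerivAt_of_eq_integral hT (h.toIsAdmissible.intervalIntegrable hχ hT) h.eq_integral

lemma lipschitzOnWith (h : IsSpaceFlow x y χ θ s) (hχ : Continuous χ) {T : ℝ} (hT : 0 ≤ T) :
    ∃ C : NNReal, LipschitzOnWith C θ (Set.uIcc 0 T) := by
  obtain ⟨C, hC0, hC⟩ := h.toIsAdmissible.exists_bound hχ T
  refine ⟨⟨C, hC0⟩, LipschitzOnWith.of_dist_le_mul fun a ha b hb => ?_⟩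
  rw [Set.uIcc_of_le hT] at ha hb
  rw [dist_eq_norm, h.eq_integral a ha.1, h.eq_integral b hb.1, add_sub_add_left_eq_sub,
    intervalIntegral.integral_interval_sub_left (h.toIsAdmissible.intervalIntegrable hχ ha.1)
      (h.toIsAdmissible.intervalIntegrable hχ hb.1), Real.dist_eq]
  refine intervalIntegral.norm_integral_le_of_norm_le_const fun τ hτ => hC τ ?_
  have := Set.uIoc_subset_uIcc hτ
  exact Set.uIcc_subset_Icc hb ha this

lemma hasACDeriv_clm (h : IsSpaceFlow x y χ θ s) (hχ : Continuous χ) {T : ℝ} (hT : 0 ≤ T)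
    (L : ParamSpace N d →L[ℝ] ℝ) :
    HasACDeriv (fun t => L (θ t)) (fun t => L (χ (θ t) • velocity x y (θ t) fun r i => s r i t)) T := by
  obtain ⟨C, hC⟩ := h.lipschitzOnWith hχ hT
  refine HasACDeriv.of_lipschitz (L.lipschitz.comp_lipschitzOnWith hC) ?_
  filter_upwards [h.ae_hasDerivAt hχ hT] with t ht hmem
  exact L.hasFDerivAt.comp_hasDerivAt t (ht hmem)

end IsSpaceFlow

lemma hasDerivAt_relu_comp {u : ℝ → ℝ} {u' t σ : ℝ} (hu : HasDerivAt u u' t)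
    (hd : DifferentiableAt ℝ (fun t => relu (u t)) t) (hσ : σ ∈ reluSubdiff (u t)) :
    HasDerivAt (fun t => relu (u t)) (σ * u') t := by
  rcases lt_trichotomy (u t) 0 with h | h | h
  · rw [hσ.2.2.2 h, zero_mul]
    refine (hasDerivAt_const t (0 : ℝ)).congr_of_eventuallyEq ?_
    filter_upwards [hu.continuousAt.eventually (gt_mem_nhds h)] with b hb
    exact max_eq_right hb.le
  · have hmin : IsLocalMin (fun t => relu (u t)) t := Eventually.of_forall fun b => by
      simp [relu, h]
    have h1 := hmin.hasDerivAt_eq_zero hd.hasDerivAt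
    have hmin2 : IsLocalMin (fun t => relu (u t) - u t) t := Eventually.of_forall fun b => by
      simp [relu, h]
    have h2 := hmin2.hasDerivAt_eq_zero (hd.hasDerivAt.sub hu)
    have h3 : u' = 0 := by rw [h1] at h2; linarith
    rw [h3, mul_zero, ← h1]
    exact hd.hasDerivAt
  · rw [hσ.2.2.1 h, one_mul]
    refine hu.congr_of_eventuallyEq ?_
    filter_upwards [hu.continuousAt.eventually (lt_mem_nhds h)] with b hb
    exact max_eq_left hb.le

lemma abs_relu_sub_le (a b : ℝ) : |relu a - relu b| ≤ |a - b| := by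
  unfold relu
  exact abs_max_sub_max_le_abs a b 0

lemma HasACDeriv.relu {u u' σ : ℝ → ℝ} {T : ℝ} (hT : 0 ≤ T) (hu : HasACDeriv u u' T)
    (hσ : ∀ t ∈ Set.Ioo 0 T, σ t ∈ reluSubdiff (u t)) :
    HasACDeriv (fun t => relu (u t)) (fun t => σ t * u' t) T := by
  have hac : AbsolutelyContinuousOnInterval (fun t => WideReLU.relu (u t)) 0 T := by
    have h := hu.1
    rw [absolutelyContinuousOnInterval_iff] at h ⊢
    intro ε hε
    obtain ⟨δ, hδ, hh⟩ := h ε hε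
    refine ⟨δ, hδ, fun E hE hlt => lt_of_le_of_lt (Finset.sum_le_sum fun i _ => ?_) (hh E hE hlt)⟩
    rw [Real.dist_eq, Real.dist_eq]
    exact abs_relu_sub_le _ _
  refine ⟨hac, ?_⟩
  filter_upwards [hu.2, hac.ae_differentiableAt] with t h1 h2 ht
  refine hasDerivAt_relu_comp (h1 ht) (h2 ?_) (hσ t ht)
  rw [Set.uIcc_of_le hT]
  exact ⟨ht.1.le, ht.2.le⟩

/-- The chain rule for the network along the flow. -/
lemma IsSpaceFlow.hasACDeriv_network (h : IsSpaceFlow x y χ θ s) (hχ : Continuous χ) {T : ℝ}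
    (hT : 0 ≤ T) (z : Input d) {σ : ℝ → Fin N → ℝ}
    (hσ : ∀ t ∈ Set.Ioo 0 T, ∀ r, σ t r ∈ reluSubdiff (preact (ofSpace (θ t)) r z)) :
    HasACDeriv (fun t => network (ofSpace (θ t)) z)
      (fun t => ⟪gradVec (θ t) z (σ t), χ (θ t) • velocity x y (θ t) fun r i => s r i t⟫) T := by
  have hc := h.hasACDeriv_clm hχ hT projC
  have hr : ∀ r : Fin N, HasACDeriv (fun t => projA r (θ t) * relu (preactL r z (θ t))) _ T := fun r =>
    (h.hasACDeriv_clm hχ hT (projA r)).mul ((h.hasACDeriv_clm hχ hT (preactL r z)).relu hT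
      (σ := fun t => σ t r) fun t ht => by rw [← preact_ofSpace]; exact hσ t ht r)
  have := ((HasACDeriv.sum Finset.univ fun r _ => hr r).const_mul √(2 / (N : ℝ))).add hc
  simp only [network, preact_ofSpace, ofSpace_a, ofSpace_c]
  refine this.congr_deriv fun t _ => ?_
  rw [inner_eq]
  simp only [gradVec, projA_toSpace, projW_toSpace, projB_toSpace, projC_toSpace, networkGrad,
    inner_smul_left, ofSpace_a, preact_ofSpace, conj_trivial, one_mul]
  rw [Finset.mul_sum]
  congr 1
  refine Finset.sum_congr rfl fun r _ => ?_
  simp only [preactL, _root_.add_apply, ContinuousLinearMap.comp_apply, innerSL_apply_apply]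
  ring

lemma inner_velocity (v w : ParamSpace N d) (s : Fin N → Fin n → ℝ) :
    ⟪w, velocity x y v s⟫ = -(1 / (n : ℝ)) * ∑ j, ⟪w, gradVec v (x j) fun r => s r j⟫ *
      (network (ofSpace v) (x j) - y j) := by
  simp only [velocity, inner_neg_right, inner_smul_right, inner_sum, neg_mul]
  congr 2
  exact Finset.sum_congr rfl fun j _ => mul_comm _ _

end Flow

/-! ### Comparison with the original formulation of the flow -/

section Translation

variable {N d n : ℕ} {x : Fin n → Input d} {y : Fin n → ℝ}

lemma IsAdmissible.clm_integral {F : Type*} [NormedAddCommGroup F] [NormedSpace ℝ F]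
    [CompleteSpace F] {θ : ℝ → ParamSpace N d} {s : Fin N → Fin n → ℝ → ℝ}
    (h : IsAdmissible x θ s) {t : ℝ} (ht : 0 ≤ t) (L : ParamSpace N d →L[ℝ] F) :
    L (∫ τ in (0 : ℝ)..t, (1 : ℝ) • velocity x y (θ τ) fun r i => s r i τ)
      = -∫ τ in (0 : ℝ)..t, (1 / (n : ℝ)) • ∑ i, (network (ofSpace (θ τ)) (x i) - y i) •
          L (gradVec (θ τ) (x i) fun r => s r i τ) := by
  rw [← L.intervalIntegral_comp_comm
    (h.intervalIntegrable (χ := fun _ => 1) continuous_const ht), ← intervalIntegral.integral_neg]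
  simp only [velocity, map_smul, map_neg, map_sum, one_smul]

/-- A trajectory of the gradient flow, extended by a constant to negative times, is a flow in the
space of parameters. -/
lemma IsGradientFlow.exists_isSpaceFlow {θ : ℝ → Params N d} (h : IsGradientFlow x y θ) :
    ∃ s, IsSpaceFlow x y (fun _ => 1) (fun t => toSpace (θ (max t 0))) s := by
  obtain ⟨ha, hw, hb, hc, s, hs, hsub, heq⟩ := h
  have hmax : Continuous fun t : ℝ => max t 0 := by fun_prop
  have hcont : ∀ {F : Type} [TopologicalSpace F] {f : ℝ → F}, ContinuousOn f (Set.Ici 0) →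
      Continuous fun t => f (max t 0) := fun hf =>
    hf.comp_continuous hmax fun t => le_max_right t 0
  have hadm : IsAdmissible x (fun t => toSpace (θ (max t 0))) s :=
    { continuous := continuous_toSpace (fun r => hcont (ha r)) (fun r => hcont (hw r))
        (fun r => hcont (hb r)) (hcont hc)
      measurable := hs
      mem_subdiff := fun r i t ht => by
        simp only [max_eq_left ht, ofSpace_toSpace]; exact hsub r i t ht }
  refine ⟨s, { toIsAdmissible := hadm, eq_integral := fun t ht => ?_ }⟩
  obtain ⟨ea, ew, eb, ec⟩ := heq t ht
  have hτ : ∀ τ ∈ Set.uIcc 0 t, max τ 0 = τ := fun τ hτ => by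
    rw [Set.uIcc_of_le ht] at hτ; exact max_eq_left hτ.1
  refine paramSpace_ext (fun r => ?_) (fun r => ?_) (fun r => ?_) ?_
  · rw [map_add, hadm.clm_integral ht, projA_toSpace, projA_toSpace, max_eq_left ht, max_self, ea r,
      sub_eq_add_neg]
    congr 2
    refine intervalIntegral.integral_congr fun τ h => ?_
    simp only [hτ τ h, ofSpace_toSpace, gradVec, projA_toSpace, smul_eq_mul]
  · rw [map_add, hadm.clm_integral ht, projW_toSpace, projW_toSpace, max_eq_left ht, max_self, ew r,
      sub_eq_add_neg]
    congr 2
    refine intervalIntegral.integral_congr fun τ h => ?_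
    simp only [hτ τ h, ofSpace_toSpace, gradVec, projW_toSpace]
  · rw [map_add, hadm.clm_integral ht, projB_toSpace, projB_toSpace, max_eq_left ht, max_self, eb r,
      sub_eq_add_neg]
    congr 2
    refine intervalIntegral.integral_congr fun τ h => ?_
    simp only [hτ τ h, ofSpace_toSpace, gradVec, projB_toSpace, smul_eq_mul]
  · rw [map_add, hadm.clm_integral ht, projC_toSpace, projC_toSpace, max_eq_left ht, max_self, ec,
      sub_eq_add_neg]
    congr 2
    refine intervalIntegral.integral_congr fun τ h => ?_
    simp only [hτ τ h, ofSpace_toSpace, gradVec, projC_toSpace, smul_eq_mul]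

lemma IsSpaceFlow.isGradientFlow {θ : ℝ → ParamSpace N d} {s : Fin N → Fin n → ℝ → ℝ}
    (h : IsSpaceFlow x y (fun _ => 1) θ s) : IsGradientFlow x y fun t => ofSpace (θ t) := by
  have hc := h.continuous
  refine ⟨fun r => ((projA r).continuous.comp hc).continuousOn,
    fun r => ((projW r).continuous.comp hc).continuousOn,
    fun r => ((projB r).continuous.comp hc).continuousOn,
    (projC.continuous.comp hc).continuousOn, s, h.measurable, h.mem_subdiff, fun t ht => ?_⟩
  have key := h.eq_integral t ht
  refine ⟨fun r => ?_, fun r => ?_, fun r => ?_, ?_⟩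
  · have := congrArg (projA r) key
    rw [map_add, h.toIsAdmissible.clm_integral ht, ← sub_eq_add_neg] at this
    exact this
  · have := congrArg (projW r) key
    rw [map_add, h.toIsAdmissible.clm_integral ht, ← sub_eq_add_neg] at this
    exact this
  · have := congrArg (projB r) key
    rw [map_add, h.toIsAdmissible.clm_integral ht, ← sub_eq_add_neg] at this
    exact this
  · have := congrArg projC key
    rw [map_add, h.toIsAdmissible.clm_integral ht, ← sub_eq_add_neg] at this
    exact this

end Translation

/-! ### Existence of the truncated flow -/

section Existence

variable {N d n : ℕ} {x : Fin n → Input d} {y : Fin n → ℝ}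

lemma gradVec_eq_sum (v : ParamSpace N d) (z : Input d) (s : Fin N → ℝ) :
    gradVec v z s = gradVec v z 0 + ∑ r, s r • (gradVec v z (Pi.single r 1) - gradVec v z 0) := by
  refine paramSpace_ext (fun r => ?_) (fun r => ?_) (fun r => ?_) ?_
  · simp [gradVec, networkGrad, map_sum]
  · simp only [gradVec, networkGrad, map_add, map_sum, map_smul, map_sub, projW_toSpace]
    rw [Finset.sum_eq_single r]
    · simp only [Pi.zero_apply, mul_zero, zero_smul, sub_zero, Pi.single_eq_same, mul_one, zero_add,
        smul_smul]
      congr 1; ring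
    · intro b _ hb
      simp [Pi.single_eq_of_ne hb.symm]
    · simp
  · simp only [gradVec, networkGrad, map_add, map_sum, map_smul, map_sub, projB_toSpace]
    rw [Finset.sum_eq_single r]
    · simp only [Pi.zero_apply, mul_zero, sub_zero, Pi.single_eq_same, mul_one, zero_add,
        smul_eq_mul]
      ring
    · intro b _ hb
      simp [Pi.single_eq_of_ne hb.symm]
    · simp
  · simp [gradVec, networkGrad, map_sum]

/-- The coefficient of `s r i` in the affine function `s ↦ velocity x y v s`. -/
def velocityCoeff (x : Fin n → Input d) (y : Fin n → ℝ) (v : ParamSpace N d) (r : Fin N)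
    (i : Fin n) : ParamSpace N d :=
  -((1 / (n : ℝ)) • (network (ofSpace v) (x i) - y i) •
    (gradVec v (x i) (Pi.single r 1) - gradVec v (x i) 0))

lemma velocity_eq_sum (v : ParamSpace N d) (s : Fin N → Fin n → ℝ) :
    velocity x y v s = velocity x y v 0 + ∑ q : Fin N × Fin n, s q.1 q.2 • velocityCoeff x y v q.1 q.2 := by
  have h : ∀ i, gradVec v (x i) (fun r => s r i) = gradVec v (x i) 0
      + ∑ r, s r i • (gradVec v (x i) (Pi.single r 1) - gradVec v (x i) 0) := fun i =>
    gradVec_eq_sum v (x i) fun r => s r i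
  rw [Fintype.sum_prod_type_right]
  simp only [velocity, velocityCoeff]
  simp_rw [h]
  simp only [smul_add, Finset.sum_add_distrib, neg_add, Finset.smul_sum, smul_neg, Finset.sum_neg_distrib]
  congr 2
  refine Finset.sum_congr rfl fun i _ => Finset.sum_congr rfl fun r _ => ?_
  simp only [smul_smul]
  congr 1
  ring

lemma continuous_velocityCoeff (r : Fin N) (i : Fin n) :
    Continuous fun v : ParamSpace N d => velocityCoeff x y v r i := by
  have h1 : ∀ s : Fin N → ℝ, Continuous fun v : ParamSpace N d => gradVec v (x i) s := by
    intro s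
    have h : Continuous fun v : ParamSpace N d => (v, s) := by fun_prop
    have h5 := (continuous_gradVec (N := N) (x i)).comp h
    simpa only [Function.comp_def] using h5
  have h2 := ((continuous_network (N := N) (x i)).sub (continuous_const (y := y i))).smul
    ((h1 (Pi.single r 1)).sub (h1 0))
  exact (h2.const_smul (1 / (n : ℝ))).neg

/-- A cutoff equal to `1` on the ball of radius `R` and to `0` off the ball of radius `2R`. -/
def cutoff (p₀ : ParamSpace N d) (R : ℝ) (v : ParamSpace N d) : ℝ :=
  max 0 (min 1 (2 - ‖v - p₀‖ / R))

lemma continuous_cutoff (p₀ : ParamSpace N d) (R : ℝ) : Continuous (cutoff p₀ R) := by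
  unfold cutoff; fun_prop

lemma cutoff_eq_one {p₀ v : ParamSpace N d} {R : ℝ} (hR : 0 < R) (h : ‖v - p₀‖ ≤ R) :
    cutoff p₀ R v = 1 := by
  have : ‖v - p₀‖ / R ≤ 1 := (div_le_one hR).2 h
  rw [cutoff, min_eq_left (by linarith), max_eq_right zero_le_one]

lemma cutoff_eq_zero {p₀ v : ParamSpace N d} {R : ℝ} (hR : 0 < R) (h : 2 * R < ‖v - p₀‖) :
    cutoff p₀ R v = 0 := by
  have : 2 < ‖v - p₀‖ / R := (lt_div_iff₀ hR).2 h
  rw [cutoff, max_eq_left]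
  exact (min_le_right _ _).trans (by linarith)

theorem exists_isSpaceFlow (p₀ : ParamSpace N d) {R : ℝ} (hR : 0 < R) :
    ∃ θ s, θ 0 = p₀ ∧ IsSpaceFlow x y (cutoff p₀ R) θ s := by
  let G : Option (Fin N × Fin n) → ParamSpace N d → ParamSpace N d := fun k v =>
    k.elim (velocity x y v 0) fun q => velocityCoeff x y v q.1 q.2
  let u : Option (Fin N × Fin n) → ParamSpace N d → ℝ := fun k v =>
    k.elim 1 fun q => preactL q.1 (x q.2) v
  have hG : ∀ k, Continuous (G k) := by
    rintro (_ | q)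
    · have h : Continuous fun v : ParamSpace N d => (v, (0 : Fin N → Fin n → ℝ)) := by fun_prop
      have h5 := (continuous_velocity (x := x) (y := y)).comp h
      change Continuous fun v => velocity x y v 0
      simpa only [Function.comp_def] using h5
    · exact continuous_velocityCoeff q.1 q.2
  have hu : ∀ k, Continuous (u k) := by
    rintro (_ | q)
    · exact continuous_const
    · exact (preactL q.1 (x q.2)).continuous
  have hcG : ∀ k, Continuous fun v => cutoff p₀ R v • G k v := fun k =>
    (continuous_cutoff p₀ R).smul (hG k)
  have hb : ∀ k, ∃ C : ℝ, ∀ v, ‖cutoff p₀ R v • G k v‖ ≤ C := by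
    intro k
    obtain ⟨C, hC⟩ := (isCompact_closedBall p₀ (2 * R)).exists_bound_of_continuousOn
      (hcG k).continuousOn
    refine ⟨max C 0, fun v => ?_⟩
    by_cases hv : ‖v - p₀‖ ≤ 2 * R
    · exact (hC v (mem_closedBall_iff_norm.2 hv)).trans (le_max_left _ _)
    · rw [cutoff_eq_zero hR (not_le.1 hv), zero_smul, norm_zero]
      exact le_max_right _ _
  choose C hC using hb
  have hB : ∀ k v, ‖cutoff p₀ R v • G k v‖ ≤ ∑ k, |C k| := fun k v =>
    (hC k v).trans ((le_abs_self _).trans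
      (Finset.single_le_sum (f := fun k => |C k|) (fun i _ => abs_nonneg _) (Finset.mem_univ k)))
  obtain ⟨θ, hθ, h0, s, hs, hsub, heq⟩ := exists_inclusion_solution hcG hB hu p₀
  refine ⟨θ, fun r i => s (some (r, i)), h0,
    { continuous := hθ
      measurable := fun r i => hs _
      mem_subdiff := fun r i t ht => by
        rw [preact_ofSpace]; exact hsub (some (r, i)) t ht
      eq_integral := fun t ht => ?_ }⟩
  rw [heq t ht, h0]
  congr 1
  refine intervalIntegral.integral_congr fun τ hτ => ?_
  rw [Set.uIcc_of_le ht] at hτ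
  have h1 : s none τ = 1 := (hsub none τ hτ.1).2.2.1 one_pos
  simp only [Fintype.sum_option, h1, one_smul]
  rw [velocity_eq_sum, smul_add, Finset.smul_sum]
  congr 1
  exact Finset.sum_congr rfl fun q _ => smul_comm _ _ _

end Existence

/-! ### Kernel regression as a linear flow -/

section Regression

variable {d n : ℕ} {x : Fin n → Input d} {y : Fin n → ℝ}

lemma HasACDeriv.of_hasDerivAt {f f' : ℝ → ℝ} {T : ℝ} (h : ∀ t, HasDerivAt f (f' t) t)
    (hc : Continuous f') : HasACDeriv f f' T := by
  refine HasACDeriv.of_contDiff (contDiff_one_iff_deriv.2 ⟨fun t => (h t).differentiableAt, ?_⟩) h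
  rwa [funext fun t => (h t).deriv]

/-- The residuals of kernel regression. -/
def ntkResidual (x : Fin n → Input d) (y : Fin n → ℝ) (i : Fin n) (t : ℝ) : ℝ :=
  -((NormedSpace.exp (-(t / (n : ℝ)) • ntkGram x)).mulVec y i)

attribute [local instance] Matrix.linftyOpNormedRing Matrix.linftyOpNormedAlgebra in
lemma hasDerivAt_exp_gram (t : ℝ) :
    HasDerivAt (fun t : ℝ => NormedSpace.exp (-(t / (n : ℝ)) • ntkGram x))
      (-(1 / (n : ℝ)) • (ntkGram x * NormedSpace.exp (-(t / (n : ℝ)) • ntkGram x))) t := by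
  have h := (hasDerivAt_exp_smul_const' (𝕂 := ℝ) (ntkGram x) (-(t / (n : ℝ)))).scomp t
    (((hasDerivAt_id t).div_const (n : ℝ)).neg)
  exact h

attribute [local instance] Matrix.linftyOpNormedRing Matrix.linftyOpNormedAlgebra in
lemma hasDerivAt_exp_gram_apply (t : ℝ) (i j : Fin n) :
    HasDerivAt (fun t : ℝ => NormedSpace.exp (-(t / (n : ℝ)) • ntkGram x) i j)
      (-(1 / (n : ℝ)) * (ntkGram x * NormedSpace.exp (-(t / (n : ℝ)) • ntkGram x)) i j) t :=
  (LinearMap.toContinuousLinearMap (Matrix.entryLinearMap ℝ ℝ i j)).hasFDerivAt.comp_hasDerivAt t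
    (hasDerivAt_exp_gram t)

lemma hasDerivAt_mulVec_apply {M : ℝ → Matrix (Fin n) (Fin n) ℝ} {M' : Matrix (Fin n) (Fin n) ℝ}
    {t : ℝ} (h : ∀ i j, HasDerivAt (fun t => M t i j) (M' i j) t) (y : Fin n → ℝ) (i : Fin n) :
    HasDerivAt (fun t => (M t).mulVec y i) (M'.mulVec y i) t := by
  simp only [Matrix.mulVec, dotProduct]
  exact HasDerivAt.fun_sum fun j _ => (h i j).mul_const _

lemma hasDerivAt_ntkResidual (i : Fin n) (t : ℝ) :
    HasDerivAt (ntkResidual x y i)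
      (-(1 / (n : ℝ)) * ∑ j, ntk (x i) (x j) * ntkResidual x y j t) t := by
  have h := (hasDerivAt_mulVec_apply (M := fun t => NormedSpace.exp (-(t / (n : ℝ)) • ntkGram x))
    (M' := -(1 / (n : ℝ)) • (ntkGram x * NormedSpace.exp (-(t / (n : ℝ)) • ntkGram x)))
    (fun i j => hasDerivAt_exp_gram_apply t i j) y i).neg
  refine h.congr_deriv ?_
  rw [Matrix.smul_mulVec, ← Matrix.mulVec_mulVec]
  simp only [Pi.smul_apply, smul_eq_mul, ntkResidual, mul_neg, Finset.sum_neg_distrib]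
  rw [Matrix.mulVec, dotProduct]
  rfl

lemma continuous_ntkResidual (i : Fin n) : Continuous (ntkResidual x y i) :=
  continuous_iff_continuousAt.2 fun t => (hasDerivAt_ntkResidual i t).continuousAt

lemma ntkResidual_zero (i : Fin n) : ntkResidual x y i 0 = -y i := by
  simp [ntkResidual]

lemma hasDerivAt_ntkRegression (hdet : IsUnit (ntkGram x).det) (z : Input d) (t : ℝ) :
    HasDerivAt (fun t => ntkRegression x y t z)
      (-(1 / (n : ℝ)) * ∑ j, ntk z (x j) * ntkResidual x y j t) t := by
  have h1 : ∀ t, ntkRegression x y t z = (fun i => ntk z (x i)) ⬝ᵥ ((ntkGram x)⁻¹.mulVec y)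
      - ∑ i, (Matrix.vecMul (fun i => ntk z (x i)) (ntkGram x)⁻¹) i *
        (NormedSpace.exp (-(t / (n : ℝ)) • ntkGram x)).mulVec y i := by
    intro t
    rw [ntkRegression, Matrix.mul_sub, mul_one, Matrix.sub_mulVec, dotProduct_sub,
      ← Matrix.mulVec_mulVec]
    congr 1
    exact Matrix.dotProduct_mulVec _ _ _
  have h2 : HasDerivAt (fun t => ∑ i, (Matrix.vecMul (fun i => ntk z (x i)) (ntkGram x)⁻¹) i *
        (NormedSpace.exp (-(t / (n : ℝ)) • ntkGram x)).mulVec y i)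
      (∑ i, (Matrix.vecMul (fun i => ntk z (x i)) (ntkGram x)⁻¹) i *
        ((-(1 / (n : ℝ)) • (ntkGram x * NormedSpace.exp (-(t / (n : ℝ)) • ntkGram x))).mulVec y i)) t :=
    HasDerivAt.fun_sum fun i _ => (hasDerivAt_mulVec_apply
      (M := fun t => NormedSpace.exp (-(t / (n : ℝ)) • ntkGram x))
      (fun i j => hasDerivAt_exp_gram_apply t i j) y i).const_mul _
  have h3 := (hasDerivAt_const t ((fun i => ntk z (x i)) ⬝ᵥ ((ntkGram x)⁻¹.mulVec y))).sub h2
  refine (h3.congr_deriv ?_).congr_of_eventuallyEq (Eventually.of_forall h1)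
  have h4 : ∑ i, (Matrix.vecMul (fun i => ntk z (x i)) (ntkGram x)⁻¹) i *
        ((-(1 / (n : ℝ)) • (ntkGram x * NormedSpace.exp (-(t / (n : ℝ)) • ntkGram x))).mulVec y i)
      = (fun i => ntk z (x i)) ⬝ᵥ ((ntkGram x)⁻¹.mulVec
        ((-(1 / (n : ℝ)) • (ntkGram x * NormedSpace.exp (-(t / (n : ℝ)) • ntkGram x))).mulVec y)) := by
    rw [Matrix.dotProduct_mulVec]; rfl
  rw [h4, Matrix.mulVec_mulVec, Matrix.mul_smul, Matrix.nonsing_inv_mul_cancel_left _ _ hdet,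
    Matrix.smul_mulVec, dotProduct_smul, zero_sub, smul_eq_mul]
  simp only [ntkResidual, mul_neg, Finset.sum_neg_distrib, neg_mul, neg_neg, dotProduct]

lemma ntkRegression_zero (z : Input d) : ntkRegression x y 0 z = 0 := by
  simp [ntkRegression]

lemma isUnit_det_ntkGram {lam : ℝ} (hlam : 0 < lam)
    (hK : ∀ v : Fin n → ℝ, lam * ∑ i, v i ^ 2 ≤ ∑ i, ∑ j, v i * ntk (x i) (x j) * v j) :
    IsUnit (ntkGram x).det := by
  rw [isUnit_iff_ne_zero]
  intro h0
  obtain ⟨v, hv, hv0⟩ := Matrix.exists_mulVec_eq_zero_iff.2 h0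
  have h1 : ∑ i, ∑ j, v i * ntk (x i) (x j) * v j = 0 := by
    refine Finset.sum_eq_zero fun i _ => ?_
    have := congrFun hv0 i
    rw [Matrix.mulVec, dotProduct] at this
    calc _ = v i * ∑ j, ntkGram x i j * v j := by
          rw [Finset.mul_sum]; exact Finset.sum_congr rfl fun j _ => by rw [mul_assoc]; rfl
      _ = 0 := by rw [this]; simp
  have h2 := hK v
  rw [h1] at h2
  obtain ⟨i, hi⟩ := Function.ne_iff.1 hv
  have h3 : 0 < ∑ i, v i ^ 2 :=
    Finset.sum_pos' (fun i _ => sq_nonneg _) ⟨i, Finset.mem_univ _, by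
      have : v i ≠ 0 := hi
      positivity⟩
  nlinarith

end Regression

/-! ### Lazy training -/

section Lazy

variable {N d n : ℕ}

/-- On the ball of radius `R` around `p₀`, the tangent kernel of the network is `κ`-close to the
neural tangent kernel. -/
def NearKernel (x : Fin n → Input d) (𝒳 : Set (Input d)) (p₀ : ParamSpace N d) (R κ : ℝ) : Prop :=
  ∀ v, ‖v - p₀‖ ≤ R → ∀ z ∈ 𝒳, ∀ j, ∀ σ σ' : Fin N → ℝ,
    (∀ r, σ r ∈ reluSubdiff (preact (ofSpace v) r z)) →
    (∀ r, σ' r ∈ reluSubdiff (preact (ofSpace v) r (x j))) →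
    |⟪gradVec v z σ, gradVec v (x j) σ'⟫ - ntk z (x j)| ≤ κ

variable {x : Fin n → Input d} {y : Fin n → ℝ} {𝒳 : Set (Input d)} {χ : ParamSpace N d → ℝ}
  {θ : ℝ → ParamSpace N d} {s : Fin N → Fin n → ℝ → ℝ} {R κ lam L Y T : ℝ}

lemma norm_velocity_sq (v : ParamSpace N d) (s : Fin N → Fin n → ℝ) :
    ‖velocity x y v s‖ ^ 2 = (1 / (n : ℝ)) ^ 2 * ∑ i, ∑ j, (network (ofSpace v) (x i) - y i) *
      ⟪gradVec v (x i) fun r => s r i, gradVec v (x j) fun r => s r j⟫ *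
        (network (ofSpace v) (x j) - y j) := by
  rw [← real_inner_self_eq_norm_sq, inner_velocity]
  have h : ∀ j, ⟪velocity x y v s, gradVec v (x j) fun r => s r j⟫ = -(1 / (n : ℝ)) *
      ∑ i, ⟪gradVec v (x j) fun r => s r j, gradVec v (x i) fun r => s r i⟫ *
        (network (ofSpace v) (x i) - y i) := fun j => by
    rw [real_inner_comm, inner_velocity]
  simp_rw [h, Finset.mul_sum, Finset.sum_mul]
  refine Finset.sum_congr rfl fun i _ => ?_
  rw [Finset.mul_sum]
  exact Finset.sum_congr rfl fun j _ => by ring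

/-- The hypotheses of the lazy training argument, at an initialization `p₀`. -/
structure LazySetting (x : Fin n → Input d) (y : Fin n → ℝ) (𝒳 : Set (Input d))
    (p₀ : ParamSpace N d) (lam L Y R κ : ℝ) : Prop where
  n_pos : 0 < n
  mem : ∀ i, x i ∈ 𝒳
  lam_pos : 0 < lam
  coercive : ∀ v : Fin n → ℝ, lam * ∑ i, v i ^ 2 ≤ ∑ i, ∑ j, v i * ntk (x i) (x j) * v j
  bound : ∀ z ∈ 𝒳, ∀ j, |ntk z (x j)| ≤ L
  Y_nonneg : 0 ≤ Y
  sum_sq_le : ∑ i, y i ^ 2 ≤ Y ^ 2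
  κ_nonneg : 0 ≤ κ
  κ_le_one : κ ≤ 1
  κ_le : n * κ ≤ lam / 2
  R_pos : 0 < R
  R_ge : 2 * n * (L + 1) * Y / lam ≤ R / 2
  near : NearKernel x 𝒳 p₀ R κ
  network_init : ∀ z, network (ofSpace p₀) z = 0

namespace LazySetting

variable {p₀ : ParamSpace N d}

lemma hasACDeriv_network (h : IsSpaceFlow x y χ θ s) (hχ : Continuous χ) (hT : 0 ≤ T)
    (hχ1 : ∀ v, ‖v - p₀‖ ≤ R → χ v = 1) (hball : ∀ t ∈ Set.Icc 0 T, ‖θ t - p₀‖ ≤ R) (z : Input d)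
    {σ : ℝ → Fin N → ℝ}
    (hσ : ∀ t ∈ Set.Ioo 0 T, ∀ r, σ t r ∈ reluSubdiff (preact (ofSpace (θ t)) r z)) :
    HasACDeriv (fun t => network (ofSpace (θ t)) z) (fun t => -(1 / (n : ℝ)) *
      ∑ j, ⟪gradVec (θ t) z (σ t), gradVec (θ t) (x j) fun r => s r j t⟫ *
        (network (ofSpace (θ t)) (x j) - y j)) T :=
  (h.hasACDeriv_network hχ hT z hσ).congr_deriv fun t ht => by
    rw [hχ1 _ (hball t ⟨ht.1.le, ht.2.le⟩), one_smul, inner_velocity]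

lemma hasACDeriv_residual (h : IsSpaceFlow x y χ θ s) (hχ : Continuous χ) (hT : 0 ≤ T)
    (hχ1 : ∀ v, ‖v - p₀‖ ≤ R → χ v = 1) (hball : ∀ t ∈ Set.Icc 0 T, ‖θ t - p₀‖ ≤ R) (i : Fin n) :
    HasACDeriv (fun t => network (ofSpace (θ t)) (x i) - y i) (fun t => -(1 / (n : ℝ)) *
      ∑ j, ⟪gradVec (θ t) (x i) fun r => s r i t, gradVec (θ t) (x j) fun r => s r j t⟫ *
        (network (ofSpace (θ t)) (x j) - y j)) T :=
  ((hasACDeriv_network h hχ hT hχ1 hball (x i) (σ := fun t r => s r i t)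
    fun t ht r => h.mem_subdiff r i t ht.1.le).sub (HasACDeriv.const (y i))).congr_deriv
      fun t _ => by rw [sub_zero]

lemma near_gram (S : LazySetting x y 𝒳 p₀ lam L Y R κ) (h : IsSpaceFlow x y χ θ s)
    (hball : ∀ t ∈ Set.Icc 0 T, ‖θ t - p₀‖ ≤ R) (t : ℝ) (ht : t ∈ Set.Icc 0 T) (i j : Fin n) :
    |⟪gradVec (θ t) (x i) fun r => s r i t, gradVec (θ t) (x j) fun r => s r j t⟫
      - ntk (x i) (x j)| ≤ κ :=
  S.near (θ t) (hball t ht) (x i) (S.mem i) j _ _ (fun r => h.mem_subdiff r i t ht.1)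
    fun r => h.mem_subdiff r j t ht.1

lemma sum_sq_init (S : LazySetting x y 𝒳 p₀ lam L Y R κ) (h0 : θ 0 = p₀) :
    ∑ i, (network (ofSpace (θ 0)) (x i) - y i) ^ 2 ≤ Y ^ 2 := by
  simp only [h0, S.network_init, zero_sub, neg_sq]
  exact S.sum_sq_le

lemma norm_velocity_le (S : LazySetting x y 𝒳 p₀ lam L Y R κ) (h : IsSpaceFlow x y χ θ s)
    (hχ : Continuous χ) (hT : 0 ≤ T) (hχ1 : ∀ v, ‖v - p₀‖ ≤ R → χ v = 1) (h0 : θ 0 = p₀)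
    (hball : ∀ t ∈ Set.Icc 0 T, ‖θ t - p₀‖ ≤ R) (t : ℝ) (ht : t ∈ Set.Icc 0 T) :
    ‖velocity x y (θ t) fun r i => s r i t‖ ≤ (L + 1) * Y * Real.exp (-(lam / (2 * n)) * t) := by
  have hn1 : (1 : ℝ) ≤ n := by exact_mod_cast S.n_pos
  have hL : 0 ≤ L := (abs_nonneg _).trans (S.bound _ (S.mem ⟨0, S.n_pos⟩) ⟨0, S.n_pos⟩)
  have hY := S.Y_nonneg
  have hdec := sum_sq_le_exp (T := T) S.n_pos S.coercive (hasACDeriv_residual h hχ hT hχ1 hball)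
    (fun t ht i j => S.near_gram h hball t ⟨ht.1.le, ht.2.le⟩ i j) S.κ_le S.κ_nonneg ht.1 ht.2
  set E := ∑ i, (network (ofSpace (θ t)) (x i) - y i) ^ 2 with hE
  have hE' : E ≤ Real.exp (-(lam / n * t)) * Y ^ 2 :=
    hdec.trans (mul_le_mul_of_nonneg_left (S.sum_sq_init h0) (Real.exp_pos _).le)
  have hH : ∀ i j, |⟪gradVec (θ t) (x i) fun r => s r i t, gradVec (θ t) (x j) fun r => s r j t⟫|
      ≤ L + 1 := by
    intro i j
    have h1 := S.near_gram h hball t ht i j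
    have h2 := S.bound _ (S.mem i) j
    have h3 := abs_sub_abs_le_abs_sub
      (⟪gradVec (θ t) (x i) fun r => s r i t, gradVec (θ t) (x j) fun r => s r j t⟫) (ntk (x i) (x j))
    linarith [S.κ_le_one]
  refine abs_le_of_sq_le_sq' ?_ (by positivity) |>.2
  rw [norm_velocity_sq]
  have h1 := (le_abs_self _).trans (abs_sum_sum_mul_le _ (fun i => network (ofSpace (θ t)) (x i) - y i)
    (fun i => network (ofSpace (θ t)) (x i) - y i) hH)
  have h2 := sq_sum_abs_le fun i => network (ofSpace (θ t)) (x i) - y i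
  have hexp : Real.exp (-(lam / n * t)) = Real.exp (-(lam / (2 * n)) * t) ^ 2 := by
    rw [sq, ← Real.exp_add]; congr 1; field_simp; ring
  rw [hexp] at hE'
  set X := Real.exp (-(lam / (2 * n)) * t)
  calc _ ≤ (1 / (n : ℝ)) ^ 2 * ((L + 1) * (n * (X ^ 2 * Y ^ 2))) := by
        have h3 := h2.trans (mul_le_mul_of_nonneg_left hE' (Nat.cast_nonneg n))
        rw [sq] at h3
        have h4 := h1.trans (mul_le_mul_of_nonneg_left h3 (by positivity))
        gcongr
    _ = (1 / (n : ℝ)) * ((L + 1) * (X ^ 2 * Y ^ 2)) := by field_simp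
    _ ≤ 1 * ((L + 1) * (X ^ 2 * Y ^ 2)) := by
        gcongr
        rw [div_le_one (by positivity)]
        exact hn1
    _ ≤ (L + 1) ^ 2 * (X ^ 2 * Y ^ 2) := by
        rw [one_mul]
        gcongr
        nlinarith
    _ = _ := by ring

lemma norm_sub_le_half (S : LazySetting x y 𝒳 p₀ lam L Y R κ) (h : IsSpaceFlow x y χ θ s)
    (hχ : Continuous χ) (hT : 0 ≤ T) (hχ1 : ∀ v, ‖v - p₀‖ ≤ R → χ v = 1) (h0 : θ 0 = p₀)
    (hball : ∀ t ∈ Set.Icc 0 T, ‖θ t - p₀‖ ≤ R) : ‖θ T - p₀‖ ≤ R / 2 := by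
  have hn1 : (1 : ℝ) ≤ n := by exact_mod_cast S.n_pos
  have hL : 0 ≤ L := (abs_nonneg _).trans (S.bound _ (S.mem ⟨0, S.n_pos⟩) ⟨0, S.n_pos⟩)
  have hY := S.Y_nonneg
  have hlam := S.lam_pos
  rw [h.eq_integral T hT, h0, add_sub_cancel_left]
  set c := lam / (2 * n) with hc
  have hc0 : 0 < c := by positivity
  have hint : IntervalIntegrable (fun τ => (L + 1) * Y * Real.exp (-c * τ)) volume 0 T :=
    (by fun_prop : Continuous fun τ => (L + 1) * Y * Real.exp (-c * τ)).intervalIntegrable _ _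
  refine (intervalIntegral.norm_integral_le_of_norm_le (g := fun τ => (L + 1) * Y * Real.exp (-c * τ))
    hT (Eventually.of_forall fun τ hτ => ?_) hint).trans ?_
  · have hτ' : τ ∈ Set.Icc 0 T := ⟨hτ.1.le, hτ.2⟩
    rw [hχ1 _ (hball τ hτ'), one_smul]
    exact S.norm_velocity_le h hχ hT hχ1 h0 hball τ hτ'
  · have hd : ∀ τ ∈ Set.uIcc 0 T, HasDerivAt (fun τ => -((L + 1) * Y / c) * Real.exp (-c * τ))
        ((L + 1) * Y * Real.exp (-c * τ)) τ := by
      intro τ _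
      have := (((hasDerivAt_id τ).const_mul (-c)).exp).const_mul (-((L + 1) * Y / c))
      refine this.congr_deriv ?_
      simp only [id]; field_simp
    rw [intervalIntegral.integral_eq_sub_of_hasDerivAt hd hint]
    refine le_trans ?_ S.R_ge
    have e1 : 2 * n * (L + 1) * Y / lam = (L + 1) * Y / c := by rw [hc]; field_simp
    have e2 : 0 ≤ (L + 1) * Y / c * Real.exp (-c * T) := by positivity
    rw [e1, mul_zero, Real.exp_zero]
    linarith

lemma norm_sub_le (S : LazySetting x y 𝒳 p₀ lam L Y R κ) (h : IsSpaceFlow x y χ θ s)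
    (hχ : Continuous χ) (hχ1 : ∀ v, ‖v - p₀‖ ≤ R → χ v = 1) (h0 : θ 0 = p₀) {t : ℝ} (ht : 0 ≤ t) :
    ‖θ t - p₀‖ ≤ R := by
  by_contra hlt
  rw [not_le] at hlt
  have hR := S.R_pos
  have hcont : Continuous fun t => ‖θ t - p₀‖ := (h.continuous.sub continuous_const).norm
  have hK : IsCompact (Set.Icc 0 t ∩ {τ | R ≤ ‖θ τ - p₀‖}) :=
    isCompact_Icc.inter_right (isClosed_le continuous_const hcont)
  obtain ⟨T, ⟨hT, hTR⟩, hmin⟩ := hK.exists_isLeast ⟨t, ⟨ht, le_rfl⟩, hlt.le⟩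
  have hbefore : ∀ τ, 0 ≤ τ → τ < T → ‖θ τ - p₀‖ < R := by
    intro τ h1 h2
    by_contra h3
    exact absurd (hmin ⟨⟨h1, h2.le.trans hT.2⟩, not_lt.1 h3⟩) (not_le.2 h2)
  have hTpos : 0 < T := by
    rcases hT.1.eq_or_lt with e | e
    · rw [← e] at hTR
      simp only [Set.mem_ofPred_eq, h0, sub_self, norm_zero] at hTR
      linarith
    · exact e
  have hlim : ‖θ T - p₀‖ ≤ R / 2 := by
    have ht1 : Tendsto (fun τ => ‖θ τ - p₀‖) (𝓝[<] T) (𝓝 ‖θ T - p₀‖) :=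
      hcont.continuousAt.tendsto.mono_left nhdsWithin_le_nhds
    refine le_of_tendsto ht1 ?_
    filter_upwards [Ioo_mem_nhdsLT hTpos] with τ hτ
    exact S.norm_sub_le_half h hχ hτ.1.le hχ1 h0 fun a ha =>
      (hbefore a ha.1 (ha.2.trans_lt hτ.2)).le
  have : R ≤ ‖θ T - p₀‖ := hTR
  linarith

lemma indicator_mem_reluSubdiff (u : ℝ) : (if 0 < u then (1 : ℝ) else 0) ∈ reluSubdiff u := by
  split_ifs with h
  · exact ⟨zero_le_one, le_rfl, fun _ => rfl, fun h' => absurd h h'.not_gt⟩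
  · exact ⟨le_rfl, zero_le_one, fun h' => absurd h' h, fun _ => rfl⟩

theorem abs_network_sub_le (S : LazySetting x y 𝒳 p₀ lam L Y R κ) (h : IsSpaceFlow x y χ θ s)
    (hχ : Continuous χ) (hχ1 : ∀ v, ‖v - p₀‖ ≤ R → χ v = 1) (h0 : θ 0 = p₀) {t : ℝ} (ht : 0 ≤ t)
    {z : Input d} (hz : z ∈ 𝒳) :
    |network (ofSpace (θ t)) z - ntkRegression x y t z|
      ≤ κ * ((Y + L * (2 * (n / lam) * Y)) * (4 * n / lam)) := by
  have hball : ∀ τ ∈ Set.Icc 0 t, ‖θ τ - p₀‖ ≤ R := fun τ hτ => S.norm_sub_le h hχ hχ1 h0 hτ.1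
  have hdet := isUnit_det_ntkGram S.lam_pos S.coercive
  have hσ : ∀ τ : ℝ, ∀ r, (if 0 < preact (ofSpace (θ τ)) r z then (1 : ℝ) else 0) ∈
      reluSubdiff (preact (ofSpace (θ τ)) r z) := fun τ r => indicator_mem_reluSubdiff _
  have hcsum : ∀ z' : Input d, Continuous fun t => -(1 / (n : ℝ)) * ∑ j, ntk z' (x j) * ntkResidual x y j t :=
    fun z' => continuous_const.mul
      (continuous_finsetSum _ fun j _ => continuous_const.mul (continuous_ntkResidual j))
  exact abs_sub_le_of_flow (T := t) S.n_pos S.lam_pos S.coercive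
    (hasACDeriv_residual h hχ ht hχ1 hball)
    (fun i => HasACDeriv.of_hasDerivAt (fun τ => hasDerivAt_ntkResidual i τ) (hcsum (x i)))
    (fun i => by simp only [h0, S.network_init, ntkResidual_zero, zero_sub])
    (fun τ hτ i j => S.near_gram h hball τ ⟨hτ.1.le, hτ.2.le⟩ i j) S.κ_le S.κ_nonneg
    S.Y_nonneg (S.sum_sq_init h0) (fun j => S.bound z hz j)
    (hasACDeriv_network h hχ ht hχ1 hball z fun τ _ => hσ τ)
    (HasACDeriv.of_hasDerivAt (fun τ => hasDerivAt_ntkRegression hdet z τ) (hcsum z))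
    (fun τ hτ j => S.near (θ τ) (hball τ ⟨hτ.1.le, hτ.2.le⟩) z hz j _ _ (hσ τ)
      fun r => h.mem_subdiff r j τ hτ.1.le)
    (by simp only [h0, S.network_init, ntkRegression_zero]) ht le_rfl

/-- In the lazy regime the gradient flow exists for all times and stays close to kernel
regression. -/
theorem gradientFlow {q₀ : Params N d} (S : LazySetting x y 𝒳 (toSpace q₀) lam L Y R κ) :
    (∃ θ : ℝ → Params N d, θ 0 = q₀ ∧ IsGradientFlow x y θ) ∧
    ∀ θ : ℝ → Params N d, θ 0 = q₀ → IsGradientFlow x y θ → ∀ t, 0 ≤ t → ∀ z ∈ 𝒳,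
      |network (θ t) z - ntkRegression x y t z|
        ≤ κ * ((Y + L * (2 * (n / lam) * Y)) * (4 * n / lam)) := by
  constructor
  · obtain ⟨θ, s, h0, h⟩ := exists_isSpaceFlow (x := x) (y := y) (toSpace q₀) S.R_pos
    have hχ1 : ∀ v, ‖v - toSpace q₀‖ ≤ R → cutoff (toSpace q₀) R v = 1 := fun v hv =>
      cutoff_eq_one S.R_pos hv
    have hflow : IsSpaceFlow x y (fun _ => 1) θ s :=
      { toIsAdmissible := h.toIsAdmissible
        eq_integral := fun t ht => by
          rw [h.eq_integral t ht]
          congr 1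
          refine intervalIntegral.integral_congr fun τ hτ => ?_
          rw [Set.uIcc_of_le ht] at hτ
          rw [hχ1 _ (S.norm_sub_le h (continuous_cutoff _ _) hχ1 h0 hτ.1)] }
    refine ⟨fun t => ofSpace (θ t), ?_, hflow.isGradientFlow⟩
    simp only [h0, ofSpace_toSpace]
  · intro θ h0 hθ t ht z hz
    obtain ⟨s, h⟩ := hθ.exists_isSpaceFlow
    have := S.abs_network_sub_le h continuous_const (fun _ _ => rfl) (by simp [h0]) ht hz
    simpa only [max_eq_left ht, ofSpace_toSpace] using this

end LazySetting

end Lazy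

/-! ### Gaussian expectations of homogeneous functions -/

section Planar

/-- The standard Gaussian measure of the plane. -/
abbrev planarGaussian : Measure (ℝ × ℝ) := (gaussianReal 0 1).prod (gaussianReal 0 1)

lemma planarGaussian_map_linear (α β : ℝ) :
    planarGaussian.map (fun p => α * p.1 + β * p.2) = gaussianReal 0 (α ^ 2 + β ^ 2).toNNReal := by
  have h1 : (fun p : ℝ × ℝ => α * p.1 + β * p.2)
      = (fun p : ℝ × ℝ => p.1 + p.2) ∘ Prod.map (fun a => α * a) (fun b => β * b) := rfl
  rw [h1, ← Measure.map_map (by fun_prop) (by fun_prop),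
    ← Measure.map_prod_map _ _ (by fun_prop) (by fun_prop), gaussianReal_map_const_mul,
    gaussianReal_map_const_mul]
  change Measure.conv _ _ = _
  rw [gaussianReal_conv_gaussianReal]
  congr 1
  · ring
  · ext
    simp [Real.coe_toNNReal _ (by positivity : (0 : ℝ) ≤ α ^ 2 + β ^ 2)]

lemma integral_planarGaussian (F : ℝ × ℝ → ℝ) :
    ∫ p, F p ∂planarGaussian
      = ∫ p : ℝ × ℝ, (1 / (2 * Real.pi)) * Real.exp (-(p.1 ^ 2 + p.2 ^ 2) / 2) * F p := by
  rw [planarGaussian, gaussianReal_of_var_ne_zero _ one_ne_zero,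
    prod_withDensity (measurable_gaussianPDF 0 1) (measurable_gaussianPDF 0 1),
    integral_withDensity_eq_integral_toReal_smul]
  · rw [← Measure.volume_eq_prod]
    refine integral_congr_ae (Eventually.of_forall fun p => ?_)
    simp only [ENNReal.toReal_mul, toReal_gaussianPDF, gaussianPDFReal, smul_eq_mul, sub_zero,
      NNReal.coe_one, mul_one]
    have h : (√(2 * Real.pi))⁻¹ * (√(2 * Real.pi))⁻¹ = 1 / (2 * Real.pi) := by
      rw [← mul_inv, Real.mul_self_sqrt (by positivity), one_div]
    have h2 : Real.exp (-(p.1 ^ 2 + p.2 ^ 2) / 2) = Real.exp (-p.1 ^ 2 / 2) * Real.exp (-p.2 ^ 2 / 2) := by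
      rw [← Real.exp_add]; congr 1; ring
    rw [h2, ← h]; ring
  · exact ((measurable_gaussianPDF 0 1).comp measurable_fst).mul
      ((measurable_gaussianPDF 0 1).comp measurable_snd)
  · exact Eventually.of_forall fun p => ENNReal.mul_lt_top gaussianPDF_lt_top gaussianPDF_lt_top

lemma integral_planarGaussian_homogeneous (F : ℝ × ℝ → ℝ) (Φ : ℝ → ℝ) (k : ℕ)
    (h : ∀ r : ℝ, 0 < r → ∀ α, F (r * Real.cos α, r * Real.sin α) = r ^ k * Φ α) :
    ∫ p, F p ∂planarGaussian = (∫ r in Set.Ioi (0 : ℝ), r ^ (k + 1) * Real.exp (-r ^ 2 / 2)) *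
      (1 / (2 * Real.pi) * ∫ α in Set.Ioo (-Real.pi) Real.pi, Φ α) := by
  rw [integral_planarGaussian, ← integral_comp_polarCoord_symm, ← integral_const_mul,
    ← setIntegral_prod_mul]
  refine setIntegral_congr_fun (measurableSet_Ioi.prod measurableSet_Ioo) fun q hq => ?_
  have hq' : 0 < q.1 := hq.1
  simp only [polarCoord_symm_apply, smul_eq_mul]
  rw [h _ hq']
  have : (q.1 * Real.cos q.2) ^ 2 + (q.1 * Real.sin q.2) ^ 2 = q.1 ^ 2 := by
    have := Real.cos_sq_add_sin_sq q.2
    linear_combination q.1 ^ 2 * this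
  rw [this]; ring

lemma integral_mul_exp_neg_sq_div_two :
    ∫ r in Set.Ioi (0 : ℝ), r ^ (0 + 1) * Real.exp (-r ^ 2 / 2) = 1 := by
  have h := integral_rpow_mul_exp_neg_mul_rpow (p := 2) (q := 1) (b := 1 / 2) (by norm_num)
    (by norm_num) (by norm_num)
  have e : ∀ r : ℝ, r ^ (0 + 1) * Real.exp (-r ^ 2 / 2)
      = r ^ (1 : ℝ) * Real.exp (-(1 / 2) * r ^ (2 : ℝ)) := fun r => by
    rw [Real.rpow_one, zero_add, pow_one, Real.rpow_two]; congr 2; ring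
  simp_rw [e, h]
  norm_num [Real.rpow_neg_one]

lemma integral_pow_three_mul_exp_neg_sq_div_two :
    ∫ r in Set.Ioi (0 : ℝ), r ^ (2 + 1) * Real.exp (-r ^ 2 / 2) = 2 := by
  have h := integral_rpow_mul_exp_neg_mul_rpow (p := 2) (q := 3) (b := 1 / 2) (by norm_num)
    (by norm_num) (by norm_num)
  have e : ∀ r : ℝ, r ^ (2 + 1) * Real.exp (-r ^ 2 / 2)
      = r ^ (3 : ℝ) * Real.exp (-(1 / 2) * r ^ (2 : ℝ)) := fun r => by
    rw [Real.rpow_two, show (3 : ℝ) = ((3 : ℕ) : ℝ) by norm_num, Real.rpow_natCast]; congr 2; ring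
  simp_rw [e, h]
  have h2 : ((3 : ℝ) + 1) / 2 = 2 := by norm_num
  have h3 : -((3 : ℝ) + 1) / 2 = -2 := by norm_num
  rw [h2, h3, Real.Gamma_two, Real.rpow_neg (by norm_num), Real.rpow_two]
  norm_num

variable {ψ : ℝ}

/-- On `(-π, π)`, both `cos α` and `cos (α - ψ)` are positive iff `ψ - π/2 < α < π/2`. -/
lemma cos_pos_and_cos_sub_pos_iff (h0 : 0 ≤ ψ) (hπ : ψ ≤ Real.pi) {α : ℝ}
    (hα : α ∈ Set.Ioo (-Real.pi) Real.pi) :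
    (0 < Real.cos α ∧ 0 < Real.cos (α - ψ)) ↔ α ∈ Set.Ioo (ψ - Real.pi / 2) (Real.pi / 2) := by
  have hpi := Real.pi_pos
  constructor
  · rintro ⟨h1, h2⟩
    have h3 : -(Real.pi / 2) < α := by
      by_contra h
      have := Real.cos_nonpos_of_pi_div_two_le_of_le (x := -α) (by linarith) (by linarith [hα.1])
      rw [Real.cos_neg] at this
      linarith
    have h4 : α < Real.pi / 2 := by
      by_contra h
      have := Real.cos_nonpos_of_pi_div_two_le_of_le (x := α) (by linarith) (by linarith [hα.2])
      linarith
    refine ⟨?_, h4⟩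
    by_contra h
    have := Real.cos_nonpos_of_pi_div_two_le_of_le (x := ψ - α) (by linarith) (by linarith)
    rw [← Real.cos_neg, neg_sub] at this
    linarith
  · rintro ⟨h1, h2⟩
    exact ⟨Real.cos_pos_of_mem_Ioo ⟨by linarith, h2⟩,
      Real.cos_pos_of_mem_Ioo ⟨by linarith, by linarith⟩⟩

lemma Ioo_subset_Ioo_pi (h0 : 0 ≤ ψ) :
    Set.Ioo (ψ - Real.pi / 2) (Real.pi / 2) ⊆ Set.Ioo (-Real.pi) Real.pi := fun α hα =>
  ⟨by linarith [hα.1, Real.pi_pos], by linarith [hα.2, Real.pi_pos]⟩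

lemma integral_indicator_cos (h0 : 0 ≤ ψ) (hπ : ψ ≤ Real.pi) :
    ∫ α in Set.Ioo (-Real.pi) Real.pi, (if 0 < Real.cos α then (1 : ℝ) else 0) *
      (if 0 < Real.cos (α - ψ) then (1 : ℝ) else 0) = Real.pi - ψ := by
  have h1 : ∀ α ∈ Set.Ioo (-Real.pi) Real.pi, (if 0 < Real.cos α then (1 : ℝ) else 0) *
      (if 0 < Real.cos (α - ψ) then (1 : ℝ) else 0)
      = (Set.Ioo (ψ - Real.pi / 2) (Real.pi / 2)).indicator (fun _ => (1 : ℝ)) α := by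
    intro α hα
    have := cos_pos_and_cos_sub_pos_iff h0 hπ hα
    by_cases h : α ∈ Set.Ioo (ψ - Real.pi / 2) (Real.pi / 2)
    · rw [Set.indicator_of_mem h, if_pos (this.2 h).1, if_pos (this.2 h).2, one_mul]
    · rw [Set.indicator_of_notMem h]
      by_contra hne
      refine h (this.1 ⟨?_, ?_⟩)
      · by_contra h'; simp [h'] at hne
      · by_contra h'; simp [h'] at hne
  rw [setIntegral_congr_fun measurableSet_Ioo h1, setIntegral_indicator measurableSet_Ioo,
    Set.inter_eq_right.2 (Ioo_subset_Ioo_pi h0)]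
  simp only [integral_const, measureReal_restrict_apply_univ, smul_eq_mul, mul_one]
  rw [Real.volume_real_Ioo_of_le (by linarith [Real.pi_pos])]
  ring

lemma integral_relu_cos (h0 : 0 ≤ ψ) (hπ : ψ ≤ Real.pi) :
    ∫ α in Set.Ioo (-Real.pi) Real.pi, relu (Real.cos α) * relu (Real.cos (α - ψ))
      = 1 / 2 * ((Real.pi - ψ) * Real.cos ψ + Real.sin ψ) := by
  have h1 : ∀ α ∈ Set.Ioo (-Real.pi) Real.pi, relu (Real.cos α) * relu (Real.cos (α - ψ))
      = (Set.Ioo (ψ - Real.pi / 2) (Real.pi / 2)).indicator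
        (fun α => Real.cos α * Real.cos (α - ψ)) α := by
    intro α hα
    have := cos_pos_and_cos_sub_pos_iff h0 hπ hα
    by_cases h : α ∈ Set.Ioo (ψ - Real.pi / 2) (Real.pi / 2)
    · rw [Set.indicator_of_mem h, relu, relu, max_eq_left (this.2 h).1.le,
        max_eq_left (this.2 h).2.le]
    · rw [Set.indicator_of_notMem h]
      by_contra hne
      refine h (this.1 ⟨?_, ?_⟩)
      · by_contra h'; rw [relu, max_eq_right (not_lt.1 h'), zero_mul] at hne; exact hne rfl
      · by_contra h'; rw [relu, relu, max_eq_right (not_lt.1 h'), mul_zero] at hne; exact hne rfl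
  rw [setIntegral_congr_fun measurableSet_Ioo h1, setIntegral_indicator measurableSet_Ioo,
    Set.inter_eq_right.2 (Ioo_subset_Ioo_pi h0), ← integral_Ioc_eq_integral_Ioo,
    ← intervalIntegral.integral_of_le (by linarith)]
  have hd : ∀ α ∈ Set.uIcc (ψ - Real.pi / 2) (Real.pi / 2),
      HasDerivAt (fun α => 1 / 2 * (α * Real.cos ψ + 1 / 2 * Real.sin (2 * α - ψ)))
        (Real.cos α * Real.cos (α - ψ)) α := by
    intro α _
    have := ((((hasDerivAt_id α).mul_const (Real.cos ψ)).add
      (((((hasDerivAt_id α).const_mul 2).sub_const ψ).sin).const_mul (1 / 2)))).const_mul (1 / 2)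
    refine this.congr_deriv ?_
    have e1 : Real.cos ψ = Real.cos (α - (α - ψ)) := by congr 1; ring
    have e2 : Real.cos (2 * α - ψ) = Real.cos (α + (α - ψ)) := by congr 1; ring
    simp only [id]
    rw [e1, e2, Real.cos_sub, Real.cos_add]; ring
  rw [intervalIntegral.integral_eq_sub_of_hasDerivAt hd
    ((by fun_prop : Continuous fun α => Real.cos α * Real.cos (α - ψ)).intervalIntegrable _ _)]
  have e1 : Real.sin (2 * (Real.pi / 2) - ψ) = Real.sin ψ := by
    rw [mul_div_cancel₀ _ two_ne_zero, Real.sin_pi_sub]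
  have e2 : Real.sin (2 * (ψ - Real.pi / 2) - ψ) = -Real.sin ψ := by
    rw [show 2 * (ψ - Real.pi / 2) - ψ = -(Real.pi - ψ) by ring, Real.sin_neg, Real.sin_pi_sub]
  rw [e1, e2]; ring

lemma relu_mul_of_nonneg {c : ℝ} (hc : 0 ≤ c) (z : ℝ) : relu (c * z) = c * relu z := by
  rw [relu, relu, mul_max_of_nonneg _ _ hc, mul_zero]

lemma indicator_mul_of_pos {c : ℝ} (hc : 0 < c) (z : ℝ) :
    (if 0 < c * z then (1 : ℝ) else 0) = if 0 < z then (1 : ℝ) else 0 := by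
  simp only [mul_pos_iff_of_pos_left hc]

lemma rotate_polar (r α ψ : ℝ) :
    Real.cos ψ * (r * Real.cos α) + Real.sin ψ * (r * Real.sin α) = r * Real.cos (α - ψ) := by
  rw [Real.cos_sub]; ring

lemma integral_planar_indicator (h0 : 0 ≤ ψ) (hπ : ψ ≤ Real.pi) {A B : ℝ} (hA : 0 < A) (hB : 0 < B) :
    ∫ p, (if 0 < A * p.1 then (1 : ℝ) else 0) *
      (if 0 < B * (Real.cos ψ * p.1 + Real.sin ψ * p.2) then (1 : ℝ) else 0) ∂planarGaussian
      = (Real.pi - ψ) / (2 * Real.pi) := by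
  rw [integral_planarGaussian_homogeneous _ (fun α => (if 0 < Real.cos α then (1 : ℝ) else 0) *
      (if 0 < Real.cos (α - ψ) then (1 : ℝ) else 0)) 0, integral_mul_exp_neg_sq_div_two,
      integral_indicator_cos h0 hπ]
  · ring
  · intro r hr α
    simp only [rotate_polar, indicator_mul_of_pos hA, indicator_mul_of_pos hB, indicator_mul_of_pos hr]
    ring

lemma integral_planar_relu (h0 : 0 ≤ ψ) (hπ : ψ ≤ Real.pi) {A B : ℝ} (hA : 0 < A) (hB : 0 < B) :
    ∫ p, relu (A * p.1) * relu (B * (Real.cos ψ * p.1 + Real.sin ψ * p.2)) ∂planarGaussian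
      = A * B / (2 * Real.pi) * ((Real.pi - ψ) * Real.cos ψ + Real.sin ψ) := by
  rw [integral_planarGaussian_homogeneous _
      (fun α => A * B * (relu (Real.cos α) * relu (Real.cos (α - ψ)))) 2,
      integral_pow_three_mul_exp_neg_sq_div_two, integral_const_mul, integral_relu_cos h0 hπ]
  · ring
  · intro r hr α
    simp only [rotate_polar, relu_mul_of_nonneg hA.le, relu_mul_of_nonneg hB.le,
      relu_mul_of_nonneg hr.le]
    ring

end Planar

/-! ### The law of one neuron -/

lemma integrable_one_add_norm_pow {E : Type*} [NormedAddCommGroup E] [NormedSpace ℝ E]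
    [MeasurableSpace E] [BorelSpace E] [CompleteSpace E] [SecondCountableTopology E]
    (μ : Measure E) [IsGaussian μ] (C : ℝ) (k : ℕ) :
    Integrable (fun v => ‖1 + C * ‖v‖‖ ^ k) μ := by
  have h0 : MemLp (fun v : E => v) k μ := IsGaussian.memLp_id μ k (ENNReal.natCast_ne_top k)
  have h1 : MemLp (fun v : E => C * ‖v‖) k μ := h0.norm.const_mul C
  have h2 : MemLp (fun _ : E => (1 : ℝ)) k μ := memLp_const 1
  have hL : MemLp (fun v : E => 1 + C * ‖v‖) k μ := h2.add h1
  exact hL.integrable_norm_pow'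

section Neuron

variable {d : ℕ}

/-- The law of the hidden weights and bias of one neuron. -/
abbrev hiddenLaw (d : ℕ) : Measure ((Fin d → ℝ) × ℝ) :=
  (Measure.pi fun _ : Fin d => gaussianReal 0 1).prod (gaussianReal 0 1)

/-- The law of the parameters of one neuron. -/
abbrev neuronLaw (d : ℕ) : Measure (ℝ × (Fin d → ℝ) × ℝ) := (gaussianReal 0 1).prod (hiddenLaw d)

/-- The pre-activation of a neuron on `z`. -/
def hiddenPreact (h : (Fin d → ℝ) × ℝ) (z : Input d) : ℝ := ⟪WithLp.toLp 2 h.1, z⟫ + h.2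

lemma continuous_hiddenPreact (z : Input d) : Continuous fun h => hiddenPreact h z := by
  unfold hiddenPreact
  have : Continuous fun w : Fin d → ℝ => (WithLp.toLp 2 w : Input d) := PiLp.continuous_toLp 2 _
  exact ((this.comp continuous_fst).inner continuous_const).add continuous_snd

lemma pi_gaussian_map_inner (z : Input d) :
    (Measure.pi fun _ : Fin d => gaussianReal 0 1).map (fun w => ⟪(WithLp.toLp 2 w : Input d), z⟫)
      = gaussianReal 0 (‖z‖ ^ 2).toNNReal := by
  have h1 : (fun w : Fin d → ℝ => ⟪(WithLp.toLp 2 w : Input d), z⟫)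
      = (innerSL ℝ z : Input d →L[ℝ] ℝ) ∘ (WithLp.toLp 2) := by
    ext w; simp [real_inner_comm]
  rw [h1, ← Measure.map_map (by fun_prop) (by fun_prop), map_pi_eq_stdGaussian,
    IsGaussian.map_eq_gaussianReal, integral_strongDual_stdGaussian, variance_dual_stdGaussian,
    innerSL_apply_norm]

lemma hiddenLaw_map_linear (z : Input d) (β : ℝ) :
    (hiddenLaw d).map (fun h => ⟪(WithLp.toLp 2 h.1 : Input d), z⟫ + β * h.2)
      = gaussianReal 0 (‖z‖ ^ 2 + β ^ 2).toNNReal := by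
  have hm : Measurable fun w : Fin d → ℝ => ⟪(WithLp.toLp 2 w : Input d), z⟫ := by
    have : Continuous fun w : Fin d → ℝ => (WithLp.toLp 2 w : Input d) := PiLp.continuous_toLp 2 _
    exact (this.inner continuous_const).measurable
  have h1 : (fun h : (Fin d → ℝ) × ℝ => ⟪(WithLp.toLp 2 h.1 : Input d), z⟫ + β * h.2)
      = (fun p : ℝ × ℝ => p.1 + p.2) ∘
        Prod.map (fun w => ⟪(WithLp.toLp 2 w : Input d), z⟫) (fun b => β * b) := rfl
  rw [h1, ← Measure.map_map (by fun_prop) (hm.prodMap (by fun_prop)),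
    ← Measure.map_prod_map _ _ hm (by fun_prop), gaussianReal_map_const_mul,
    pi_gaussian_map_inner]
  change Measure.conv _ _ = _
  rw [gaussianReal_conv_gaussianReal]
  congr 1
  · ring
  · ext
    simp [Real.coe_toNNReal _ (by positivity : (0 : ℝ) ≤ ‖z‖ ^ 2 + β ^ 2)]

lemma sq_inner_add_one_le (z z' : Input d) :
    (⟪z, z'⟫ + 1) ^ 2 ≤ (‖z‖ ^ 2 + 1) * (‖z'‖ ^ 2 + 1) := by
  have h1 : ⟪z, z'⟫ ^ 2 ≤ ‖z‖ ^ 2 * ‖z'‖ ^ 2 := by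
    have := abs_real_inner_le_norm z z'
    rw [← mul_pow, ← sq_abs]
    gcongr
  have h2 : 2 * ⟪z, z'⟫ ≤ ‖z‖ ^ 2 + ‖z'‖ ^ 2 := by
    have := norm_sub_sq_real z z'
    nlinarith [sq_nonneg ‖z - z'‖]
  nlinarith

lemma mul_cos_ntkAngle (z z' : Input d) :
    √(‖z‖ ^ 2 + 1) * √(‖z'‖ ^ 2 + 1) * Real.cos (ntkAngle z z') = ⟪z, z'⟫ + 1 := by
  have hpos : 0 < √((‖z‖ ^ 2 + 1) * (‖z'‖ ^ 2 + 1)) := by positivity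
  have h := abs_le.1 (Real.abs_le_sqrt (sq_inner_add_one_le z z'))
  rw [ntkAngle, Real.cos_arccos, ← Real.sqrt_mul (by positivity), mul_div_cancel₀ _ hpos.ne']
  · rw [le_div_iff₀ hpos]; linarith [h.1]
  · rw [div_le_one hpos]; exact h.2

lemma ntkAngle_nonneg (z z' : Input d) : 0 ≤ ntkAngle z z' := Real.arccos_nonneg _

lemma ntkAngle_le_pi (z z' : Input d) : ntkAngle z z' ≤ Real.pi := Real.arccos_le_pi _

lemma mul_sin_ntkAngle (z z' : Input d) :
    √(‖z‖ ^ 2 + 1) * √(‖z'‖ ^ 2 + 1) * Real.sin (ntkAngle z z')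
      = √(‖z - z'‖ ^ 2 + ‖z‖ ^ 2 * ‖z'‖ ^ 2 - ⟪z, z'⟫ ^ 2) := by
  have h0 : 0 ≤ Real.sin (ntkAngle z z') :=
    Real.sin_nonneg_of_nonneg_of_le_pi (ntkAngle_nonneg z z') (ntkAngle_le_pi z z')
  have hA : √(‖z‖ ^ 2 + 1) ^ 2 = ‖z‖ ^ 2 + 1 := Real.sq_sqrt (by positivity)
  have hB : √(‖z'‖ ^ 2 + 1) ^ 2 = ‖z'‖ ^ 2 + 1 := Real.sq_sqrt (by positivity)
  have hc := mul_cos_ntkAngle z z'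
  have hs := Real.cos_sq_add_sin_sq (ntkAngle z z')
  have hd := norm_sub_sq_real z z'
  have e : ‖z - z'‖ ^ 2 + ‖z‖ ^ 2 * ‖z'‖ ^ 2 - ⟪z, z'⟫ ^ 2
      = (√(‖z‖ ^ 2 + 1) * √(‖z'‖ ^ 2 + 1) * Real.sin (ntkAngle z z')) ^ 2 := by
    have hsin : Real.sin (ntkAngle z z') ^ 2 = 1 - Real.cos (ntkAngle z z') ^ 2 := by linarith
    have h2 : (√(‖z‖ ^ 2 + 1) * √(‖z'‖ ^ 2 + 1) * Real.sin (ntkAngle z z')) ^ 2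
        = √(‖z‖ ^ 2 + 1) ^ 2 * √(‖z'‖ ^ 2 + 1) ^ 2
          - (√(‖z‖ ^ 2 + 1) * √(‖z'‖ ^ 2 + 1) * Real.cos (ntkAngle z z')) ^ 2 := by
      rw [mul_pow, mul_pow, hsin]; ring
    rw [h2, hc, hA, hB, hd]; ring
  rw [e, Real.sqrt_sq (by positivity)]

/-- The pre-activations on two inputs are jointly Gaussian. -/
lemma hiddenLaw_map_pair (z z' : Input d) :
    (hiddenLaw d).map (fun h => (hiddenPreact h z, hiddenPreact h z'))
      = planarGaussian.map (fun p => (√(‖z‖ ^ 2 + 1) * p.1,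
        √(‖z'‖ ^ 2 + 1) * (Real.cos (ntkAngle z z') * p.1 + Real.sin (ntkAngle z z') * p.2))) := by
  have hm1 : Measurable fun h : (Fin d → ℝ) × ℝ => (hiddenPreact h z, hiddenPreact h z') :=
    (continuous_hiddenPreact z).measurable.prodMk (continuous_hiddenPreact z').measurable
  have hm2 : Measurable (fun p : ℝ × ℝ => (√(‖z‖ ^ 2 + 1) * p.1,
      √(‖z'‖ ^ 2 + 1) * (Real.cos (ntkAngle z z') * p.1 + Real.sin (ntkAngle z z') * p.2))) := by
    fun_prop
  have := Measure.isProbabilityMeasure_map (μ := hiddenLaw d) hm1.aemeasurable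
  have := Measure.isProbabilityMeasure_map (μ := planarGaussian) hm2.aemeasurable
  refine Measure.ext_of_charFunDual (funext fun L => ?_)
  rw [charFunDual_eq_charFun_map_one, charFunDual_eq_charFun_map_one,
    Measure.map_map L.continuous.measurable hm1, Measure.map_map L.continuous.measurable hm2]
  have hL : ∀ a b : ℝ, L (a, b) = L (1, 0) * a + L (0, 1) * b := fun a b => by
    have : ((a, b) : ℝ × ℝ) = a • (1, 0) + b • (0, 1) := by simp
    rw [this, map_add, map_smul, map_smul]; simp [mul_comm]
  set s := L (1, 0)
  set t := L (0, 1)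
  set A := √(‖z‖ ^ 2 + 1) with hA
  set B := √(‖z'‖ ^ 2 + 1) with hB
  set ψ := ntkAngle z z'
  have e1 : (L ∘ fun h : (Fin d → ℝ) × ℝ => (hiddenPreact h z, hiddenPreact h z'))
      = fun h => ⟪(WithLp.toLp 2 h.1 : Input d), s • z + t • z'⟫ + (s + t) * h.2 := by
    ext h
    simp only [Function.comp_apply, hL, hiddenPreact, inner_add_right, inner_smul_right]
    ring
  have e2 : (L ∘ fun p : ℝ × ℝ => (A * p.1, B * (Real.cos ψ * p.1 + Real.sin ψ * p.2)))
      = fun p => (s * A + t * B * Real.cos ψ) * p.1 + (t * B * Real.sin ψ) * p.2 := by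
    ext p
    simp only [Function.comp_apply, hL]
    ring
  rw [e1, e2, hiddenLaw_map_linear, planarGaussian_map_linear]
  congr 3
  have h1 : ‖s • z + t • z'‖ ^ 2 = s ^ 2 * ‖z‖ ^ 2 + 2 * (s * t * ⟪z, z'⟫) + t ^ 2 * ‖z'‖ ^ 2 := by
    rw [norm_add_sq_real, norm_smul, norm_smul, inner_smul_left, inner_smul_right, mul_pow, mul_pow,
      Real.norm_eq_abs, Real.norm_eq_abs, sq_abs, sq_abs]
    simp only [conj_trivial]; ring
  have h2 : A ^ 2 = ‖z‖ ^ 2 + 1 := Real.sq_sqrt (by positivity)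
  have h3 : B ^ 2 = ‖z'‖ ^ 2 + 1 := Real.sq_sqrt (by positivity)
  have h4 : A * B * Real.cos ψ = ⟪z, z'⟫ + 1 := mul_cos_ntkAngle z z'
  have h5 := Real.cos_sq_add_sin_sq ψ
  rw [h1]
  linear_combination -s ^ 2 * h2 - t ^ 2 * h3 - 2 * s * t * h4 - t ^ 2 * B ^ 2 * h5

lemma integral_pair (z z' : Input d) {F : ℝ × ℝ → ℝ} (hF : Measurable F) :
    ∫ h, F (hiddenPreact h z, hiddenPreact h z') ∂hiddenLaw d
      = ∫ p, F (√(‖z‖ ^ 2 + 1) * p.1, √(‖z'‖ ^ 2 + 1) *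
        (Real.cos (ntkAngle z z') * p.1 + Real.sin (ntkAngle z z') * p.2)) ∂planarGaussian := by
  have hm1 : Measurable fun h : (Fin d → ℝ) × ℝ => (hiddenPreact h z, hiddenPreact h z') :=
    (continuous_hiddenPreact z).measurable.prodMk (continuous_hiddenPreact z').measurable
  have hm2 : Measurable (fun p : ℝ × ℝ => (√(‖z‖ ^ 2 + 1) * p.1,
      √(‖z'‖ ^ 2 + 1) * (Real.cos (ntkAngle z z') * p.1 + Real.sin (ntkAngle z z') * p.2))) := by
    fun_prop
  rw [← integral_map (φ := fun h => (hiddenPreact h z, hiddenPreact h z')) hm1.aemeasurable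
    hF.aestronglyMeasurable, hiddenLaw_map_pair, integral_map hm2.aemeasurable
    hF.aestronglyMeasurable]

/-- The derivative of the ReLU with value `0` at `0`. -/
def step (u : ℝ) : ℝ := if 0 < u then 1 else 0

lemma measurable_step : Measurable step :=
  Measurable.ite measurableSet_Ioi measurable_const measurable_const

lemma step_nonneg (u : ℝ) : 0 ≤ step u := by unfold step; split_ifs <;> norm_num

lemma step_le_one (u : ℝ) : step u ≤ 1 := by unfold step; split_ifs <;> norm_num

lemma integral_step (z z' : Input d) :
    ∫ h, step (hiddenPreact h z) * step (hiddenPreact h z') ∂hiddenLaw d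
      = (Real.pi - ntkAngle z z') / (2 * Real.pi) := by
  rw [integral_pair z z' (F := fun q => step q.1 * step q.2)
    ((measurable_step.comp measurable_fst).mul (measurable_step.comp measurable_snd))]
  exact integral_planar_indicator (ntkAngle_nonneg z z') (ntkAngle_le_pi z z') (by positivity)
    (by positivity)

lemma integral_relu (z z' : Input d) :
    ∫ h, relu (hiddenPreact h z) * relu (hiddenPreact h z') ∂hiddenLaw d
      = 1 / (2 * Real.pi) * ((Real.pi - ntkAngle z z') * (⟪z, z'⟫ + 1)
        + √(‖z - z'‖ ^ 2 + ‖z‖ ^ 2 * ‖z'‖ ^ 2 - ⟪z, z'⟫ ^ 2)) := by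
  have hr : Measurable relu := continuous_relu.measurable
  rw [integral_pair z z' (F := fun q => relu q.1 * relu q.2)
    ((hr.comp measurable_fst).mul (hr.comp measurable_snd))]
  refine (integral_planar_relu (ntkAngle_nonneg z z') (ntkAngle_le_pi z z') (by positivity)
    (by positivity)).trans ?_
  rw [← mul_cos_ntkAngle, ← mul_sin_ntkAngle]
  ring

/-! ### Moments -/

lemma isGaussian_pi : IsGaussian (Measure.pi fun _ : Fin d => gaussianReal 0 1) := by
  have h : (Measure.pi fun _ : Fin d => gaussianReal 0 1)
      = (stdGaussian (Input d)).map (PiLp.continuousLinearEquiv 2 ℝ fun _ : Fin d => ℝ) := by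
    rw [← map_pi_eq_stdGaussian, Measure.map_map (by fun_prop) (by fun_prop)]
    exact Measure.map_id.symm
  rw [h]
  infer_instance

/-- A bound for the norm of the parameters of a neuron. -/
def neuronSize (ω : ℝ × (Fin d → ℝ) × ℝ) : ℝ :=
  1 + |ω.1| + ‖(WithLp.toLp 2 ω.2.1 : Input d)‖ + |ω.2.2|

lemma one_le_neuronSize (ω : ℝ × (Fin d → ℝ) × ℝ) : 1 ≤ neuronSize ω := by
  unfold neuronSize; linarith [abs_nonneg ω.1, abs_nonneg ω.2.2, norm_nonneg (WithLp.toLp 2 ω.2.1 : Input d)]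

lemma continuous_neuronSize : Continuous (neuronSize (d := d)) := by
  unfold neuronSize
  have : Continuous fun w : Fin d → ℝ => (WithLp.toLp 2 w : Input d) := PiLp.continuous_toLp 2 _
  have := this.comp (continuous_fst.comp (continuous_snd (X := ℝ) (Y := (Fin d → ℝ) × ℝ)))
  have := this.norm
  simp only [Function.comp_apply] at this
  fun_prop

lemma norm_toLp_le (w : Fin d → ℝ) :
    ‖(WithLp.toLp 2 w : Input d)‖ ≤ d * ‖w‖ := by
  rw [EuclideanSpace.norm_eq]
  refine Real.sqrt_le_iff.2 ⟨by positivity, ?_⟩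
  calc ∑ i, ‖w i‖ ^ 2 ≤ ∑ _i : Fin d, ‖w‖ ^ 2 :=
        Finset.sum_le_sum fun i _ => by gcongr; exact norm_le_pi_norm w i
    _ = d * ‖w‖ ^ 2 := by simp
    _ ≤ (d : ℝ) ^ 2 * ‖w‖ ^ 2 := by
        gcongr
        exact_mod_cast Nat.le_self_pow two_ne_zero d
    _ = _ := by ring

lemma neuronSize_le (ω : ℝ × (Fin d → ℝ) × ℝ) : neuronSize ω ≤ 1 + (d + 2) * ‖ω‖ := by
  have h1 : |ω.1| ≤ ‖ω‖ := norm_fst_le ω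
  have h2 : ‖ω.2‖ ≤ ‖ω‖ := norm_snd_le ω
  have h3 : |ω.2.2| ≤ ‖ω.2‖ := norm_snd_le ω.2
  have h4 : ‖ω.2.1‖ ≤ ‖ω.2‖ := norm_fst_le ω.2
  have h5 := norm_toLp_le ω.2.1
  have h6 : (d : ℝ) * ‖ω.2.1‖ ≤ d * ‖ω‖ := by gcongr; exact h4.trans h2
  unfold neuronSize
  linarith

lemma integrable_neuronSize_pow (k : ℕ) :
    Integrable (fun ω => neuronSize ω ^ k) (neuronLaw d) := by
  have := isGaussian_pi (d := d)
  refine (integrable_one_add_norm_pow (neuronLaw d) ((d : ℝ) + 2) k).mono'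
    ((continuous_neuronSize.pow k).aestronglyMeasurable) (Eventually.of_forall fun ω => ?_)
  have h0 : 0 ≤ neuronSize ω := zero_le_one.trans (one_le_neuronSize ω)
  rw [norm_pow, Real.norm_of_nonneg h0]
  gcongr
  exact (neuronSize_le ω).trans (le_abs_self _)

lemma abs_hiddenPreact_le (ω : ℝ × (Fin d → ℝ) × ℝ) (z : Input d) :
    |hiddenPreact ω.2 z| ≤ (‖z‖ + 1) * neuronSize ω := by
  have h1 := abs_real_inner_le_norm (WithLp.toLp 2 ω.2.1 : Input d) z
  have h2 := abs_add_le ⟪(WithLp.toLp 2 ω.2.1 : Input d), z⟫ ω.2.2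
  unfold hiddenPreact neuronSize
  have := norm_nonneg z
  have := norm_nonneg (WithLp.toLp 2 ω.2.1 : Input d)
  have := abs_nonneg ω.1
  have := abs_nonneg ω.2.2
  nlinarith [mul_nonneg (norm_nonneg z) (abs_nonneg ω.1), mul_nonneg (norm_nonneg z) (abs_nonneg ω.2.2)]

lemma relu_nonneg (u : ℝ) : 0 ≤ relu u := le_max_right _ _

lemma relu_le_abs (u : ℝ) : relu u ≤ |u| := max_le (le_abs_self u) (abs_nonneg u)

/-- The contribution of one pair of mirrored neurons to the empirical tangent kernel. -/
def kernelSample (z z' : Input d) (ω : ℝ × (Fin d → ℝ) × ℝ) : ℝ :=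
  relu (hiddenPreact ω.2 z) * relu (hiddenPreact ω.2 z')
    + ω.1 ^ 2 * step (hiddenPreact ω.2 z) * step (hiddenPreact ω.2 z') * (⟪z, z'⟫ + 1)

lemma measurable_kernelSample (z z' : Input d) : Measurable (kernelSample z z') := by
  have h : ∀ z : Input d, Measurable fun ω : ℝ × (Fin d → ℝ) × ℝ => hiddenPreact ω.2 z :=
    fun z => (continuous_hiddenPreact z).measurable.comp measurable_snd
  have hr : Measurable relu := continuous_relu.measurable
  unfold kernelSample
  exact ((hr.comp (h z)).mul (hr.comp (h z'))).add
    ((((measurable_fst.pow_const 2).mul (measurable_step.comp (h z))).mul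
      (measurable_step.comp (h z'))).mul_const _)

lemma sq_fst_le (ω : ℝ × (Fin d → ℝ) × ℝ) : ω.1 ^ 2 ≤ neuronSize ω ^ 2 := by
  rw [← sq_abs]
  gcongr
  unfold neuronSize
  linarith [abs_nonneg ω.2.2, norm_nonneg (WithLp.toLp 2 ω.2.1 : Input d)]

lemma abs_inner_add_one_le (z z' : Input d) : |⟪z, z'⟫ + 1| ≤ (‖z‖ + 1) * (‖z'‖ + 1) := by
  have h1 := abs_real_inner_le_norm z z'
  have h2 := abs_add_le ⟪z, z'⟫ 1
  rw [abs_one] at h2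
  nlinarith [norm_nonneg z, norm_nonneg z']

lemma abs_kernelSample_le (z z' : Input d) (ω : ℝ × (Fin d → ℝ) × ℝ) :
    |kernelSample z z' ω| ≤ 2 * ((‖z‖ + 1) * (‖z'‖ + 1)) * neuronSize ω ^ 2 := by
  unfold kernelSample
  have h0 := one_le_neuronSize ω
  have h1 : |relu (hiddenPreact ω.2 z) * relu (hiddenPreact ω.2 z')|
      ≤ ((‖z‖ + 1) * neuronSize ω) * ((‖z'‖ + 1) * neuronSize ω) := by
    rw [abs_mul, abs_of_nonneg (relu_nonneg _), abs_of_nonneg (relu_nonneg _)]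
    exact mul_le_mul ((relu_le_abs _).trans (abs_hiddenPreact_le ω z))
      ((relu_le_abs _).trans (abs_hiddenPreact_le ω z')) (relu_nonneg _) (by positivity)
  have h2 : |ω.1 ^ 2 * step (hiddenPreact ω.2 z) * step (hiddenPreact ω.2 z') * (⟪z, z'⟫ + 1)|
      ≤ neuronSize ω ^ 2 * 1 * 1 * ((‖z‖ + 1) * (‖z'‖ + 1)) := by
    rw [abs_mul, abs_mul, abs_mul, abs_of_nonneg (sq_nonneg ω.1), abs_of_nonneg (step_nonneg _),
      abs_of_nonneg (step_nonneg _)]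
    exact mul_le_mul (mul_le_mul (mul_le_mul (sq_fst_le ω) (step_le_one _) (step_nonneg _)
      (by positivity)) (step_le_one _) (step_nonneg _) (by positivity))
      (abs_inner_add_one_le z z') (abs_nonneg _) (by positivity)
  refine (abs_add_le _ _).trans ((add_le_add h1 h2).trans (le_of_eq ?_))
  ring

lemma integral_sq_gaussian : ∫ a, a ^ 2 ∂(gaussianReal 0 1) = 1 := by
  have h := variance_eq_sub (μ := gaussianReal 0 1) (X := id) (memLp_id_gaussianReal 2)
  rw [variance_id_gaussianReal] at h
  simp only [Pi.pow_apply, id, integral_id_gaussianReal, NNReal.coe_one] at h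
  linarith

/-- The mean of the tangent kernel at initialization is the neural tangent kernel. -/
theorem integral_kernelSample (z z' : Input d) :
    2 * ∫ ω, kernelSample z z' ω ∂neuronLaw d + 1 = ntk z z' := by
  have hr : Measurable relu := continuous_relu.measurable
  have h : ∀ z : Input d, Measurable fun ω : ℝ × (Fin d → ℝ) × ℝ => hiddenPreact ω.2 z :=
    fun z => (continuous_hiddenPreact z).measurable.comp measurable_snd
  have i1 : Integrable (fun ω : ℝ × (Fin d → ℝ) × ℝ =>
      relu (hiddenPreact ω.2 z) * relu (hiddenPreact ω.2 z')) (neuronLaw d) := by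
    refine ((integrable_neuronSize_pow 2).const_mul ((‖z‖ + 1) * (‖z'‖ + 1))).mono'
      ((hr.comp (h z)).mul (hr.comp (h z'))).aestronglyMeasurable (Eventually.of_forall fun ω => ?_)
    have h0 := one_le_neuronSize ω
    rw [Real.norm_eq_abs, abs_mul, abs_of_nonneg (relu_nonneg _), abs_of_nonneg (relu_nonneg _)]
    refine (mul_le_mul ((relu_le_abs _).trans (abs_hiddenPreact_le ω z))
      ((relu_le_abs _).trans (abs_hiddenPreact_le ω z')) (relu_nonneg _) (by positivity)).trans
      (le_of_eq (by ring))
  have i2 : Integrable (fun ω : ℝ × (Fin d → ℝ) × ℝ =>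
      ω.1 ^ 2 * (step (hiddenPreact ω.2 z) * step (hiddenPreact ω.2 z'))) (neuronLaw d) := by
    refine (integrable_neuronSize_pow 2).mono'
      ((measurable_fst.pow_const 2).mul ((measurable_step.comp (h z)).mul
        (measurable_step.comp (h z')))).aestronglyMeasurable (Eventually.of_forall fun ω => ?_)
    rw [Real.norm_eq_abs, abs_mul, abs_mul, abs_of_nonneg (sq_nonneg ω.1),
      abs_of_nonneg (step_nonneg _), abs_of_nonneg (step_nonneg _)]
    have := mul_le_one₀ (step_le_one (hiddenPreact ω.2 z)) (step_nonneg (hiddenPreact ω.2 z')) (step_le_one _)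
    have h1 := sq_fst_le ω
    nlinarith [sq_nonneg ω.1]
  have e : ∀ ω : ℝ × (Fin d → ℝ) × ℝ, kernelSample z z' ω
      = relu (hiddenPreact ω.2 z) * relu (hiddenPreact ω.2 z')
        + (ω.1 ^ 2 * (step (hiddenPreact ω.2 z) * step (hiddenPreact ω.2 z'))) * (⟪z, z'⟫ + 1) :=
    fun ω => by rw [kernelSample]; ring
  simp_rw [e]
  rw [integral_add i1 (i2.mul_const _), integral_mul_const,
    integral_prod_mul (fun a : ℝ => a ^ 2)
      (fun h => step (hiddenPreact h z) * step (hiddenPreact h z')), integral_sq_gaussian,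
    integral_step]
  have e1 : ∫ ω, relu (hiddenPreact ω.2 z) * relu (hiddenPreact ω.2 z') ∂neuronLaw d
      = ∫ h, relu (hiddenPreact h z) * relu (hiddenPreact h z') ∂hiddenLaw d := by
    have := integral_prod_mul (μ := gaussianReal 0 1) (ν := hiddenLaw d) (fun _ : ℝ => (1 : ℝ))
      (fun h => relu (hiddenPreact h z) * relu (hiddenPreact h z'))
    simpa using this
  rw [e1, integral_relu, ntk]
  field_simp
  ring

/-- Small ball estimate for the pre-activations. -/
lemma hiddenLaw_abs_le (z : Input d) {ρ : ℝ} (hρ : 0 ≤ ρ) :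
    (hiddenLaw d).real {h | |hiddenPreact h z| ≤ ρ} ≤ ρ := by
  have hm := (continuous_hiddenPreact z).measurable
  have hlaw : (hiddenLaw d).map (fun h => hiddenPreact h z)
      = gaussianReal 0 (‖z‖ ^ 2 + 1).toNNReal := by
    have := hiddenLaw_map_linear z 1
    simpa [hiddenPreact] using this
  have hset : {h : (Fin d → ℝ) × ℝ | |hiddenPreact h z| ≤ ρ}
      = (fun h => hiddenPreact h z) ⁻¹' Set.Icc (-ρ) ρ := by
    ext h; simp [abs_le]
  have hv : (‖z‖ ^ 2 + 1).toNNReal ≠ 0 := by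
    simp only [ne_eq, Real.toNNReal_eq_zero, not_le]; positivity
  have hpdf : ∀ u, gaussianPDF 0 (‖z‖ ^ 2 + 1).toNNReal u ≤ ENNReal.ofReal (1 / 2) := by
    intro u
    refine ENNReal.ofReal_le_ofReal ?_
    rw [gaussianPDFReal, Real.coe_toNNReal _ (by positivity)]
    have h1 : Real.exp (-(u - 0) ^ 2 / (2 * (‖z‖ ^ 2 + 1))) ≤ 1 := by
      rw [Real.exp_le_one_iff]
      apply div_nonpos_of_nonpos_of_nonneg
      · simp only [neg_nonpos]; positivity
      · positivity
    have h2 : (√(2 * Real.pi * (‖z‖ ^ 2 + 1)))⁻¹ ≤ 1 / 2 := by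
      rw [one_div]
      refine inv_anti₀ two_pos (Real.le_sqrt_of_sq_le ?_)
      nlinarith [Real.pi_gt_three, sq_nonneg ‖z‖]
    exact (mul_le_mul h2 h1 (Real.exp_pos _).le (by norm_num)).trans (le_of_eq (mul_one _))
  rw [hset, measureReal_def, ← Measure.map_apply hm measurableSet_Icc, hlaw, gaussianReal_apply _ hv]
  refine ENNReal.toReal_le_of_le_ofReal hρ ?_
  calc ∫⁻ u in Set.Icc (-ρ) ρ, gaussianPDF 0 (‖z‖ ^ 2 + 1).toNNReal u
      ≤ ∫⁻ _ in Set.Icc (-ρ) ρ, ENNReal.ofReal (1 / 2) := lintegral_mono fun u => hpdf u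
    _ = ENNReal.ofReal (1 / 2) * volume (Set.Icc (-ρ) ρ) := setLIntegral_const _ _
    _ = ENNReal.ofReal ρ := by
      rw [Real.volume_Icc, ← ENNReal.ofReal_mul (by norm_num)]; congr 1; ring

end Neuron

/-! ### Strict positivity of the neural tangent kernel -/

section Positivity

variable {d n : ℕ}

instance isOpenPosMeasure_gaussianReal : (gaussianReal 0 1).IsOpenPosMeasure :=
  (gaussianReal_absolutelyContinuous' 0 one_ne_zero).isOpenPosMeasure

instance isOpenPosMeasure_neuronLaw : (neuronLaw d).IsOpenPosMeasure := by
  have h1 : (Measure.pi fun _ : Fin d => gaussianReal 0 1).IsOpenPosMeasure :=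
    Measure.pi.isOpenPosMeasure _
  have h2 : (hiddenLaw d).IsOpenPosMeasure := Measure.prod.instIsOpenPosMeasure
  exact Measure.prod.instIsOpenPosMeasure

/-- ReLU ridge functions at distinct points are linearly independent. -/
lemma exists_sum_relu_ne_zero {x : Fin n → Input d} (hx : Function.Injective x) {v : Fin n → ℝ}
    (hv : v ≠ 0) : ∃ (w : Input d) (b : ℝ), ∑ i, v i * relu (⟪w, x i⟫ + b) ≠ 0 := by
  classical
  obtain ⟨i₀, hi₀⟩ := Function.ne_iff.1 hv
  obtain ⟨i, hi, hmax⟩ := (Finset.univ.filter fun i => v i ≠ 0).exists_max_image (fun i => ‖x i‖)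
    ⟨i₀, by simpa using hi₀⟩
  rw [Finset.mem_filter] at hi
  have hlt : ∀ j, v j ≠ 0 → j ≠ i → ⟪x i, x j⟫ < ⟪x i, x i⟫ := by
    intro j hj hne
    have h1 := hmax j (by simpa using hj)
    have h2 : 0 < ‖x i - x j‖ ^ 2 := by
      have := norm_pos_iff.2 (sub_ne_zero.2 fun h => hne (hx h).symm)
      positivity
    rw [norm_sub_sq_real] at h2
    rw [real_inner_self_eq_norm_sq]
    nlinarith [norm_nonneg (x j), norm_nonneg (x i)]
  have hev : ∀ᶠ δ : ℝ in 𝓝[>] 0, ∀ j, v j ≠ 0 → j ≠ i → δ < ⟪x i, x i⟫ - ⟪x i, x j⟫ := by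
    refine eventually_all.2 fun j => ?_
    by_cases hj : v j ≠ 0 ∧ j ≠ i
    · filter_upwards [nhdsWithin_le_nhds (Iio_mem_nhds (sub_pos.2 (hlt j hj.1 hj.2)))] with δ hδ
        _ _ using hδ
    · exact Eventually.of_forall fun δ h1 h2 => absurd ⟨h1, h2⟩ hj
  obtain ⟨δ, hδ, hδ0⟩ := (hev.and self_mem_nhdsWithin).exists
  refine ⟨x i, δ - ⟪x i, x i⟫, ?_⟩
  rw [Finset.sum_eq_single i]
  · have : ⟪x i, x i⟫ + (δ - ⟪x i, x i⟫) = δ := by ring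
    rw [this, relu, max_eq_left (le_of_lt hδ0)]
    exact mul_ne_zero hi.2 (ne_of_gt hδ0)
  · intro j _ hne
    by_cases hj : v j = 0
    · rw [hj, zero_mul]
    · rw [relu, max_eq_right (by linarith [hδ j hj hne]), mul_zero]
  · simp

lemma sum_sum_kernelSample_ge (x : Fin n → Input d) (v : Fin n → ℝ)
    (ω : ℝ × (Fin d → ℝ) × ℝ) :
    (∑ i, v i * relu (hiddenPreact ω.2 (x i))) ^ 2
      ≤ ∑ i, ∑ j, v i * kernelSample (x i) (x j) ω * v j := by
  set c : Fin n → ℝ := fun i => v i * step (hiddenPreact ω.2 (x i)) with hc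
  have h1 : ‖∑ i, c i • x i‖ ^ 2 = ∑ i, ∑ j, c i * c j * ⟪x i, x j⟫ := by
    rw [← real_inner_self_eq_norm_sq, sum_inner]
    refine Finset.sum_congr rfl fun i _ => ?_
    rw [inner_sum]
    refine Finset.sum_congr rfl fun j _ => ?_
    rw [inner_smul_left, inner_smul_right]
    simp only [conj_trivial]
    ring
  have h2 : (∑ i, c i) ^ 2 = ∑ i, ∑ j, c i * c j := by
    rw [sq, Finset.sum_mul_sum]
  have h3 : (∑ i, v i * relu (hiddenPreact ω.2 (x i))) ^ 2
      = ∑ i, ∑ j, (v i * relu (hiddenPreact ω.2 (x i))) * (v j * relu (hiddenPreact ω.2 (x j))) := by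
    rw [sq, Finset.sum_mul_sum]
  have h4 : ∑ i, ∑ j, v i * kernelSample (x i) (x j) ω * v j
      = (∑ i, v i * relu (hiddenPreact ω.2 (x i))) ^ 2
        + ω.1 ^ 2 * (‖∑ i, c i • x i‖ ^ 2 + (∑ i, c i) ^ 2) := by
    rw [h1, h2, h3, ← Finset.sum_add_distrib, Finset.mul_sum, ← Finset.sum_add_distrib]
    refine Finset.sum_congr rfl fun i _ => ?_
    rw [← Finset.sum_add_distrib, Finset.mul_sum, ← Finset.sum_add_distrib]
    refine Finset.sum_congr rfl fun j _ => ?_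
    rw [kernelSample, hc]
    ring
  rw [h4]
  have : 0 ≤ ω.1 ^ 2 * (‖∑ i, c i • x i‖ ^ 2 + (∑ i, c i) ^ 2) := by positivity
  linarith

lemma integrable_kernelSample (z z' : Input d) : Integrable (kernelSample z z') (neuronLaw d) :=
  ((integrable_neuronSize_pow 2).const_mul _).mono'
    (measurable_kernelSample z z').aestronglyMeasurable
    (Eventually.of_forall fun ω => abs_kernelSample_le z z' ω)

lemma sum_sum_ntk_pos {x : Fin n → Input d} (hx : Function.Injective x) {v : Fin n → ℝ}
    (hv : v ≠ 0) : 0 < ∑ i, ∑ j, v i * ntk (x i) (x j) * v j := by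
  have hint : ∀ i j, Integrable (fun ω => v i * kernelSample (x i) (x j) ω * v j) (neuronLaw d) :=
    fun i j => ((integrable_kernelSample (x i) (x j)).const_mul (v i)).mul_const (v j)
  have hint1 : ∀ i, Integrable (fun ω => ∑ j, v i * kernelSample (x i) (x j) ω * v j)
      (neuronLaw d) := fun i => integrable_finsetSum _ fun j _ => hint i j
  have hint2 : Integrable (fun ω => ∑ i, ∑ j, v i * kernelSample (x i) (x j) ω * v j)
      (neuronLaw d) := integrable_finsetSum _ fun i _ => hint1 i
  have hcont : Continuous fun ω : ℝ × (Fin d → ℝ) × ℝ =>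
      (∑ i, v i * relu (hiddenPreact ω.2 (x i))) ^ 2 := by
    refine Continuous.pow (continuous_finsetSum _ fun i _ => continuous_const.mul ?_) 2
    exact continuous_relu.comp ((continuous_hiddenPreact (x i)).comp continuous_snd)
  have hsq : Integrable (fun ω : ℝ × (Fin d → ℝ) × ℝ =>
      (∑ i, v i * relu (hiddenPreact ω.2 (x i))) ^ 2) (neuronLaw d) := by
    refine hint2.mono' hcont.aestronglyMeasurable (Eventually.of_forall fun ω => ?_)
    rw [Real.norm_of_nonneg (sq_nonneg _)]
    exact sum_sum_kernelSample_ge x v ω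
  have hpos : 0 < ∫ ω, (∑ i, v i * relu (hiddenPreact ω.2 (x i))) ^ 2 ∂neuronLaw d := by
    rw [integral_pos_iff_support_of_nonneg (fun ω => sq_nonneg _) hsq]
    refine hcont.isOpen_support.measure_pos _ ?_
    obtain ⟨w, b, h⟩ := exists_sum_relu_ne_zero hx hv
    exact ⟨(0, (WithLp.ofLp w, b)), pow_ne_zero 2 h⟩
  have h1 := hpos.trans_le (integral_mono hsq hint2 fun ω => sum_sum_kernelSample_ge x v ω)
  rw [integral_finsetSum _ fun i _ => hint1 i] at h1
  have h2 : ∀ i, ∫ ω, ∑ j, v i * kernelSample (x i) (x j) ω * v j ∂neuronLaw d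
      = ∑ j, v i * ((ntk (x i) (x j) - 1) / 2) * v j := by
    intro i
    rw [integral_finsetSum _ fun j _ => hint i j]
    refine Finset.sum_congr rfl fun j _ => ?_
    rw [integral_mul_const, integral_const_mul, ← integral_kernelSample (x i) (x j)]
    ring
  simp_rw [h2] at h1
  have h3 : ∑ i, ∑ j, v i * ntk (x i) (x j) * v j
      = 2 * (∑ i, ∑ j, v i * ((ntk (x i) (x j) - 1) / 2) * v j) + (∑ i, v i) ^ 2 := by
    rw [sq, Finset.sum_mul_sum, Finset.mul_sum, ← Finset.sum_add_distrib]
    refine Finset.sum_congr rfl fun i _ => ?_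
    rw [Finset.mul_sum, ← Finset.sum_add_distrib]
    refine Finset.sum_congr rfl fun j _ => ?_
    ring
  rw [h3]
  positivity

/-- The Gram matrix of the neural tangent kernel at distinct points is coercive. -/
theorem exists_coercive (hn : 0 < n) {x : Fin n → Input d} (hx : Function.Injective x) :
    ∃ lam : ℝ, 0 < lam ∧ ∀ v : Fin n → ℝ,
      lam * ∑ i, v i ^ 2 ≤ ∑ i, ∑ j, v i * ntk (x i) (x j) * v j := by
  set Q : EuclideanSpace ℝ (Fin n) → ℝ := fun v => ∑ i, ∑ j, v i * ntk (x i) (x j) * v j with hQ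
  have hQc : Continuous Q := by
    refine continuous_finsetSum _ fun i _ => continuous_finsetSum _ fun j _ => ?_
    fun_prop
  have hne : (Metric.sphere (0 : EuclideanSpace ℝ (Fin n)) 1).Nonempty :=
    ⟨EuclideanSpace.single ⟨0, hn⟩ 1, by simp⟩
  obtain ⟨u, hu, hmin⟩ := (isCompact_sphere (0 : EuclideanSpace ℝ (Fin n)) 1).exists_isMinOn hne
    hQc.continuousOn
  have hu0 : (WithLp.ofLp u) ≠ 0 := by
    intro h
    have hu' : u = 0 := by ext i; exact congrFun h i
    simp [hu'] at hu
  refine ⟨Q u, sum_sum_ntk_pos hx hu0, fun v => ?_⟩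
  by_cases hv : v = 0
  · simp [hv]
  set V : EuclideanSpace ℝ (Fin n) := WithLp.toLp 2 v with hV
  have hV0 : 0 < ‖V‖ := norm_pos_iff.2 fun h => hv (by ext i; exact congrArg (fun w : EuclideanSpace ℝ (Fin n) => w i) h)
  have hVsq : ∑ i, v i ^ 2 = ‖V‖ ^ 2 := by
    rw [EuclideanSpace.norm_sq_eq]; simp [hV]
  have h1 : Q u ≤ Q (‖V‖⁻¹ • V) := by
    refine hmin ?_
    rw [mem_sphere_zero_iff_norm, norm_smul, norm_inv, norm_norm, inv_mul_cancel₀ hV0.ne']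
  have h2 : Q (‖V‖⁻¹ • V) = (‖V‖ ^ 2)⁻¹ * ∑ i, ∑ j, v i * ntk (x i) (x j) * v j := by
    simp only [hQ, Finset.mul_sum]
    refine Finset.sum_congr rfl fun i _ => Finset.sum_congr rfl fun j _ => ?_
    simp only [PiLp.smul_apply, smul_eq_mul, hV]
    ring
  rw [hVsq]
  rw [h2] at h1
  have := mul_le_mul_of_nonneg_right h1 (sq_nonneg ‖V‖)
  rwa [mul_comm (‖V‖ ^ 2)⁻¹, mul_assoc, inv_mul_cancel₀ (by positivity), mul_one] at this

lemma continuous_ntk (z' : Input d) : Continuous fun z : Input d => ntk z z' := by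
  unfold ntk ntkAngle
  have : ∀ z : Input d, √((‖z‖ ^ 2 + 1) * (‖z'‖ ^ 2 + 1)) ≠ 0 := fun z => by positivity
  have h1 : Continuous fun z : Input d => (⟪z, z'⟫ + 1) / √((‖z‖ ^ 2 + 1) * (‖z'‖ ^ 2 + 1)) := by
    refine Continuous.div (by fun_prop) ?_ this
    exact Real.continuous_sqrt.comp (by fun_prop)
  have h2 := Real.continuous_arccos.comp h1
  simp only [Function.comp_def] at h2
  have h3 : Continuous fun z : Input d => √(‖z - z'‖ ^ 2 + ‖z‖ ^ 2 * ‖z'‖ ^ 2 - ⟪z, z'⟫ ^ 2) :=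
    Real.continuous_sqrt.comp (by fun_prop)
  fun_prop

end Positivity

/-! ### Perturbation of the tangent kernel -/

/-- The indicator of `|u| ≤ ρ`. -/
def nearZero (ρ u : ℝ) : ℝ := if |u| ≤ ρ then 1 else 0

lemma nearZero_nonneg (ρ u : ℝ) : 0 ≤ nearZero ρ u := by unfold nearZero; split_ifs <;> norm_num

lemma nearZero_le_one (ρ u : ℝ) : nearZero ρ u ≤ 1 := by unfold nearZero; split_ifs <;> norm_num

lemma abs_subdiff_sub_step_le {u U s ρ X : ℝ} (hs : s ∈ reluSubdiff U) (h : |U - u| ≤ X)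
    (hρ : 0 < ρ) : |s - step u| ≤ nearZero ρ u + X / ρ := by
  obtain ⟨h0, h1, hp, hn⟩ := hs
  have hX : 0 ≤ X / ρ := div_nonneg ((abs_nonneg _).trans h) hρ.le
  have hle : |s - step u| ≤ 1 := by
    have := step_nonneg u
    have := step_le_one u
    rw [abs_le]; constructor <;> linarith
  unfold nearZero
  split_ifs with hu
  · linarith
  push Not at hu
  rcases le_or_gt ρ X with hXρ | hXρ
  · linarith [(one_le_div hρ).2 hXρ]
  have h2 := abs_le.1 h
  rcases lt_or_ge 0 u with hu0 | hu0
  · rw [abs_of_pos hu0] at hu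
    rw [hp (by linarith), step, if_pos hu0]
    simpa using hX
  · rw [abs_of_nonpos hu0] at hu
    rw [hn (by linarith), step, if_neg (not_lt.2 hu0)]
    simpa using hX

lemma abs_relu_mul_relu_sub_le (U U' u u' : ℝ) :
    |relu U * relu U' - relu u * relu u'| ≤ |U - u| * |U'| + |u| * |U' - u'| := by
  have e : relu U * relu U' - relu u * relu u'
      = (relu U - relu u) * relu U' + relu u * (relu U' - relu u') := by ring
  rw [e]
  refine (abs_add_le _ _).trans ?_
  rw [abs_mul, abs_mul, abs_of_nonneg (relu_nonneg U'), abs_of_nonneg (relu_nonneg u)]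
  exact add_le_add
    (mul_le_mul (abs_relu_sub_le _ _) (relu_le_abs _) (relu_nonneg _) (abs_nonneg _))
    (mul_le_mul (relu_le_abs _) (abs_relu_sub_le _ _) (abs_nonneg _) (abs_nonneg _))

lemma abs_sq_mul_sub_le {A a s s' σ σ' g g' : ℝ} (hs : 0 ≤ s) (hs1 : s ≤ 1) (hs' : 0 ≤ s')
    (hs1' : s' ≤ 1) (hσ : 0 ≤ σ) (hσ1 : σ ≤ 1) (hσ' : 0 ≤ σ') (hσ1' : σ' ≤ 1) :
    |A ^ 2 * s * s' * g - a ^ 2 * σ * σ' * g'|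
      ≤ |A ^ 2 - a ^ 2| * |g| + a ^ 2 * (|s - σ| + |s' - σ'|) * |g| + a ^ 2 * |g - g'| := by
  have e : A ^ 2 * s * s' * g - a ^ 2 * σ * σ' * g'
      = (A ^ 2 - a ^ 2) * (s * s') * g + a ^ 2 * ((s - σ) * s' + σ * (s' - σ')) * g
        + a ^ 2 * (σ * σ') * (g - g') := by ring
  rw [e]
  have hss : |s * s'| ≤ 1 := by rw [abs_of_nonneg (by positivity)]; exact mul_le_one₀ hs1 hs' hs1'
  have hσσ : |σ * σ'| ≤ 1 := by rw [abs_of_nonneg (by positivity)]; exact mul_le_one₀ hσ1 hσ' hσ1'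
  have h3 : |(s - σ) * s' + σ * (s' - σ')| ≤ |s - σ| + |s' - σ'| := by
    refine (abs_add_le _ _).trans ?_
    rw [abs_mul, abs_mul, abs_of_nonneg hs', abs_of_nonneg hσ]
    exact add_le_add (mul_le_of_le_one_right (abs_nonneg _) hs1')
      (mul_le_of_le_one_left (abs_nonneg _) hσ1)
  refine (abs_add_le _ _).trans (add_le_add ((abs_add_le _ _).trans (add_le_add ?_ ?_)) ?_)
  · rw [abs_mul, abs_mul]
    exact mul_le_mul_of_nonneg_right (mul_le_of_le_one_right (abs_nonneg _) hss) (abs_nonneg _)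
  · rw [abs_mul, abs_mul, abs_of_nonneg (sq_nonneg a)]
    exact mul_le_mul_of_nonneg_right (mul_le_mul_of_nonneg_left h3 (sq_nonneg a)) (abs_nonneg _)
  · rw [abs_mul, abs_mul, abs_of_nonneg (sq_nonneg a)]
    exact mul_le_mul_of_nonneg_right (mul_le_of_le_one_right (sq_nonneg a) hσσ) (abs_nonneg _)

lemma perturbation_algebra {C q D η ρ τ N N' c : ℝ} (hC : 1 ≤ C) (hq1 : 1 ≤ q) (hD : 0 ≤ D)
    (hη0 : 0 ≤ η) (hη1 : η ≤ 1) (hρ : 0 < ρ) (hτ : 0 < τ) (hN : 0 ≤ N) (hN' : 0 ≤ N')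
    (hc : 0 ≤ c) :
    (C * D + q * η) * (C * q + C * D) + C * q * (C * D)
      + (D * (2 * q + D) * C ^ 2
        + (c * (N + N') + q ^ 2 * ((C * D + q * η) / ρ + C * D / ρ)) * C ^ 2
        + q ^ 2 * (η * C))
      ≤ C ^ 3 * ((5 + 2 / ρ) * (τ * q ^ 4 + D ^ 2 / τ) + 2 * D ^ 2
        + (2 + 1 / ρ) * η * q ^ 4 + c * N + c * N') := by
  have hC0 : 0 < C := one_pos.trans_le hC
  have hq0 : 0 < q := one_pos.trans_le hq1
  have hqD : q ^ 2 * D ≤ τ * q ^ 4 + D ^ 2 / τ := by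
    have h := sq_nonneg (τ * q ^ 2 - D)
    have h2 : q ^ 2 * D * τ ≤ (τ * q ^ 4 + D ^ 2 / τ) * τ := by
      have : D ^ 2 / τ * τ = D ^ 2 := div_mul_cancel₀ _ hτ.ne'
      nlinarith [mul_nonneg (mul_nonneg hτ.le (sq_nonneg q)) hD]
    exact le_of_mul_le_mul_right h2 hτ
  have hqq : q ≤ q ^ 2 := le_self_pow₀ hq1 two_ne_zero
  have hq2 : q ^ 2 ≤ q ^ 4 := pow_le_pow_right₀ hq1 (by norm_num)
  have hq3 : q ^ 3 ≤ q ^ 4 := pow_le_pow_right₀ hq1 (by norm_num)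
  have hC23 : C ^ 2 ≤ C ^ 3 := pow_le_pow_right₀ hC (by norm_num)
  have hC1 : C ≤ C ^ 3 := le_self_pow₀ hC (by norm_num)
  have hinv : 0 < 1 / ρ := by positivity
  have P1 : (C * D + q * η) * (C * q + C * D) + C * q * (C * D) + D * (2 * q + D) * C ^ 2
      ≤ C ^ 3 * (5 * (q ^ 2 * D) + 2 * D ^ 2 + η * q ^ 4) := by
    have h1 : q * η * (C * q + C * D) ≤ C ^ 2 * (q ^ 2 * η + q * D) := by
      have hCC : C ≤ C ^ 2 := le_self_pow₀ hC two_ne_zero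
      have : q * η * (C * q + C * D) = C * (q ^ 2 * η + q * D * η) := by ring
      rw [this]
      refine mul_le_mul hCC ?_ (by positivity) (by positivity)
      have : q * D * η ≤ q * D := mul_le_of_le_one_right (by positivity) hη1
      linarith
    have h2 : q * D ≤ q ^ 2 * D := mul_le_mul_of_nonneg_right hqq hD
    have h3 : q ^ 2 * η ≤ q ^ 4 * η := mul_le_mul_of_nonneg_right hq2 hη0
    calc _ ≤ C ^ 2 * (5 * (q * D) + 2 * D ^ 2 + q ^ 2 * η) := by linarith
      _ ≤ C ^ 3 * (5 * (q ^ 2 * D) + 2 * D ^ 2 + η * q ^ 4) := by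
        refine mul_le_mul hC23 ?_ (by positivity) (by positivity)
        linarith
  have P2 : (c * (N + N') + q ^ 2 * ((C * D + q * η) / ρ + C * D / ρ)) * C ^ 2
      ≤ C ^ 3 * (c * N + c * N' + 2 / ρ * (q ^ 2 * D) + 1 / ρ * η * q ^ 4) := by
    have h1 : q ^ 2 * ((C * D + q * η) / ρ + C * D / ρ)
        = C * (2 / ρ * (q ^ 2 * D)) + 1 / ρ * η * q ^ 3 := by ring
    have h2 : 1 / ρ * η * q ^ 3 ≤ C * (1 / ρ * η * q ^ 4) :=
      (mul_le_mul_of_nonneg_left hq3 (by positivity)).trans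
        (le_mul_of_one_le_left (by positivity) hC)
    have h3 : c * (N + N') ≤ C * (c * (N + N')) :=
      le_mul_of_one_le_left (by positivity) hC
    rw [h1]
    calc _ ≤ (C * (c * (N + N')) + (C * (2 / ρ * (q ^ 2 * D)) + C * (1 / ρ * η * q ^ 4)))
          * C ^ 2 := mul_le_mul_of_nonneg_right (by linarith) (by positivity)
      _ = _ := by ring
  have P3 : q ^ 2 * (η * C) ≤ C ^ 3 * (η * q ^ 4) := by
    calc q ^ 2 * (η * C) = C * (η * q ^ 2) := by ring
      _ ≤ C ^ 3 * (η * q ^ 4) := by gcongr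
  have P4 : C ^ 3 * ((5 + 2 / ρ) * (q ^ 2 * D))
      ≤ C ^ 3 * ((5 + 2 / ρ) * (τ * q ^ 4 + D ^ 2 / τ)) := by gcongr
  linarith

section Neuron

variable {d : ℕ}

lemma norm_le_neuronSize (ω : ℝ × (Fin d → ℝ) × ℝ) :
    ‖(WithLp.toLp 2 ω.2.1 : Input d)‖ ≤ neuronSize ω := by
  unfold neuronSize; linarith [abs_nonneg ω.1, abs_nonneg ω.2.2]

lemma abs_preact_sub_le {C D η : ℝ} {ω : ℝ × (Fin d → ℝ) × ℝ} {W : Input d} {b : ℝ}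
    (hW : ‖W - WithLp.toLp 2 ω.2.1‖ ≤ D) (hb : |b - ω.2.2| ≤ D) {z z₀ : Input d}
    (hz : ‖z‖ + 1 ≤ C) (hη : ‖z - z₀‖ ≤ η) :
    |(⟪W, z⟫ + b) - hiddenPreact ω.2 z₀| ≤ C * D + neuronSize ω * η := by
  have hD : 0 ≤ D := (norm_nonneg _).trans hW
  have e : (⟪W, z⟫ + b) - hiddenPreact ω.2 z₀ = (⟪W - WithLp.toLp 2 ω.2.1, z⟫ + (b - ω.2.2))
      + ⟪(WithLp.toLp 2 ω.2.1 : Input d), z - z₀⟫ := by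
    rw [hiddenPreact, inner_sub_left, inner_sub_right]; ring
  rw [e]
  have h1 : |⟪W - WithLp.toLp 2 ω.2.1, z⟫| ≤ D * ‖z‖ :=
    (abs_real_inner_le_norm _ _).trans (mul_le_mul_of_nonneg_right hW (norm_nonneg _))
  have h2 : |⟪(WithLp.toLp 2 ω.2.1 : Input d), z - z₀⟫| ≤ neuronSize ω * η :=
    (abs_real_inner_le_norm _ _).trans (mul_le_mul (norm_le_neuronSize ω) hη (norm_nonneg _)
      (zero_le_one.trans (one_le_neuronSize ω)))
  have h3 : D * (‖z‖ + 1) ≤ D * C := mul_le_mul_of_nonneg_left hz hD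
  refine (abs_add_le _ _).trans (add_le_add ((abs_add_le _ _).trans ?_) h2)
  linarith

/-- The contribution of one neuron to the tangent kernel changes little when its parameters and the
first argument are perturbed. -/
lemma abs_neuronKernel_sub_le {C D η ρ τ : ℝ} {ω : ℝ × (Fin d → ℝ) × ℝ} {A a : ℝ} {W : Input d}
    {b : ℝ} (hC : 1 ≤ C) (ha : a ^ 2 = ω.1 ^ 2) (hA : |A - a| ≤ D)
    (hW : ‖W - WithLp.toLp 2 ω.2.1‖ ≤ D) (hb : |b - ω.2.2| ≤ D) {z z₀ z' : Input d}
    (hz : ‖z‖ + 1 ≤ C) (hz₀ : ‖z₀‖ + 1 ≤ C) (hz' : ‖z'‖ + 1 ≤ C) (hη : ‖z - z₀‖ ≤ η)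
    (hη1 : η ≤ 1) (hρ : 0 < ρ) (hτ : 0 < τ) {s s' : ℝ}
    (hs : s ∈ reluSubdiff (⟪W, z⟫ + b)) (hs' : s' ∈ reluSubdiff (⟪W, z'⟫ + b)) :
    |(relu (⟪W, z⟫ + b) * relu (⟪W, z'⟫ + b) + A ^ 2 * s * s' * (⟪z, z'⟫ + 1))
        - kernelSample z₀ z' ω|
      ≤ C ^ 3 * ((5 + 2 / ρ) * (τ * neuronSize ω ^ 4 + D ^ 2 / τ) + 2 * D ^ 2
        + (2 + 1 / ρ) * η * neuronSize ω ^ 4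
        + ω.1 ^ 2 * nearZero ρ (hiddenPreact ω.2 z₀)
        + ω.1 ^ 2 * nearZero ρ (hiddenPreact ω.2 z')) := by
  have hD : 0 ≤ D := (norm_nonneg _).trans hW
  have hη0 : 0 ≤ η := (norm_nonneg _).trans hη
  have hC0 : 0 < C := one_pos.trans_le hC
  set q := neuronSize ω with hq
  have hq1 : 1 ≤ q := one_le_neuronSize ω
  have hq0 : 0 < q := one_pos.trans_le hq1
  set u := hiddenPreact ω.2 z₀
  set u' := hiddenPreact ω.2 z'
  set U := ⟪W, z⟫ + b
  set U' := ⟪W, z'⟫ + b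
  have hU : |U - u| ≤ C * D + q * η := abs_preact_sub_le hW hb hz hη
  have hU' : |U' - u'| ≤ C * D := by
    have := abs_preact_sub_le (η := 0) hW hb hz' (z₀ := z') (by simp)
    simpa using this
  have hu : |u| ≤ C * q :=
    (abs_hiddenPreact_le ω z₀).trans (mul_le_mul_of_nonneg_right hz₀ hq0.le)
  have hu' : |u'| ≤ C * q :=
    (abs_hiddenPreact_le ω z').trans (mul_le_mul_of_nonneg_right hz' hq0.le)
  have hUabs : |U'| ≤ C * q + C * D := by
    have := abs_add_le u' (U' - u')
    rw [add_sub_cancel] at this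
    linarith
  have T1 : |relu U * relu U' - relu u * relu u'|
      ≤ (C * D + q * η) * (C * q + C * D) + C * q * (C * D) :=
    (abs_relu_mul_relu_sub_le U U' u u').trans (add_le_add
      (mul_le_mul hU hUabs (abs_nonneg _) (by positivity))
      (mul_le_mul hu hU' (abs_nonneg _) (by positivity)))
  have ha_le : a ^ 2 ≤ q ^ 2 := ha ▸ sq_fst_le ω
  have ha_abs : |a| ≤ q := abs_le_of_sq_le_sq ha_le hq0.le
  have hAa : |A ^ 2 - a ^ 2| ≤ D * (2 * q + D) := by
    have e : A ^ 2 - a ^ 2 = (A - a) * (2 * a + (A - a)) := by ring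
    rw [e, abs_mul]
    refine mul_le_mul hA ((abs_add_le _ _).trans (add_le_add ?_ hA)) (abs_nonneg _) hD
    rw [abs_mul, abs_two]
    linarith
  have hg : |⟪z, z'⟫ + 1| ≤ C ^ 2 := by
    refine (abs_inner_add_one_le z z').trans ?_
    rw [sq]
    exact mul_le_mul hz hz' (by positivity) hC0.le
  have hgg : |(⟪z, z'⟫ + 1) - (⟪z₀, z'⟫ + 1)| ≤ η * C := by
    have e : (⟪z, z'⟫ + 1) - (⟪z₀, z'⟫ + 1) = ⟪z - z₀, z'⟫ := by rw [inner_sub_left]; ring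
    rw [e]
    exact (abs_real_inner_le_norm _ _).trans
      (mul_le_mul hη (by linarith) (norm_nonneg _) hη0)
  have hσ : |s - step u| ≤ nearZero ρ u + (C * D + q * η) / ρ := abs_subdiff_sub_step_le hs hU hρ
  have hσ' : |s' - step u'| ≤ nearZero ρ u' + C * D / ρ := abs_subdiff_sub_step_le hs' hU' hρ
  have T2 := abs_sq_mul_sub_le (A := A) (a := a) (g := ⟪z, z'⟫ + 1) (g' := ⟪z₀, z'⟫ + 1) hs.1 hs.2.1
    hs'.1 hs'.2.1 (step_nonneg u) (step_le_one u) (step_nonneg u') (step_le_one u')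
  set N := nearZero ρ u
  set N' := nearZero ρ u'
  have hN : 0 ≤ N := nearZero_nonneg _ _
  have hN' : 0 ≤ N' := nearZero_nonneg _ _
  have T3 : |A ^ 2 * s * s' * (⟪z, z'⟫ + 1) - a ^ 2 * step u * step u' * (⟪z₀, z'⟫ + 1)|
      ≤ D * (2 * q + D) * C ^ 2
        + (a ^ 2 * (N + N') + q ^ 2 * ((C * D + q * η) / ρ + C * D / ρ)) * C ^ 2
        + q ^ 2 * (η * C) := by
    refine T2.trans (add_le_add (add_le_add (mul_le_mul hAa hg (abs_nonneg _) (by positivity)) ?_)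
      (mul_le_mul ha_le hgg (abs_nonneg _) (by positivity)))
    refine mul_le_mul ?_ hg (abs_nonneg _) (by positivity)
    have h1 : a ^ 2 * ((C * D + q * η) / ρ + C * D / ρ)
        ≤ q ^ 2 * ((C * D + q * η) / ρ + C * D / ρ) :=
      mul_le_mul_of_nonneg_right ha_le (by positivity)
    have h2 := mul_le_mul_of_nonneg_left (add_le_add hσ hσ') (sq_nonneg a)
    linarith
  have e : (relu U * relu U' + A ^ 2 * s * s' * (⟪z, z'⟫ + 1)) - kernelSample z₀ z' ω
      = (relu U * relu U' - relu u * relu u')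
        + (A ^ 2 * s * s' * (⟪z, z'⟫ + 1) - a ^ 2 * step u * step u' * (⟪z₀, z'⟫ + 1)) := by
    rw [kernelSample, ha]; ring
  rw [e, ← ha]
  refine (abs_add_le _ _).trans ((add_le_add T1 T3).trans ?_)
  exact perturbation_algebra hC hq1 hD hη0 hη1 hρ hτ hN hN' (sq_nonneg a)

end Neuron

/-! ### Mirrored networks -/

section Mirrored

variable {d m : ℕ}

/-- The index of the sample from which a neuron of the mirrored network is initialized. -/
def mirrorIdx (m : ℕ) : Fin (m + m) → Fin m := Fin.append id id

lemma sum_mirrorIdx (F : Fin m → ℝ) : ∑ r, F (mirrorIdx m r) = 2 * ∑ k, F k := by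
  rw [Fin.sum_univ_add]
  simp only [mirrorIdx, Fin.append_left, Fin.append_right, id]
  ring

lemma mirroredInit_w (ω : InitSample d m) (r : Fin (m + m)) :
    (mirroredInit ω).w r = WithLp.toLp 2 (ω (mirrorIdx m r)).2.1 := by
  refine Fin.addCases (fun i => ?_) (fun i => ?_) r
  · simp only [mirroredInit, mirrorIdx, Fin.append_left, id]
  · simp only [mirroredInit, mirrorIdx, Fin.append_right, id]

lemma mirroredInit_b (ω : InitSample d m) (r : Fin (m + m)) :
    (mirroredInit ω).b r = (ω (mirrorIdx m r)).2.2 := by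
  refine Fin.addCases (fun i => ?_) (fun i => ?_) r
  · simp only [mirroredInit, mirrorIdx, Fin.append_left, id]
  · simp only [mirroredInit, mirrorIdx, Fin.append_right, id]

lemma mirroredInit_a_sq (ω : InitSample d m) (r : Fin (m + m)) :
    (mirroredInit ω).a r ^ 2 = (ω (mirrorIdx m r)).1 ^ 2 := by
  refine Fin.addCases (fun i => ?_) (fun i => ?_) r
  · simp only [mirroredInit, mirrorIdx, Fin.append_left, id]
  · simp only [mirroredInit, mirrorIdx, Fin.append_right, id, neg_sq]

lemma network_mirroredInit (ω : InitSample d m) (z : Input d) : network (mirroredInit ω) z = 0 := by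
  rw [network, Fin.sum_univ_add]
  simp only [mirroredInit, preact, Fin.append_left, Fin.append_right, neg_mul,
    Finset.sum_neg_distrib, add_neg_cancel, mul_zero, add_zero]

/-- Near a typical mirrored initialization the tangent kernel is close to its average over the
initialization. -/
theorem abs_inner_gradVec_sub_le {C η ρ R α β : ℝ} (hm : 0 < m) {ω : InitSample d m}
    {v : ParamSpace (m + m) d} (hC : 1 ≤ C) (hρ : 0 < ρ) (hη1 : η ≤ 1)
    (hv : ‖v - toSpace (mirroredInit ω)‖ ≤ R) {z z₀ z' : Input d}
    (hz : ‖z‖ + 1 ≤ C) (hz₀ : ‖z₀‖ + 1 ≤ C) (hz' : ‖z'‖ + 1 ≤ C) (hη : ‖z - z₀‖ ≤ η)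
    {s s' : Fin (m + m) → ℝ} (hs : ∀ r, s r ∈ reluSubdiff (preact (ofSpace v) r z))
    (hs' : ∀ r, s' r ∈ reluSubdiff (preact (ofSpace v) r z'))
    (hβ : 1 / (m : ℝ) * ∑ k, neuronSize (ω k) ^ 4 ≤ β)
    (hα : 1 / (m : ℝ) * ∑ k, (ω k).1 ^ 2 * nearZero ρ (hiddenPreact (ω k).2 z₀) ≤ α)
    (hα' : 1 / (m : ℝ) * ∑ k, (ω k).1 ^ 2 * nearZero ρ (hiddenPreact (ω k).2 z') ≤ α) :
    |⟪gradVec v z s, gradVec v z' s'⟫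
        - (2 * (1 / (m : ℝ) * ∑ k, kernelSample z₀ z' (ω k)) + 1)|
      ≤ C ^ 3 * ((5 + 2 / ρ) * (2 * β + R ^ 2) / √m + 2 * R ^ 2 / m + (4 + 2 / ρ) * η * β
        + 4 * α) := by
  have hm0 : (0 : ℝ) < m := by exact_mod_cast hm
  have hsm : 0 < √(m : ℝ) := Real.sqrt_pos.2 hm0
  have hη0 : 0 ≤ η := (norm_nonneg _).trans hη
  set p := toSpace (mirroredInit ω) with hp
  set D : Fin (m + m) → ℝ := fun r =>
    √(projA r (v - p) ^ 2 + ‖projW r (v - p)‖ ^ 2 + projB r (v - p) ^ 2) with hDdef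
  have hDsq : ∀ r, D r ^ 2 = projA r (v - p) ^ 2 + ‖projW r (v - p)‖ ^ 2 + projB r (v - p) ^ 2 :=
    fun r => Real.sq_sqrt (by positivity)
  have hsumD : ∑ r, D r ^ 2 ≤ R ^ 2 := by
    have h1 := norm_sq_eq (v - p)
    have h2 : ‖v - p‖ ^ 2 ≤ R ^ 2 := by gcongr
    simp_rw [hDsq]
    nlinarith [sq_nonneg (projC (v - p))]
  have hDA : ∀ r, |projA r v - (mirroredInit ω).a r| ≤ D r := by
    intro r
    refine Real.abs_le_sqrt ?_
    rw [map_sub, hp, projA_toSpace]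
    nlinarith [sq_nonneg ‖projW r (v - toSpace (mirroredInit ω))‖,
      sq_nonneg (projB r (v - toSpace (mirroredInit ω)))]
  have hDW : ∀ r, ‖projW r v - WithLp.toLp 2 (ω (mirrorIdx m r)).2.1‖ ≤ D r := by
    intro r
    rw [← mirroredInit_w, ← projW_toSpace, ← map_sub, ← hp]
    refine Real.le_sqrt_of_sq_le ?_
    nlinarith [sq_nonneg (projA r (v - p)), sq_nonneg (projB r (v - p))]
  have hDB : ∀ r, |projB r v - (ω (mirrorIdx m r)).2.2| ≤ D r := by
    intro r
    rw [← mirroredInit_b, ← projB_toSpace, ← map_sub, ← hp]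
    refine Real.abs_le_sqrt ?_
    nlinarith [sq_nonneg (projA r (v - p)), sq_nonneg ‖projW r (v - p)‖]
  set τ : ℝ := 1 / √m with hτdef
  have hτ : 0 < τ := by positivity
  set B : ℝ := 1 / (m : ℝ) * ∑ k, neuronSize (ω k) ^ 4
  set V : ℝ := 1 / (m : ℝ) * ∑ k, (ω k).1 ^ 2 * nearZero ρ (hiddenPreact (ω k).2 z₀)
  set V' : ℝ := 1 / (m : ℝ) * ∑ k, (ω k).1 ^ 2 * nearZero ρ (hiddenPreact (ω k).2 z')
  have key : |⟪gradVec v z s, gradVec v z' s'⟫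
        - (2 * (1 / (m : ℝ) * ∑ k, kernelSample z₀ z' (ω k)) + 1)|
      ≤ 1 / (m : ℝ) * ∑ r, C ^ 3 * ((5 + 2 / ρ)
        * (τ * neuronSize (ω (mirrorIdx m r)) ^ 4 + D r ^ 2 / τ) + 2 * D r ^ 2
        + (2 + 1 / ρ) * η * neuronSize (ω (mirrorIdx m r)) ^ 4
        + (ω (mirrorIdx m r)).1 ^ 2 * nearZero ρ (hiddenPreact (ω (mirrorIdx m r)).2 z₀)
        + (ω (mirrorIdx m r)).1 ^ 2 * nearZero ρ (hiddenPreact (ω (mirrorIdx m r)).2 z')) := by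
    have e1 : 2 * (1 / (m : ℝ) * ∑ k, kernelSample z₀ z' (ω k))
        = 1 / (m : ℝ) * ∑ r, kernelSample z₀ z' (ω (mirrorIdx m r)) := by
      rw [sum_mirrorIdx fun k => kernelSample z₀ z' (ω k)]; ring
    have e2 : (2 : ℝ) / ((m + m : ℕ) : ℝ) = 1 / (m : ℝ) := by
      push_cast; field_simp; norm_num
    rw [inner_gradVec, e1, e2, add_sub_add_right_eq_sub, ← mul_sub, ← Finset.sum_sub_distrib,
      abs_mul, abs_of_pos (show (0 : ℝ) < 1 / m by positivity)]
    refine mul_le_mul_of_nonneg_left ((Finset.abs_sum_le_sum_abs _ _).trans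
      (Finset.sum_le_sum fun r _ => ?_)) (by positivity)
    exact abs_neuronKernel_sub_le hC (mirroredInit_a_sq ω r) (hDA r) (hDW r) (hDB r) hz hz₀ hz' hη
      hη1 hρ hτ (hs r) (hs' r)
  refine key.trans ?_
  have e3 : 1 / (m : ℝ) * ∑ r, C ^ 3 * ((5 + 2 / ρ)
        * (τ * neuronSize (ω (mirrorIdx m r)) ^ 4 + D r ^ 2 / τ) + 2 * D r ^ 2
        + (2 + 1 / ρ) * η * neuronSize (ω (mirrorIdx m r)) ^ 4
        + (ω (mirrorIdx m r)).1 ^ 2 * nearZero ρ (hiddenPreact (ω (mirrorIdx m r)).2 z₀)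
        + (ω (mirrorIdx m r)).1 ^ 2 * nearZero ρ (hiddenPreact (ω (mirrorIdx m r)).2 z'))
      = C ^ 3 * ((5 + 2 / ρ) * (2 * τ * B + 1 / (m * τ) * ∑ r, D r ^ 2)
        + 2 / m * ∑ r, D r ^ 2 + (4 + 2 / ρ) * η * B + 2 * V + 2 * V') := by
    rw [← Finset.mul_sum]
    simp only [Finset.sum_add_distrib, ← Finset.mul_sum, ← Finset.sum_div]
    rw [sum_mirrorIdx fun k => neuronSize (ω k) ^ 4,
      sum_mirrorIdx fun k => (ω k).1 ^ 2 * nearZero ρ (hiddenPreact (ω k).2 z₀),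
      sum_mirrorIdx fun k => (ω k).1 ^ 2 * nearZero ρ (hiddenPreact (ω k).2 z')]
    simp only [B, V, V']
    field_simp
    ring
  rw [e3]
  have hmτ : 1 / ((m : ℝ) * τ) = 1 / √m := by
    rw [hτdef, mul_one_div, Real.div_sqrt]
  have h1 : 2 * τ * B + 1 / (m * τ) * ∑ r, D r ^ 2 ≤ (2 * β + R ^ 2) / √m := by
    rw [hmτ, add_div]
    have h1 : 2 * τ * B ≤ 2 * τ * β := mul_le_mul_of_nonneg_left hβ (by positivity)
    have h2 : 1 / √m * ∑ r, D r ^ 2 ≤ 1 / √m * R ^ 2 :=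
      mul_le_mul_of_nonneg_left hsumD (by positivity)
    have e1 : 2 * τ * β = 2 * β / √m := by rw [hτdef]; ring
    have e2 : 1 / √m * R ^ 2 = R ^ 2 / √m := by ring
    linarith
  have h2 : 2 / (m : ℝ) * ∑ r, D r ^ 2 ≤ 2 * R ^ 2 / m := by
    rw [mul_div_right_comm]
    exact mul_le_mul_of_nonneg_left hsumD (by positivity)
  have h3 : (4 + 2 / ρ) * η * B ≤ (4 + 2 / ρ) * η * β :=
    mul_le_mul_of_nonneg_left hβ (by positivity)
  have h4 := mul_le_mul_of_nonneg_left h1 (show 0 ≤ 5 + 2 / ρ by positivity)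
  rw [← mul_div_assoc (5 + 2 / ρ) (2 * β + R ^ 2) (√(m : ℝ))] at h4
  exact mul_le_mul_of_nonneg_left (by linarith) (by positivity)

end Mirrored

/-! ### Concentration of averages -/

section Concentration

variable {Ω : Type*} [MeasurableSpace Ω] {ν : Measure Ω} [IsProbabilityMeasure ν] {m : ℕ}

/-- Chebyshev's inequality for averages of independent samples. -/
lemma measureReal_average_sub_ge_le (hm : 0 < m) {X : Ω → ℝ} (hX : MemLp X 2 ν) {δ : ℝ}
    (hδ : 0 < δ) :
    (Measure.pi fun _ : Fin m => ν).real
        {ω | δ ≤ |1 / (m : ℝ) * ∑ k, X (ω k) - ∫ a, X a ∂ν|} ≤ Var[X; ν] / δ ^ 2 / m := by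
  have hm0 : (0 : ℝ) < m := by exact_mod_cast hm
  set μ := Measure.pi fun _ : Fin m => ν
  set S : (Fin m → Ω) → ℝ := ∑ k : Fin m, fun ω => X (ω k) with hS
  have hSapp : ∀ ω, S ω = ∑ k, X (ω k) := fun ω => by rw [hS, Finset.sum_apply]
  have hcomp : ∀ k : Fin m, MemLp (fun ω : Fin m → Ω => X (ω k)) 2 μ := fun k =>
    hX.comp_measurePreserving (measurePreserving_eval (fun _ : Fin m => ν) k)
  have hSL : MemLp S 2 μ := memLp_finsetSum' _ fun k _ => hcomp k
  have hvar : Var[S; μ] = m * Var[X; ν] := by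
    rw [hS, variance_sum_pi (μ := fun _ : Fin m => ν) (X := fun _ => X) fun _ => hX]
    simp
  have hmean : μ[S] = m * ∫ a, X a ∂ν := by
    simp_rw [hSapp]
    rw [integral_finsetSum _ fun k _ => (hcomp k).integrable one_le_two]
    have : ∀ k : Fin m, ∫ ω, X (ω k) ∂μ = ∫ a, X a ∂ν := fun k =>
      integral_comp_eval (μ := fun _ : Fin m => ν) hX.1
    simp [this]
  have h := meas_ge_le_variance_div_sq hSL (show 0 < m * δ by positivity)
  have hset : {ω : Fin m → Ω | δ ≤ |1 / (m : ℝ) * ∑ k, X (ω k) - ∫ a, X a ∂ν|}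
      = {ω | m * δ ≤ |S ω - μ[S]|} := by
    ext ω
    simp only [Set.mem_ofPred_eq]
    have e : S ω - μ[S] = m * (1 / (m : ℝ) * ∑ k, X (ω k) - ∫ a, X a ∂ν) := by
      rw [hSapp, hmean]; field_simp
    rw [e, abs_mul, abs_of_pos hm0, mul_le_mul_iff_right₀ hm0]
  rw [hset, measureReal_def]
  refine ENNReal.toReal_le_of_le_ofReal (by have := variance_nonneg X ν; positivity)
    (h.trans (le_of_eq ?_))
  rw [hvar]
  congr 1
  field_simp

lemma exists_average_event {ι : Type*} [Fintype ι] {X : ι → Ω → ℝ} (hXm : ∀ i, Measurable (X i))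
    (hX : ∀ i, MemLp (X i) 2 ν) {δ : ℝ} (hδ : 0 < δ) :
    ∃ C : ℝ, ∀ m : ℕ, 0 < m → ∃ E : Set (Fin m → Ω), MeasurableSet E ∧
      1 - C / m ≤ (Measure.pi fun _ : Fin m => ν).real E ∧
      ∀ ω ∈ E, ∀ i, |1 / (m : ℝ) * ∑ k, X i (ω k) - ∫ a, X i a ∂ν| < δ := by
  refine ⟨∑ i, Var[X i; ν] / δ ^ 2, fun m hm => ?_⟩
  set μ := Measure.pi fun _ : Fin m => ν
  set B : ι → Set (Fin m → Ω) := fun i =>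
    {ω | δ ≤ |1 / (m : ℝ) * ∑ k, X i (ω k) - ∫ a, X i a ∂ν|}
  have hB : ∀ i, MeasurableSet (B i) := by
    intro i
    refine measurableSet_le measurable_const ?_
    have : Measurable fun ω : Fin m → Ω => ∑ k, X i (ω k) :=
      Finset.measurable_sum _ fun k _ => (hXm i).comp (measurable_pi_apply k)
    exact ((this.const_mul _).sub_const _).norm
  have hU : MeasurableSet (⋃ i, B i) := MeasurableSet.iUnion hB
  refine ⟨(⋃ i, B i)ᶜ, hU.compl, ?_, fun ω hω i => ?_⟩
  · rw [probReal_compl_eq_one_sub hU, Finset.sum_div]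
    have h1 : μ.real (⋃ i, B i) ≤ ∑ i, μ.real (B i) := measureReal_iUnion_fintype_le _
    have h2 : ∑ i, μ.real (B i) ≤ ∑ i, Var[X i; ν] / δ ^ 2 / m :=
      Finset.sum_le_sum fun i _ => measureReal_average_sub_ge_le hm (hX i) hδ
    linarith
  · by_contra h
    exact hω (Set.mem_iUnion.2 ⟨i, not_lt.1 h⟩)

end Concentration

/-! ### The tangent kernel at a typical initialization -/

section Typical

variable {d n : ℕ}

lemma memLp_of_abs_le_neuronSize_pow {X : ℝ × (Fin d → ℝ) × ℝ → ℝ} (hX : Measurable X) {c : ℝ}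
    {k : ℕ} (h : ∀ ω, |X ω| ≤ c * neuronSize ω ^ k) : MemLp X 2 (neuronLaw d) := by
  refine (memLp_two_iff_integrable_sq hX.aestronglyMeasurable).2 ?_
  refine ((integrable_neuronSize_pow (2 * k)).const_mul (c ^ 2)).mono'
    (hX.pow_const 2).aestronglyMeasurable (Eventually.of_forall fun ω => ?_)
  rw [Real.norm_of_nonneg (sq_nonneg _), ← sq_abs, mul_comm 2 k, pow_mul, ← mul_pow]
  exact pow_le_pow_left₀ (abs_nonneg _) (h ω) 2

lemma measurable_nearZero (ρ : ℝ) : Measurable (nearZero ρ) :=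
  Measurable.ite (measurableSet_le measurable_norm measurable_const) measurable_const
    measurable_const

/-- The squared output weight of a neuron, restricted to the event that its pre-activation at `z`
is small. -/
def kinkSample (ρ : ℝ) (z : Input d) (ω : ℝ × (Fin d → ℝ) × ℝ) : ℝ :=
  ω.1 ^ 2 * nearZero ρ (hiddenPreact ω.2 z)

lemma measurable_kinkSample (ρ : ℝ) (z : Input d) : Measurable (kinkSample ρ z) :=
  (measurable_fst.pow_const 2).mul ((measurable_nearZero ρ).comp
    ((continuous_hiddenPreact z).measurable.comp measurable_snd))

lemma abs_kinkSample_le (ρ : ℝ) (z : Input d) (ω : ℝ × (Fin d → ℝ) × ℝ) :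
    |kinkSample ρ z ω| ≤ 1 * neuronSize ω ^ 2 := by
  rw [kinkSample, abs_mul, abs_of_nonneg (sq_nonneg ω.1), abs_of_nonneg (nearZero_nonneg _ _),
    mul_comm]
  exact mul_le_mul (nearZero_le_one _ _) (sq_fst_le ω) (sq_nonneg _) zero_le_one

lemma integral_kinkSample_le {ρ : ℝ} (hρ : 0 ≤ ρ) (z : Input d) :
    ∫ ω, kinkSample ρ z ω ∂neuronLaw d ≤ ρ := by
  have hset : MeasurableSet {h : (Fin d → ℝ) × ℝ | |hiddenPreact h z| ≤ ρ} :=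
    measurableSet_le (continuous_hiddenPreact z).norm.measurable measurable_const
  have e : (fun h => nearZero ρ (hiddenPreact h z))
      = Set.indicator {h : (Fin d → ℝ) × ℝ | |hiddenPreact h z| ≤ ρ} 1 := by
    ext h
    simp only [nearZero, Set.indicator_apply, Set.mem_ofPred_eq, Pi.one_apply]
  have h1 : ∫ ω, kinkSample ρ z ω ∂neuronLaw d
      = (∫ a, a ^ 2 ∂gaussianReal 0 1) * ∫ h, nearZero ρ (hiddenPreact h z) ∂hiddenLaw d :=
    integral_prod_mul (fun a : ℝ => a ^ 2) fun h => nearZero ρ (hiddenPreact h z)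
  rw [h1, integral_sq_gaussian, one_mul, e, integral_indicator_one hset]
  exact hiddenLaw_abs_le z hρ

lemma exists_ntk_modulus {𝒳 : Set (Input d)} (h𝒳 : IsCompact 𝒳) (x : Fin n → Input d) {κ : ℝ}
    (hκ : 0 < κ) : ∃ η > 0, ∀ z ∈ 𝒳, ∀ z₀ ∈ 𝒳, ‖z - z₀‖ < η → ∀ j,
      |ntk z (x j) - ntk z₀ (x j)| ≤ κ := by
  have hc : Continuous fun (z : Input d) (j : Fin n) => ntk z (x j) :=
    continuous_pi fun j => continuous_ntk (x j)
  obtain ⟨η, hη, h⟩ := Metric.uniformContinuousOn_iff.1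
    (h𝒳.uniformContinuousOn_of_continuous hc.continuousOn) κ hκ
  refine ⟨η, hη, fun z hz z₀ hz₀ hzz j => ?_⟩
  have h1 := h z hz z₀ hz₀ (by rwa [dist_eq_norm])
  have h2 := dist_le_pi_dist (fun j => ntk z (x j)) (fun j => ntk z₀ (x j)) j
  rw [Real.dist_eq] at h2
  exact h2.trans h1.le

lemma eventually_le_of_sqrt (F G H κ : ℝ) (hκ : 0 < κ) :
    ∀ᶠ m : ℕ in atTop, F * (G / √(m : ℝ) + H / m) ≤ κ := by
  have h1 : Tendsto (fun m : ℕ => G / √(m : ℝ)) atTop (𝓝 0) :=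
    tendsto_const_nhds.div_atTop (Real.tendsto_sqrt_atTop.comp tendsto_natCast_atTop_atTop)
  have h2 : Tendsto (fun m : ℕ => H / (m : ℝ)) atTop (𝓝 0) :=
    tendsto_const_nhds.div_atTop tendsto_natCast_atTop_atTop
  have h3 := (h1.add h2).const_mul F
  rw [add_zero, mul_zero] at h3
  exact (h3.eventually_lt_const hκ).mono fun m hm => hm.le

/-- With high probability the tangent kernel is uniformly close to its limit on a ball of fixed
radius around the initialization. -/
theorem exists_nearKernel_event {𝒳 : Set (Input d)} (h𝒳 : IsCompact 𝒳) {x : Fin n → Input d}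
    (hx : ∀ i, x i ∈ 𝒳) {κ : ℝ} (hκ : 0 < κ) (R : ℝ) :
    ∃ C : ℝ, ∀ᶠ m : ℕ in atTop, ∃ E : Set (InitSample d m), MeasurableSet E ∧
      1 - C / m ≤ (initLaw d m).real E ∧
      ∀ ω ∈ E, NearKernel x 𝒳 (toSpace (mirroredInit ω)) R κ := by
  obtain ⟨c₀, hc₀⟩ := h𝒳.isBounded.exists_norm_le
  set c := max (c₀ + 1) 1
  have hc1 : 1 ≤ c := le_max_right _ _
  have hc : ∀ z ∈ 𝒳, ‖z‖ + 1 ≤ c := fun z hz =>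
    (add_le_add (hc₀ z hz) le_rfl).trans (le_max_left _ _)
  set F := c ^ 3
  have hF : 0 < F := by positivity
  set ρ := κ / (40 * F)
  have hρ : 0 < ρ := by positivity
  set β := (∫ ω, neuronSize ω ^ 4 ∂neuronLaw d) + 1
  have hβ : 0 < β := by
    have : 0 ≤ ∫ ω, neuronSize ω ^ 4 ∂neuronLaw d :=
      integral_nonneg fun ω => pow_nonneg (zero_le_one.trans (one_le_neuronSize ω)) 4
    positivity
  obtain ⟨η', hη', hmod⟩ := exists_ntk_modulus h𝒳 x (show 0 < κ / 5 by positivity)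
  set η₂ := κ / (5 * F * ((4 + 2 / ρ) * β))
  have hη₂ : 0 < η₂ := by positivity
  set η := min η' (min 1 η₂)
  have hη : 0 < η := lt_min hη' (lt_min one_pos hη₂)
  have hη1 : η ≤ 1 := (min_le_right _ _).trans (min_le_left _ _)
  have hηβ : F * ((4 + 2 / ρ) * η * β) ≤ κ / 5 := by
    have h1 : η ≤ η₂ := (min_le_right _ _).trans (min_le_right _ _)
    calc F * ((4 + 2 / ρ) * η * β) ≤ F * ((4 + 2 / ρ) * η₂ * β) := by gcongr
      _ = κ / 5 := by simp only [η₂]; field_simp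
  obtain ⟨T₀, hT₀, hT₀fin, hcover⟩ := h𝒳.finite_cover_balls hη
  set T := T₀ ∪ Set.range x
  have hTfin : T.Finite := hT₀fin.union (Set.finite_range x)
  have hT𝒳 : ∀ z ∈ T, z ∈ 𝒳 := by
    rintro z (hz | ⟨i, rfl⟩)
    exacts [hT₀ hz, hx i]
  have : Fintype T := hTfin.fintype
  set δ := min 1 (min ρ (κ / 10))
  have hδ : 0 < δ := lt_min one_pos (lt_min hρ (by positivity))
  have hδ1 : δ ≤ 1 := min_le_left _ _
  have hδρ : δ ≤ ρ := (min_le_right _ _).trans (min_le_left _ _)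
  have hδκ : δ ≤ κ / 10 := (min_le_right _ _).trans (min_le_right _ _)
  obtain ⟨C, hE⟩ := exists_average_event (ν := neuronLaw d) (ι := Unit ⊕ T ⊕ T × Fin n)
    (X := Sum.elim (fun _ ω => neuronSize ω ^ 4)
      (Sum.elim (fun z => kinkSample ρ z) fun zj => kernelSample zj.1 (x zj.2)))
    (by
      rintro (_ | z | zj)
      · exact continuous_neuronSize.measurable.pow_const 4
      · exact measurable_kinkSample ρ _
      · exact measurable_kernelSample _ _)
    (by
      rintro (_ | z | zj)
      · refine memLp_of_abs_le_neuronSize_pow (c := 1) (k := 4)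
          (continuous_neuronSize.measurable.pow_const 4) fun ω => ?_
        have : 0 ≤ neuronSize ω := zero_le_one.trans (one_le_neuronSize ω)
        simp only [Sum.elim_inl]
        rw [abs_of_nonneg (by positivity), one_mul]
      · exact memLp_of_abs_le_neuronSize_pow (measurable_kinkSample ρ _) (abs_kinkSample_le ρ _)
      · exact memLp_of_abs_le_neuronSize_pow (measurable_kernelSample _ _)
          (abs_kernelSample_le _ _))
    hδ
  refine ⟨C, ?_⟩
  filter_upwards [eventually_gt_atTop 0, eventually_le_of_sqrt F
    ((5 + 2 / ρ) * (2 * β + R ^ 2)) (2 * R ^ 2) (κ / 5) (by positivity)] with m hm hmR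
  obtain ⟨E, hEm, hEprob, hE⟩ := hE m hm
  refine ⟨E, hEm, hEprob, fun ω hω v hv z hz j s s' hs hs' => ?_⟩
  obtain ⟨z₀, hz₀, hzz⟩ := Set.mem_iUnion₂.1 (hcover hz)
  rw [Metric.mem_ball, dist_eq_norm] at hzz
  have hz₀T : z₀ ∈ T := Or.inl hz₀
  have hxT : x j ∈ T := Or.inr ⟨j, rfl⟩
  have hB : 1 / (m : ℝ) * ∑ k, neuronSize (ω k) ^ 4 ≤ β := by
    have h := (abs_lt.1 (hE ω hω (Sum.inl ()))).2
    simp only [Sum.elim_inl] at h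
    simp only [β]
    linarith
  have hV : ∀ z₁ ∈ T, 1 / (m : ℝ) * ∑ k, (ω k).1 ^ 2 * nearZero ρ (hiddenPreact (ω k).2 z₁)
      ≤ 2 * ρ := by
    intro z₁ hz₁
    have h := (abs_lt.1 (hE ω hω (Sum.inr (Sum.inl ⟨z₁, hz₁⟩)))).2
    simp only [Sum.elim_inl, Sum.elim_inr] at h
    have h2 := integral_kinkSample_le hρ.le z₁
    simp only [kinkSample] at h h2
    linarith
  have hK : |2 * (1 / (m : ℝ) * ∑ k, kernelSample z₀ (x j) (ω k)) + 1 - ntk z₀ (x j)| ≤ κ / 5 := by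
    have h := hE ω hω (Sum.inr (Sum.inr (⟨z₀, hz₀T⟩, j)))
    simp only [Sum.elim_inr] at h
    rw [← integral_kernelSample z₀ (x j), add_sub_add_right_eq_sub, ← mul_sub, abs_mul, abs_two]
    linarith
  have hM := hmod z hz z₀ (hT𝒳 z₀ hz₀T) (hzz.trans_le (min_le_left _ _)) j
  have hP := abs_inner_gradVec_sub_le hm hc1 hρ hη1 hv (hc z hz) (hc z₀ (hT𝒳 z₀ hz₀T))
    (hc (x j) (hx j)) hzz.le hs hs' hB (hV z₀ hz₀T) (hV (x j) hxT)
  have hρF : F * (4 * (2 * ρ)) = κ / 5 := by simp only [ρ]; field_simp; norm_num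
  have hsum : F * ((5 + 2 / ρ) * (2 * β + R ^ 2) / √m + 2 * R ^ 2 / m + (4 + 2 / ρ) * η * β
      + 4 * (2 * ρ)) ≤ 3 * (κ / 5) := by
    have e : F * ((5 + 2 / ρ) * (2 * β + R ^ 2) / √m + 2 * R ^ 2 / m + (4 + 2 / ρ) * η * β
        + 4 * (2 * ρ)) = F * ((5 + 2 / ρ) * (2 * β + R ^ 2) / √m + 2 * R ^ 2 / m)
        + F * ((4 + 2 / ρ) * η * β) + F * (4 * (2 * ρ)) := by ring
    rw [e, hρF]
    linarith
  have h1 := abs_le.1 (hP.trans hsum)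
  have h2 := abs_le.1 hK
  have h3 := abs_le.1 hM
  rw [abs_le]
  constructor <;> linarith [h1.1, h1.2, h2.1, h2.2, h3.1, h3.2]

end Typical

end

end WideReLU

theorem proposition2 {d n : ℕ} (hn : 0 < n)
    (𝒳 : Set (WideReLU.Input d)) (h𝒳 : IsCompact 𝒳)
    (x : Fin n → WideReLU.Input d) (hx : ∀ i, x i ∈ 𝒳) (hinj : Function.Injective x)
    (y : Fin n → ℝ) :
    ∃ p : ℕ → ℝ, Tendsto p atTop (𝓝 0) ∧
      ∀ ε : ℝ, 0 < ε → ∃ M : ℕ, ∀ m : ℕ, M ≤ m →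
        ∃ E : Set (WideReLU.InitSample d m), MeasurableSet E ∧
          1 - p m ≤ (WideReLU.initLaw d m).real E ∧
          ∀ ω ∈ E,
            (∃ θ : ℝ → WideReLU.Params (m + m) d,
              θ 0 = WideReLU.mirroredInit ω ∧ WideReLU.IsGradientFlow x y θ) ∧
            ∀ θ : ℝ → WideReLU.Params (m + m) d,
              θ 0 = WideReLU.mirroredInit ω → WideReLU.IsGradientFlow x y θ →
              ∀ t : ℝ, 0 ≤ t → ∀ z ∈ 𝒳,
                |WideReLU.network (θ t) z - WideReLU.ntkRegression x y t z| ≤ ε := by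
  obtain ⟨lam, hlam, hcoer⟩ := WideReLU.exists_coercive hn hinj
  have hn0 : (0 : ℝ) < n := by exact_mod_cast hn
  have hL : ∃ L : ℝ, 0 ≤ L ∧ ∀ z ∈ 𝒳, ∀ j, |WideReLU.ntk z (x j)| ≤ L := by
    have hc : Continuous fun (z : WideReLU.Input d) (j : Fin n) => WideReLU.ntk z (x j) :=
      continuous_pi fun j => WideReLU.continuous_ntk (x j)
    obtain ⟨L, hL⟩ := h𝒳.exists_bound_of_continuousOn hc.continuousOn
    refine ⟨L, (norm_nonneg _).trans (hL (x ⟨0, hn⟩) (hx _)), fun z hz j => ?_⟩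
    exact (norm_le_pi_norm (fun j => WideReLU.ntk z (x j)) j).trans (hL z hz)
  obtain ⟨L, hL0, hL⟩ := hL
  set Y := √(∑ i, y i ^ 2)
  have hY : 0 ≤ Y := Real.sqrt_nonneg _
  have hYsq : ∑ i, y i ^ 2 ≤ Y ^ 2 :=
    (Real.sq_sqrt (Finset.sum_nonneg fun i _ => sq_nonneg (y i))).ge
  set R := 4 * n * (L + 1) * Y / lam + 1
  have hR0 : 0 ≤ 4 * n * (L + 1) * Y / lam := by positivity
  set B := (Y + L * (2 * (n / lam) * Y)) * (4 * n / lam)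
  have hB : 0 ≤ B := by positivity
  refine ⟨fun m => 1 / √(m : ℝ), tendsto_const_nhds.div_atTop
    (Real.tendsto_sqrt_atTop.comp tendsto_natCast_atTop_atTop), fun ε hε => ?_⟩
  set κ := min (min 1 (lam / 2 / n)) (ε / (B + 1))
  have hκ : 0 < κ := lt_min (lt_min one_pos (by positivity)) (by positivity)
  have hκ1 : κ ≤ 1 := (min_le_left _ _).trans (min_le_left _ _)
  have hκ2 : n * κ ≤ lam / 2 := by
    have h : κ ≤ lam / 2 / n := (min_le_left _ _).trans (min_le_right _ _)
    rw [mul_comm]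
    exact (le_div_iff₀ hn0).1 h
  have hκB : κ * B ≤ ε := by
    have h : κ ≤ ε / (B + 1) := min_le_right _ _
    have h1 := (le_div_iff₀ (by positivity)).1 h
    nlinarith
  obtain ⟨C, hC⟩ := WideReLU.exists_nearKernel_event h𝒳 hx hκ R
  have hsqrt : Tendsto (fun m : ℕ => √(m : ℝ)) atTop atTop :=
    Real.tendsto_sqrt_atTop.comp tendsto_natCast_atTop_atTop
  obtain ⟨M, hM⟩ := eventually_atTop.1
    (hC.and ((hsqrt.eventually_ge_atTop C).and (eventually_gt_atTop 0)))
  refine ⟨M, fun m hm => ?_⟩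
  obtain ⟨⟨E, hEm, hEp, hE⟩, hCm, hm0⟩ := hM m hm
  refine ⟨E, hEm, le_trans ?_ hEp, fun ω hω => ?_⟩
  · have hm1 : (0 : ℝ) < m := by exact_mod_cast hm0
    have hs : 0 < √(m : ℝ) := Real.sqrt_pos.2 hm1
    have h : C / m ≤ 1 / √(m : ℝ) := by
      rw [div_le_div_iff₀ hm1 hs, one_mul]
      calc C * √(m : ℝ) ≤ √(m : ℝ) * √(m : ℝ) := mul_le_mul_of_nonneg_right hCm hs.le
        _ = m := Real.mul_self_sqrt hm1.le
    linarith
  have S : WideReLU.LazySetting x y 𝒳 (WideReLU.toSpace (WideReLU.mirroredInit ω)) lam L Y R κ :=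
    { n_pos := hn
      mem := hx
      lam_pos := hlam
      coercive := hcoer
      bound := hL
      Y_nonneg := hY
      sum_sq_le := hYsq
      κ_nonneg := hκ.le
      κ_le_one := hκ1
      κ_le := hκ2
      R_pos := by positivity
      R_ge := by
        have e : 2 * n * (L + 1) * Y / lam = (4 * n * (L + 1) * Y / lam) / 2 := by ring
        rw [e]
        linarith
      near := hE ω hω
      network_init := fun z => by
        rw [WideReLU.ofSpace_toSpace]
        exact WideReLU.network_mirroredInit ω z }
  obtain ⟨h1, h2⟩ := S.gradientFlow
  exact ⟨h1, fun θ hθ0 hθ t ht z hz => (h2 θ hθ0 hθ t ht z hz).trans hκB⟩
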